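/- Let $a,\gamma,T>0$ and let $V(r)=a(e^{-r}-1)+ar$ be the Toda potential. For configurations $(r_x,p_x)_{x\in\mathbb Z}\in(\mathbb R\times\mathbb R)^{\mathbb Z}$ let $\mu$ be the Gibbs measure at temperature $T$ and zero pressure, i.e. the product measure under which all $r_x,p_x$ are independent, $r_x$ has density proportional to $e^{-V(r)/T}$ and $p_x$ is centred Gaussian with variance $T$. Let $\theta_z$ denote the shift by $z$, and let $\mathcal H$ be the Hilbert space obtained by completing the local square-integrable functions (functions of finitely many coordinates) for the semi-inner product $$\ll f,g\gg\;=\;\sum_{z\in\mathbb Z}\big\{\mu(f\,\theta_z g)-\mu(f)\mu(g)\big\}.$$ On the set $C_0^2$ of compactly supported local $C^2$ functions let $\mathfrak L'=\mathfrak A+\gamma(\mathfrak S+\mathfrak S')$, where $$\mathfrak A f=\sum_{x}\big[(p_x-p_{x-1})\partial_{r_x}f+(V'(r_{x+1})-V'(r_x))\partial_{p_x}f\big],\qquad \mathfrak S f(\omega)=\sum_x\,[f(\omega^x)-f(\omega)],$$ $$\mathfrak S' f=\tfrac12\sum_x\,(p_{x+1}\partial_{p_x}-p_x\partial_{p_{x+1}})^2f,$$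 and $\omega^x$ is $\omega$ with the sign of $p_x$ reversed. Assume that $\mathfrak L'$ generates a strongly continuous semigroup on $\mathcal H$ with $C_0^2$ as a core; that is, the generator of the semigroup, again denoted by $\mathfrak L'$, is the closure of the operator just defined on $C_0^2$. Let $j_{0,1}=-p_0V'(r_1)$ be the energy current. Then $(\lambda-\mathfrak L')^{-1}j_{0,1}$ exists for every $\lambda>0$, the limit $$\kappa'(T)=\gamma+T^{-2}\lim_{\lambda\downarrow0}\ll j_{0,1},(\lambda-\mathfrak L')^{-1}j_{0,1}\gg$$ exists, and $$\gamma+\Big[\frac{6\gamma}{a}+\frac{2T}{\gamma a}\Big]^{-1}\;\le\;\kappa'(T)\;\le\;\gamma+\frac{a}{6\gamma}.$$ -/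

import Mathlib

open MeasureTheory ProbabilityTheory Filter Topology

/-! Infinite one-dimensional chains of oscillators at equilibrium, at zero pressure. -/

namespace OscillatorChain

noncomputable section

/-- A configuration of the infinite chain: `ω x = (r_x, p_x)`, the interparticle distance and the
momentum at the site `x`. -/
abbrev Config : Type := ℤ → ℝ × ℝ

/-- The shift: `(θ_z ω)_x = ω_{x + z}`. -/
def shift (z : ℤ) (ω : Config) : Config := fun x => ω (x + z)

/-- The data of a chain: the interaction potential `V`, the temperature `T`, the strength `γ` of
the noise. The Boltzmann weight is integrable, so that Gibbs measures exist. -/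
structure Chain where
  V : ℝ → ℝ
  T : ℝ
  γ : ℝ
  T_pos : 0 < T
  γ_pos : 0 < γ
  integrable_boltzmann : Integrable (fun r : ℝ => Real.exp (-V r / T))

/-! ### Gibbs measure -/

/-- The law of `r_x` at zero pressure: density `exp (-V r / T) / Z`. -/
def Chain.lawR (c : Chain) : Measure ℝ := volume.tilted (fun r => -c.V r / c.T)

/-- The law of `p_x`: centred Gaussian with variance `T`. -/
def Chain.lawP (c : Chain) : Measure ℝ := gaussianReal 0 c.T.toNNReal

instance (c : Chain) : IsProbabilityMeasure c.lawR :=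
  isProbabilityMeasure_tilted c.integrable_boltzmann

instance (c : Chain) : IsProbabilityMeasure c.lawP := by
  unfold Chain.lawP; infer_instance

/-- The infinite volume Gibbs measure `μ_{0,T}` with pressure `0` and temperature `T`. -/
def Chain.gibbs (c : Chain) : Measure Config :=
  Measure.infinitePi (fun _ : ℤ => c.lawR.prod c.lawP)

instance (c : Chain) : IsProbabilityMeasure c.gibbs := by
  unfold Chain.gibbs; infer_instance

/-! ### Local functions and the Hilbert space -/

/-- Local (depending on finitely many sites) square integrable functions. -/
def Chain.localSubmodule (c : Chain) : Submodule ℝ (Config → ℝ) where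
  carrier := {f | Measurable f ∧ (∃ Λ : Finset ℤ, DependsOn f (Λ : Set ℤ)) ∧ MemLp f 2 c.gibbs}
  zero_mem' := ⟨measurable_const, ⟨∅, fun _ _ _ => rfl⟩, MemLp.zero⟩
  add_mem' := by
    rintro f g ⟨hf, ⟨Λ, hΛ⟩, hf2⟩ ⟨hg, ⟨Λ', hΛ'⟩, hg2⟩
    refine ⟨hf.add hg, ⟨Λ ∪ Λ', fun x y h => ?_⟩, hf2.add hg2⟩
    have h1 := hΛ (x := x) (y := y) fun i hi => h i (by simp [Finset.mem_coe.1 hi])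
    have h2 := hΛ' (x := x) (y := y) fun i hi => h i (by simp [Finset.mem_coe.1 hi])
    simp [h1, h2]
  smul_mem' := by
    rintro a f ⟨hf, ⟨Λ, hΛ⟩, hf2⟩
    refine ⟨hf.const_smul a, ⟨Λ, fun x y h => ?_⟩, hf2.const_smul a⟩
    simp [hΛ h]

/-- The space of local square integrable functions, as a type of its own: its norm and topology
are those of the semi-inner product below, not those of `Config → ℝ`. -/
def Chain.LocalFun (c : Chain) : Type := c.localSubmodule

instance (c : Chain) : AddCommGroup c.LocalFun := inferInstanceAs (AddCommGroup c.localSubmodule)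

instance (c : Chain) : Module ℝ c.LocalFun := inferInstanceAs (Module ℝ c.localSubmodule)

/-- The function underlying an element of `LocalFun`. -/
def Chain.LocalFun.fn {c : Chain} (f : c.LocalFun) : Config → ℝ := c.localSubmodule.subtype f

instance (c : Chain) : CoeFun c.LocalFun (fun _ => Config → ℝ) := ⟨Chain.LocalFun.fn⟩

/-- The semi-inner product `≪f, g≫ = ∑_z { μ(f θ_z g) - μ(f) μ(g) }`; for local `f` and `g` the
sum has finitely many nonzero terms. -/
def Chain.semiInner (c : Chain) (f g : Config → ℝ) : ℝ :=
  ∑' z : ℤ, ((∫ ω, f ω * g (shift z ω) ∂c.gibbs) - (∫ ω, f ω ∂c.gibbs) * ∫ ω, g ω ∂c.gibbs)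

section Helpers

variable (c : Chain)

lemma measurable_shift (z : ℤ) : Measurable (shift z) := by
  unfold shift; fun_prop

lemma measurePreserving_shift (z : ℤ) : MeasurePreserving (shift z) c.gibbs c.gibbs := by
  refine ⟨measurable_shift z, ?_⟩
  unfold Chain.gibbs
  refine Measure.eq_infinitePi _ fun s t ht => ?_
  rw [Measure.map_apply (measurable_shift z)
    (MeasurableSet.pi s.countable_toSet fun i _ => ht i)]
  have : shift z ⁻¹' ((s : Set ℤ).pi t)
      = ((s.map (Equiv.addRight z).toEmbedding : Finset ℤ) : Set ℤ).pi (fun i => t (i - z)) := by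
    ext ω
    simp only [shift, Set.mem_preimage, Set.mem_pi, Finset.mem_coe, Finset.mem_map,
      Equiv.coe_toEmbedding, Equiv.coe_addRight]
    constructor
    · rintro h _ ⟨i, hi, rfl⟩
      simpa using h i hi
    · intro h i hi
      simpa using h (i + z) ⟨i, hi, rfl⟩
  rw [this, Measure.infinitePi_pi _ (fun i _ => ht _)]
  simp

lemma LocalFun.mem (f : c.LocalFun) : Measurable f ∧
    (∃ Λ : Finset ℤ, DependsOn f (Λ : Set ℤ)) ∧ MemLp f 2 c.gibbs :=
  Subtype.property (p := fun g => g ∈ c.localSubmodule) f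

lemma LocalFun.memLp (f : c.LocalFun) : MemLp f 2 c.gibbs := (LocalFun.mem c f).2.2

lemma LocalFun.measurable (f : c.LocalFun) : Measurable f := (LocalFun.mem c f).1

lemma LocalFun.memLp_shift (f : c.LocalFun) (z : ℤ) : MemLp (f ∘ shift z) 2 c.gibbs :=
  (LocalFun.memLp c f).comp_measurePreserving (measurePreserving_shift c z)

lemma shift_shift (y z : ℤ) (ω : Config) : shift y (shift z ω) = shift (y + z) ω := by
  funext x; simp [shift, add_assoc]

/-- The terms of the semi-inner product. -/
def corr (f g : c.LocalFun) (z : ℤ) : ℝ := covariance f (g ∘ shift z) c.gibbs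

lemma semiInner_eq (f g : c.LocalFun) : c.semiInner f g = ∑' z, corr c f g z := by
  unfold Chain.semiInner corr
  congr 1
  funext z
  rw [covariance_eq_sub (LocalFun.memLp c f) (LocalFun.memLp_shift c g z)]
  congr 2
  have h := (measurePreserving_shift c z).map_eq
  conv_lhs => rw [← h]
  rw [integral_map (measurable_shift z).aemeasurable]
  · rfl
  · exact (LocalFun.measurable c g).aestronglyMeasurable

lemma cov_shift_shift (f g : c.LocalFun) (y z : ℤ) :
    covariance (f ∘ shift y) (g ∘ shift z) c.gibbs = corr c f g (z - y) := by
  have h := (measurePreserving_shift c y).map_eq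
  unfold corr
  conv_rhs => rw [← h]
  rw [covariance_map]
  · congr 1
    funext ω
    simp [shift_shift]
  · exact (LocalFun.measurable c f).aestronglyMeasurable
  · exact ((LocalFun.measurable c g).comp (measurable_shift _)).aestronglyMeasurable
  · exact (measurable_shift y).aemeasurable

lemma corr_comm (f g : c.LocalFun) (z : ℤ) : corr c f g z = corr c g f (-z) := by
  have h := cov_shift_shift c f g 0 z
  have h' := cov_shift_shift c g f z 0
  rw [covariance_comm] at h'
  simp only [sub_zero, zero_sub] at h h'
  rw [← h, h']

lemma indep_of_disjoint {f g : Config → ℝ} (hf : Measurable f) (hg : Measurable g)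
    {S S' : Finset ℤ} (hS : DependsOn f (S : Set ℤ)) (hS' : DependsOn g (S' : Set ℤ))
    (h : Disjoint S S') : IndepFun f g c.gibbs := by
  have hi : iIndepFun (fun (i : ℤ) (ω : Config) => ω i) c.gibbs :=
    iIndepFun_infinitePi (P := fun _ : ℤ => c.lawR.prod c.lawP) (X := fun _ ω => ω)
      (fun _ => measurable_id)
  have h1 := hi.indepFun_finset S S' h (fun i => measurable_pi_apply i)
  let ext (R : Finset ℤ) (v : R → ℝ × ℝ) : Config :=
    fun x => if hx : x ∈ R then v ⟨x, hx⟩ else 0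
  have hext : ∀ R : Finset ℤ, Measurable (ext R) := fun R => by
    refine measurable_pi_lambda _ fun x => ?_
    by_cases hx : x ∈ R
    · simpa [ext, hx] using measurable_pi_apply _
    · simp [ext, hx]
  have h2 := h1.comp (hf.comp (hext S)) (hg.comp (hext S'))
  have e1 : (f ∘ ext S) ∘ (fun (ω : Config) (i : S) => ω i) = f := by
    funext ω
    exact hS fun i hi => by simp [ext, Finset.mem_coe.1 hi]
  have e2 : (g ∘ ext S') ∘ (fun (ω : Config) (i : S') => ω i) = g := by
    funext ω
    exact hS' fun i hi => by simp [ext, Finset.mem_coe.1 hi]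
  rwa [e1, e2] at h2

lemma corr_eventually_zero (f g : c.LocalFun) :
    ∃ K : ℕ, ∀ z : ℤ, K < |z| → corr c f g z = 0 := by
  obtain ⟨S, hS⟩ := (LocalFun.mem c f).2.1
  obtain ⟨S', hS'⟩ := (LocalFun.mem c g).2.1
  refine ⟨(∑ x ∈ S, x.natAbs) + ∑ x ∈ S', x.natAbs, fun z hz => ?_⟩
  have hd : DependsOn (g ∘ shift z) ((S'.map (Equiv.addRight z).toEmbedding : Finset ℤ) : Set ℤ) :=
    fun x y hxy => hS' fun i hi => hxy (i + z) (by simpa using hi)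
  refine (indep_of_disjoint c (LocalFun.measurable c f) ((LocalFun.measurable c g).comp (measurable_shift z)) hS hd ?_).covariance_eq_zero
    (LocalFun.memLp c f) (LocalFun.memLp_shift c g z)
  rw [Finset.disjoint_left]
  rintro x hx hx'
  obtain ⟨y, hy, rfl⟩ := Finset.mem_map.1 hx'
  simp only [Equiv.coe_toEmbedding, Equiv.coe_addRight] at hx
  rw [Int.abs_eq_natAbs] at hz
  have h1 := Finset.single_le_sum (f := fun x : ℤ => x.natAbs) (fun _ _ => Nat.zero_le _) hx
  have h2 := Finset.single_le_sum (f := fun x : ℤ => x.natAbs) (fun _ _ => Nat.zero_le _) hy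
  omega

lemma summable_corr (f g : c.LocalFun) : Summable (corr c f g) := by
  obtain ⟨K, hK⟩ := corr_eventually_zero c f g
  refine summable_of_ne_finset_zero (s := Finset.Icc (-(K : ℤ)) K) fun z hz => hK z ?_
  rw [Finset.mem_Icc, ← abs_le] at hz
  exact not_le.1 hz

lemma semiInner_comm (f g : c.LocalFun) : c.semiInner f g = c.semiInner g f := by
  rw [semiInner_eq, semiInner_eq, ← (Equiv.neg ℤ).tsum_eq (corr c g f)]
  exact tsum_congr fun z => corr_comm c f g z

lemma semiInner_add_left (f g h : c.LocalFun) :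
    c.semiInner (f + g : c.LocalFun) h = c.semiInner f h + c.semiInner g h := by
  rw [semiInner_eq, semiInner_eq, semiInner_eq,
    ← (summable_corr c f h).tsum_add (summable_corr c g h)]
  exact tsum_congr fun z => covariance_add_left (LocalFun.memLp c f) (LocalFun.memLp c g)
    (LocalFun.memLp_shift c h z)

lemma semiInner_smul_left (f g : c.LocalFun) (a : ℝ) :
    c.semiInner (a • f : c.LocalFun) g = a * c.semiInner f g := by
  rw [semiInner_eq, semiInner_eq, ← tsum_mul_left]
  exact tsum_congr fun z => covariance_smul_left a

/-- Positivity: the semi-inner product is the rate of growth of the variance of `∑_{i < n} θ_i f`. -/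
lemma semiInner_self_nonneg (f : c.LocalFun) : 0 ≤ c.semiInner f f := by
  obtain ⟨K, hK⟩ := corr_eventually_zero c f f
  set B := c.semiInner f f with hB
  let F : ℕ → Config → ℝ := fun n => ∑ i ∈ Finset.range n, f ∘ shift i
  have hF : ∀ n, MemLp (F n) 2 c.gibbs := fun n =>
    memLp_finsetSum' _ fun i _ => LocalFun.memLp_shift c f i
  have hBsum : ∀ n : ℕ, K ≤ n →
      B = corr c f f 0 + 2 * ∑ i ∈ Finset.range n, corr c f f (n - i) := by
    intro n hn
    have hsupp : B = ∑ z ∈ Finset.Icc (-(n : ℤ)) n, corr c f f z := by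
      rw [hB, semiInner_eq]
      refine tsum_eq_sum fun z hz => hK z ?_
      rw [Finset.mem_Icc, ← abs_le] at hz
      have := not_le.1 hz
      omega
    have hIcc : ∀ m : ℕ, ∑ z ∈ Finset.Icc (-(m : ℤ)) m, corr c f f z
        = corr c f f 0 + 2 * ∑ i ∈ Finset.range m, corr c f f ((i : ℤ) + 1) := by
      intro m
      induction m with
      | zero => simp
      | succ m ih =>
        have e : Finset.Icc (-((m + 1 : ℕ) : ℤ)) ((m + 1 : ℕ) : ℤ)
            = insert (-((m : ℤ) + 1)) (insert ((m : ℤ) + 1) (Finset.Icc (-(m : ℤ)) m)) := by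
          ext z
          simp only [Finset.mem_Icc, Finset.mem_insert]
          push_cast
          omega
        rw [e, Finset.sum_insert, Finset.sum_insert, ih, Finset.sum_range_succ,
          corr_comm c f f (-((m : ℤ) + 1)), neg_neg]
        · ring
        · simp
        · simp only [Finset.mem_insert, Finset.mem_Icc]
          omega
    rw [hsupp, hIcc n]
    congr 2
    rw [← Finset.sum_range_reflect]
    refine Finset.sum_congr rfl fun i hi => ?_
    congr 1
    have := Finset.mem_range.1 hi
    omega
  have hstep : ∀ n : ℕ, covariance (F (n + 1)) (F (n + 1)) c.gibbs
      = covariance (F n) (F n) c.gibbs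
        + (corr c f f 0 + 2 * ∑ i ∈ Finset.range n, corr c f f (n - i)) := by
    intro n
    have e : F (n + 1) = F n + f ∘ shift n := Finset.sum_range_succ _ n
    have hs := LocalFun.memLp_shift c f n
    rw [e, covariance_add_left (hF n) hs ((hF n).add hs), covariance_add_right (hF n) (hF n) hs,
      covariance_add_right hs (hF n) hs, covariance_comm (f ∘ shift n) (F n), cov_shift_shift]
    have : covariance (F n) (f ∘ shift n) c.gibbs
        = ∑ i ∈ Finset.range n, corr c f f (n - i) := by
      simp only [F]
      rw [covariance_sum_left' (fun (i : ℕ) _ => LocalFun.memLp_shift c f i) hs]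
      exact Finset.sum_congr rfl fun i _ => cov_shift_shift c f f i n
    rw [this, sub_self]
    ring
  have hlin : ∀ m : ℕ, covariance (F (K + m)) (F (K + m)) c.gibbs
      = covariance (F K) (F K) c.gibbs + m * B := by
    intro m
    induction m with
    | zero => simp
    | succ m ih =>
      rw [← add_assoc, hstep, ih, ← hBsum (K + m) (by omega)]
      push_cast
      ring
  by_contra hneg
  push Not at hneg
  obtain ⟨m, hm⟩ := exists_nat_gt (covariance (F K) (F K) c.gibbs / (-B))
  have h1 := hlin m
  have h2 : 0 ≤ covariance (F (K + m)) (F (K + m)) c.gibbs := by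
    rw [covariance_self (hF _).aestronglyMeasurable.aemeasurable]
    exact variance_nonneg _ _
  rw [div_lt_iff₀ (by linarith)] at hm
  linarith

end Helpers

/-- The semi-inner product `≪·, ·≫` on local functions. -/
@[reducible] def Chain.core (c : Chain) : PreInnerProductSpace.Core ℝ c.LocalFun where
  inner f g := c.semiInner f g
  conj_inner_symm f g := semiInner_comm c g f
  re_inner_nonneg f := semiInner_self_nonneg c f
  add_left f g h := semiInner_add_left c f g h
  smul_left f g a := semiInner_smul_left c f g a

instance (c : Chain) : SeminormedAddCommGroup c.LocalFun :=
  @InnerProductSpace.Core.toSeminormedAddCommGroup ℝ _ _ _ _ c.core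

instance (c : Chain) : InnerProductSpace ℝ c.LocalFun :=
  InnerProductSpace.ofCore c.core

/-- The Hilbert space `ℋ_{0,T}`: the (Hausdorff) completion of the local functions with respect to
the semi-inner product `≪·, ·≫`. -/
abbrev Chain.H (c : Chain) : Type := UniformSpace.Completion c.LocalFun

/-- The class in `ℋ_{0,T}` of a local function. -/
def Chain.toH (c : Chain) (f : c.LocalFun) : c.H := (f : UniformSpace.Completion c.LocalFun)

/-! ### The generator on smooth local functions -/

/-- `∂f / ∂r_x`. -/
def dr (x : ℤ) (f : Config → ℝ) (ω : Config) : ℝ :=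
  deriv (fun s => f (Function.update ω x (s, (ω x).2))) (ω x).1

/-- `∂f / ∂p_x`. -/
def dp (x : ℤ) (f : Config → ℝ) (ω : Config) : ℝ :=
  deriv (fun s => f (Function.update ω x ((ω x).1, s))) (ω x).2

/-- `ω^x`: the momentum of the particle `x` is flipped. -/
def flipAt (x : ℤ) (ω : Config) : Config := Function.update ω x ((ω x).1, -(ω x).2)

/-- The Liouville operator
`𝔄 f = ∑_x { (p_x - p_{x-1}) ∂_{r_x} f + (V'(r_{x+1}) - V'(r_x)) ∂_{p_x} f }`. -/
def Chain.liouville (c : Chain) (f : Config → ℝ) (ω : Config) : ℝ :=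
  ∑' x : ℤ, (((ω x).2 - (ω (x - 1)).2) * dr x f ω
    + (deriv c.V (ω (x + 1)).1 - deriv c.V (ω x).1) * dp x f ω)

/-- The velocity flip noise `𝔖 f = ∑_x { f(ω^x) - f(ω) }`. -/
def flipNoise (f : Config → ℝ) (ω : Config) : ℝ := ∑' x : ℤ, (f (flipAt x ω) - f ω)

/-- The vector field `p_{x+1} ∂_{p_x} - p_x ∂_{p_{x+1}}`. -/
def rot (x : ℤ) (f : Config → ℝ) (ω : Config) : ℝ :=
  (ω (x + 1)).2 * dp x f ω - (ω x).2 * dp (x + 1) f ω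

/-- The exchange noise `𝔖' = (1/2) ∑_x (p_{x+1} ∂_{p_x} - p_x ∂_{p_{x+1}})²`. -/
def exchangeNoise (f : Config → ℝ) (ω : Config) : ℝ :=
  (1 / 2) * ∑' x : ℤ, rot x (rot x f) ω

/-- `𝔏' = 𝔄 + γ (𝔖 + 𝔖')`. -/
def Chain.gen (c : Chain) (f : Config → ℝ) (ω : Config) : ℝ :=
  c.liouville f ω + c.γ * (flipNoise f ω + exchangeNoise f ω)

/-- `C_0^k`: compactly supported local functions of class `C^k`. -/
def IsTestFunction (k : ℕ) (f : Config → ℝ) : Prop :=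
  ∃ (Λ : Finset ℤ) (F : (Λ → ℝ × ℝ) → ℝ),
    ContDiff ℝ k F ∧ HasCompactSupport F ∧ ∀ ω, f ω = F (fun x => ω x)

/-- The graph in `ℋ × ℋ` of the operator `𝔏'` with domain `C_0^2`. -/
def Chain.testGraph (c : Chain) : Set (c.H × c.H) :=
  {z | ∃ f g : c.LocalFun, IsTestFunction 2 f ∧ (∀ ω, g ω = c.gen f ω) ∧
    z = (c.toH f, c.toH g)}

/-! ### Semigroups and the conductivity -/

/-- A strongly continuous semigroup of bounded operators. -/
structure C0Semigroup (E : Type*) [NormedAddCommGroup E] [NormedSpace ℝ E] where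
  toFun : ℝ → E →L[ℝ] E
  map_zero : toFun 0 = ContinuousLinearMap.id ℝ E
  map_add : ∀ s t : ℝ, 0 ≤ s → 0 ≤ t → toFun (s + t) = (toFun s).comp (toFun t)
  continuousOn : ∀ u : E, ContinuousOn (fun t => toFun t u) (Set.Ici 0)

/-- The graph of the generator of a semigroup: the pairs `(u, v)` such that
`(P_t u - u) / t → v` as `t ↓ 0`. -/
def C0Semigroup.generatorGraph {E : Type*} [NormedAddCommGroup E] [NormedSpace ℝ E]
    (P : C0Semigroup E) : Set (E × E) :=
  {z | Tendsto (fun t : ℝ => t⁻¹ • (P.toFun t z.1 - z.1)) (𝓝[>] 0) (𝓝 z.2)}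

/-- `P` is the semigroup on `ℋ_{0,T}` of the dynamics generated by `𝔏'`: its generator coincides
with `𝔏'` on `C_0^2`, and `C_0^2` is dense in the domain of the generator for the graph norm. -/
def Chain.IsDynamics (c : Chain) (P : C0Semigroup c.H) : Prop :=
  P.generatorGraph = closure c.testGraph

/-- The energy current `j_{0,1} = -p_0 V'(r_1)`. -/
def Chain.current (c : Chain) (ω : Config) : ℝ := -(ω 0).2 * deriv c.V (ω 1).1

/-- The Green-Kubo conductivity of the dynamics exists and is equal to `κ`:
`j_{0,1}` is a local square integrable function, for every `l > 0` the resolvent equation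
`l u_l - 𝔏' u_l = j_{0,1}` has a solution `u_l` in the domain of the generator `𝔏'`, and
`γ + T⁻² ≪j_{0,1}, u_l≫` tends to `κ` as `l ↓ 0`. -/
def Chain.HasConductivity (c : Chain) (P : C0Semigroup c.H) (κ : ℝ) : Prop :=
  ∃ (J : c.LocalFun) (u v : ℝ → c.H), (∀ ω, J ω = c.current ω) ∧
    (∀ l : ℝ, 0 < l → (u l, v l) ∈ P.generatorGraph ∧ l • u l - v l = c.toH J) ∧
    Tendsto (fun l : ℝ => c.γ + (c.T ^ 2)⁻¹ * inner ℝ (c.toH J) (u l)) (𝓝[>] 0) (𝓝 κ)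

/-! ### The Toda lattice -/

/-- The Toda potential `V(r) = a (e^{-r} - 1) + a r`. -/
def todaPotential (a : ℝ) (r : ℝ) : ℝ := a * (Real.exp (-r) - 1) + a * r

lemma integrable_toda {a T : ℝ} (ha : 0 < a) (hT : 0 < T) :
    Integrable (fun r : ℝ => Real.exp (-todaPotential a r / T)) := by
  have hc : 0 < a / T := div_pos ha hT
  have hint : Integrable (fun r : ℝ => Real.exp (a / T) * Real.exp (-(a / T) * |r|)) := by
    refine Integrable.const_mul ?_ _
    rw [← integrableOn_univ, ← Set.Iic_union_Ioi (a := (0 : ℝ))]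
    refine IntegrableOn.union ?_ ?_
    · refine (integrableOn_exp_mul_Iic hc 0).congr_fun (fun r hr => ?_) measurableSet_Iic
      simp [abs_of_nonpos (Set.mem_Iic.1 hr)]
    · refine (integrableOn_exp_mul_Ioi (neg_lt_zero.2 hc) 0).congr_fun (fun r hr => ?_)
        measurableSet_Ioi
      simp [abs_of_pos (Set.mem_Ioi.1 hr)]
  refine hint.mono' ?_ (Eventually.of_forall fun r => ?_)
  · unfold todaPotential
    exact (by fun_prop : Continuous _).aestronglyMeasurable
  · rw [Real.norm_eq_abs, abs_of_pos (Real.exp_pos _), ← Real.exp_add, Real.exp_le_exp]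
    have key : |r| - 1 ≤ Real.exp (-r) - 1 + r := by
      rcases le_total 0 r with h | h
      · rw [abs_of_nonneg h]
        linarith [Real.exp_pos (-r)]
      · rw [abs_of_nonpos h]
        have := Real.quadratic_le_exp_of_nonneg (x := -r) (by linarith)
        nlinarith [sq_nonneg (r + 1)]
    have e : -todaPotential a r / T = -(a / T) * (Real.exp (-r) - 1 + r) := by
      unfold todaPotential
      field_simp
    rw [e]
    nlinarith

/-- The Toda lattice with parameter `a` at temperature `T`, with noise of strength `γ`. -/
def toda (a γ T : ℝ) (ha : 0 < a) (hγ : 0 < γ) (hT : 0 < T) : Chain where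
  V := todaPotential a
  T := T
  γ := γ
  T_pos := hT
  γ_pos := hγ
  integrable_boltzmann := integrable_toda ha hT

end

end OscillatorChain

/-! Write `L` for `𝔏'`, `j` for the energy current, `u_l` for the solution of `l u - L u = j`, and
`D(f) = -≪f, L f≫`. For the Gibbs measure the Liouville part is antisymmetric and the noise
symmetric, so `D(f)` is `γ/2` times the sum of the mean squares of `gradFlip f` and `gradRot f`: the
effect of one momentum flip and of one momentum rotation on the formal sum of all translates of `f`.
Every relation used below is proved on test functions and is a closed condition on pairs `(f, L f)`;
it therefore passes to the generator, whose graph is the closure of the test graph.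

Existence of the limit. Since `D ≥ 0`, the semigroup is contractive and the resolvent exists on `(0,
∞)`. Let `R` be the reversal of all momenta. It conjugates `L` to its formal adjoint, `R j = -j`,
and reversing the momenta site by site gives `D(f) ≥ (γ/2) ‖f - R f‖²`. Hence `‖u_l - R u_l‖` is
bounded uniformly in `l`. The resolvent identity gives `d/dl ≪j, u_l≫ = ≪R u_l, u_l≫ = ‖u_l‖² - ‖u_l
- R u_l‖² / 2`, which is bounded below by some `-C`. So `≪j, u_l≫ + C l` is nondecreasing and
nonnegative, and it converges to a limit `A` as `l ↓ 0` (`exists_tendsto_inner_resolvent`).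

Bounds. Spatial gradients vanish in `ℋ`, and modulo them `j = (k + b) / 2` with `k = -p_0 (V'(r_0) +
V'(r_1))` and `b = 𝔄 V(r_1)`. The noise multiplies `k` by `-3γ`. The Toda identity `V'' = a - V'`
gives `𝔄 k = m` modulo gradients, with `m = V'(r_1) (p_1² - p_0²)`. Pairing the resolvent equation
with `V(r_1)` shows `≪b, u_l≫ → 0`, so `A = lim ≪k, u_l≫ / 2`. Pairing it with `k` shows `3γ ≪k,
u_l≫ + ≪m, u_l≫ → ≪k, j≫ = T² a`. Both `k` and `m` are divergences for the flip and rotation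
gradients, so Cauchy-Schwarz (`Chain.Adm2.sq_pairing_le`) bounds the squares of these pairings by
multiples of `D(u_l) ≤ ≪j, u_l≫`. The first gives `A² ≤ const * A`, the upper bound; the second
gives `(T² a)² ≤ const * A`, the lower bound. -/

namespace OscillatorChain

/-! ### Strongly continuous semigroups with a dissipative generator. -/

section Semigroup

variable {E : Type*} [NormedAddCommGroup E] [InnerProductSpace ℝ E]

namespace C0Semigroup

lemma generatorGraph_add (P : C0Semigroup E) {u v u' v' : E} (h : (u, v) ∈ P.generatorGraph)
    (h' : (u', v') ∈ P.generatorGraph) : (u + u', v + v') ∈ P.generatorGraph := by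
  have := Tendsto.add h h'
  refine this.congr fun t => ?_
  simp only [_root_.map_add, ← smul_add]
  congr 1
  abel

lemma generatorGraph_smul (P : C0Semigroup E) {u v : E} (h : (u, v) ∈ P.generatorGraph) (a : ℝ) :
    (a • u, a • v) ∈ P.generatorGraph := by
  have := Tendsto.const_smul h a
  refine this.congr fun t => ?_
  simp only [map_smul, ← smul_sub]
  rw [smul_comm]

lemma generatorGraph_sub (P : C0Semigroup E) {u v u' v' : E} (h : (u, v) ∈ P.generatorGraph)
    (h' : (u', v') ∈ P.generatorGraph) : (u - u', v - v') ∈ P.generatorGraph := by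
  have := P.generatorGraph_add h (P.generatorGraph_smul h' (-1))
  simpa [sub_eq_add_neg] using this

lemma tendsto_orbit_slope (P : C0Semigroup E) {u v : E} (h : (u, v) ∈ P.generatorGraph)
    {t : ℝ} (ht : 0 ≤ t) :
    Tendsto (fun s : ℝ => s⁻¹ • (P.toFun (t + s) u - P.toFun t u)) (𝓝[>] 0)
      (𝓝 (P.toFun t v)) := by
  have := ((P.toFun t).continuous.tendsto v).comp h
  refine this.congr' ?_
  filter_upwards [self_mem_nhdsWithin] with s hs
  simp [P.map_add t s ht (le_of_lt hs)]

lemma orbit_mem (P : C0Semigroup E) {u v : E} (h : (u, v) ∈ P.generatorGraph)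
    {t : ℝ} (ht : 0 ≤ t) : (P.toFun t u, P.toFun t v) ∈ P.generatorGraph := by
  refine (P.tendsto_orbit_slope h ht).congr' ?_
  filter_upwards [self_mem_nhdsWithin] with s hs
  simp [add_comm t s, P.map_add s t (le_of_lt hs) ht]

/-- The right derivative suffices for comparing norms along the orbit, and it comes from the
semigroup law without any local bound on `‖P.toFun t‖`. -/
lemma hasDerivWithinAt_orbit (P : C0Semigroup E) {u v : E} (h : (u, v) ∈ P.generatorGraph)
    {t : ℝ} (ht : 0 ≤ t) :
    HasDerivWithinAt (fun s => P.toFun s u) (P.toFun t v) (Set.Ici t) t := by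
  rw [hasDerivWithinAt_iff_tendsto_slope]
  have e : Set.Ici t \ {t} = Set.Ioi t := by ext; simp [lt_iff_le_and_ne]
  rw [e]
  have hs : Tendsto (fun s : ℝ => s - t) (𝓝[>] t) (𝓝[>] 0) := by
    refine tendsto_nhdsWithin_iff.2 ⟨?_, ?_⟩
    · have : Tendsto (fun s : ℝ => s - t) (𝓝 t) (𝓝 (t - t)) :=
        (continuous_id.sub continuous_const).tendsto t
      rw [sub_self] at this
      exact this.mono_left nhdsWithin_le_nhds
    · filter_upwards [self_mem_nhdsWithin] with s hs
      simpa using hs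
  refine ((P.tendsto_orbit_slope h ht).comp hs).congr fun s => ?_
  simp [slope_def_module]

/-- A semigroup with dissipative generator contracts the domain of its generator. -/
lemma norm_orbit_le_of_mem (P : C0Semigroup E)
    (hd : ∀ z ∈ P.generatorGraph, inner ℝ z.1 z.2 ≤ 0)
    {u v : E} (h : (u, v) ∈ P.generatorGraph) {t : ℝ} (ht : 0 ≤ t) : ‖P.toFun t u‖ ≤ ‖u‖ := by
  -- The orbit stays in the graph, so `‖P_s u‖²` has right derivative `2 ⟪P_s u, P_s v⟫ ≤ 0`.
  have key := image_le_of_deriv_right_le_deriv_boundary (a := 0) (b := t)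
    (f := fun s => ‖P.toFun s u‖ ^ 2) (f' := fun s => 2 * inner ℝ (P.toFun s u) (P.toFun s v))
    (B := fun _ => ‖u‖ ^ 2) (B' := fun _ => 0)
    (((P.continuousOn u).mono Set.Icc_subset_Ici_self).norm.pow 2)
    (fun s hs => (P.hasDerivWithinAt_orbit h hs.1).norm_sq)
    (by simp [P.map_zero]) continuousOn_const (fun s _ => (hasDerivAt_const s _).hasDerivWithinAt)
    (fun s hs => by
      have := hd _ (P.orbit_mem h hs.1)
      simp only at this ⊢
      linarith)
  have := key (Set.right_mem_Icc.2 ht)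
  exact (sq_le_sq₀ (norm_nonneg _) (norm_nonneg _)).1 this

variable [CompleteSpace E]

/-- The truncated Laplace transform of an orbit lies in the domain of the generator. -/
lemma exists_truncated_resolvent (P : C0Semigroup E) (l : ℝ) (u : E) :
    ∃ w : ℝ → E, HasDerivAt w u 0 ∧ w 0 = 0 ∧ ∀ t, 0 ≤ t →
      (w t, l • w t - u + Real.exp (-l * t) • P.toFun t u) ∈ P.generatorGraph := by
  -- Truncating at `max s 0` makes the integrand continuous on all of `ℝ`; nothing is known about
  -- `P` at negative times.
  let g : ℝ → E := fun s => Real.exp (-l * s) • P.toFun (max s 0) u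
  have hg : Continuous g := by
    refine Continuous.smul (by fun_prop) ?_
    exact (P.continuousOn u).comp_continuous (by fun_prop) fun s => Set.mem_Ici.2 (le_max_right _ _)
  have hg0 : ∀ s, 0 ≤ s → g s = Real.exp (-l * s) • P.toFun s u := fun s hs => by
    simp only [g, max_eq_left hs]
  let w : ℝ → E := fun t => ∫ s in (0 : ℝ)..t, g s
  have hw : ∀ t, HasDerivAt w (g t) t := fun t =>
    intervalIntegral.integral_hasDerivAt_right (hg.intervalIntegrable _ _)
      (hg.stronglyMeasurableAtFilter _ _) hg.continuousAt
  have hw0 : w 0 = 0 := intervalIntegral.integral_same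
  refine ⟨w, by simpa [hg0, P.map_zero] using hw 0, hw0, fun t ht => ?_⟩
  -- By the semigroup law, applying `P_s` translates the window of integration. Differentiating at
  -- `s = 0` then gives the generator at `w t`.
  have hshift : ∀ s, 0 ≤ s →
      P.toFun s (w t) = Real.exp (l * s) • (w (t + s) - w s) := by
    intro s hs
    have e1 : P.toFun s (w t) = ∫ x in (0 : ℝ)..t, P.toFun s (g x) :=
      ((P.toFun s).intervalIntegral_comp_comm (hg.intervalIntegrable _ _)).symm
    have e2 : ∫ x in (0 : ℝ)..t, P.toFun s (g x)
        = ∫ x in (0 : ℝ)..t, Real.exp (l * s) • g (x + s) := by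
      refine intervalIntegral.integral_congr fun x hx => ?_
      rw [Set.uIcc_of_le ht] at hx
      have hx0 : 0 ≤ x := hx.1
      rw [hg0 x hx0, hg0 (x + s) (by linarith), map_smul, smul_smul, ← Real.exp_add,
        add_comm x s, P.map_add s x hs hx0]
      simp only [ContinuousLinearMap.comp_apply]
      congr 2
      ring
    rw [e1, e2, intervalIntegral.integral_smul,
      intervalIntegral.integral_comp_add_right (fun x => g x) s, zero_add]
    congr 1
    exact (intervalIntegral.integral_interval_sub_left (hg.intervalIntegrable _ _)
      (hg.intervalIntegrable _ _)).symm
  have hderiv : HasDerivAt (fun s => Real.exp (l * s) • (w (t + s) - w s))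
      (l • w t - u + Real.exp (-l * t) • P.toFun t u) 0 := by
    have h1 : HasDerivAt (fun s : ℝ => Real.exp (l * s)) (Real.exp (l * 0) * (l * 1)) 0 :=
      ((hasDerivAt_id (0 : ℝ)).const_mul l).exp
    have h2 : HasDerivAt (fun s : ℝ => w (t + s)) (g t) 0 := by
      have := hw (t + 0)
      rw [add_zero] at this
      simpa using HasDerivAt.comp_const_add (f := w) t 0 (by simpa using this)
    have h3 := h1.smul (h2.sub (hw 0))
    refine h3.congr_deriv ?_
    rw [hg0 t ht, hg0 0 le_rfl, P.map_zero]
    simp only [mul_zero, Real.exp_zero, one_smul, mul_one, one_mul, Pi.sub_apply, add_zero, hw0, sub_zero,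
      ContinuousLinearMap.id_apply]
    abel
  have h4 := (hasDerivAt_iff_tendsto_slope.1 hderiv).mono_left
    (nhdsWithin_mono 0 (fun x (hx : (0 : ℝ) < x) => by simpa using hx.ne'))
  refine h4.congr' ?_
  filter_upwards [self_mem_nhdsWithin] with s hs
  simp [slope_def_module, hshift s (le_of_lt hs), hw0]

/-- The domain of the generator is dense. -/
lemma exists_mem_tendsto (P : C0Semigroup E) (u : E) :
    ∃ z : ℝ → E × E, (∀ t, 0 < t → z t ∈ P.generatorGraph) ∧
      Tendsto (fun t => (z t).1) (𝓝[>] 0) (𝓝 u) := by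
  -- With `l = 0`, `w t` is the integral of the orbit over `[0, t]`; the averages `w t / t` lie in
  -- the domain and tend to `u`.
  obtain ⟨w, hw, hw0, hmem⟩ := P.exists_truncated_resolvent 0 u
  refine ⟨fun t => (t⁻¹ • w t, t⁻¹ • ((0 : ℝ) • w t - u + Real.exp (-0 * t) • P.toFun t u)),
    fun t ht => P.generatorGraph_smul (hmem t ht.le) t⁻¹, ?_⟩
  have h4 := (hasDerivAt_iff_tendsto_slope.1 hw).mono_left
    (nhdsWithin_mono 0 (fun x (hx : (0 : ℝ) < x) => by simpa using hx.ne'))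
  refine h4.congr fun t => ?_
  simp [slope_def_module, hw0]

/-- A strongly continuous semigroup with dissipative generator is contractive. -/
lemma norm_orbit_le (P : C0Semigroup E)
    (hd : ∀ z ∈ P.generatorGraph, inner ℝ z.1 z.2 ≤ 0) (u : E) {t : ℝ} (ht : 0 ≤ t) :
    ‖P.toFun t u‖ ≤ ‖u‖ := by
  obtain ⟨z, hz, hlim⟩ := P.exists_mem_tendsto u
  refine le_of_tendsto_of_tendsto (((P.toFun t).continuous.tendsto u).comp hlim).norm hlim.norm ?_
  filter_upwards [self_mem_nhdsWithin] with s hs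
  exact P.norm_orbit_le_of_mem hd (hz s hs) ht

end C0Semigroup

/-- Pair `l • u - v` with `u` and use Cauchy-Schwarz. Applied to differences, this gives uniqueness
for the resolvent equation, convergence of approximate solutions, and continuity of the resolvent in
`l`. -/
lemma norm_le_of_dissipative {u v : E} (hd : inner ℝ u v ≤ 0) (l : ℝ) :
    l * ‖u‖ ≤ ‖l • u - v‖ := by
  rcases eq_or_ne u 0 with rfl | hu
  · simp
  have h1 : inner ℝ u (l • u - v) = l * ‖u‖ ^ 2 - inner ℝ u v := by
    rw [inner_sub_right, inner_smul_right, real_inner_self_eq_norm_sq]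
  have h2 := real_inner_le_norm u (l • u - v)
  have h3 : 0 < ‖u‖ := norm_pos_iff.2 hu
  nlinarith

/-- The resolvent of a dissipative generator is everywhere defined. -/
lemma C0Semigroup.exists_resolvent [CompleteSpace E] (P : C0Semigroup E)
    (hc : IsClosed P.generatorGraph)
    (hd : ∀ z ∈ P.generatorGraph, inner ℝ z.1 z.2 ≤ 0) {l : ℝ} (hl : 0 < l) (j : E) :
    ∃ z ∈ P.generatorGraph, l • z.1 - z.2 = j := by
  -- The Laplace transform truncated at `n` solves the equation up to `e^{-ln} P_n j`, which tends
  -- to `0` by contractivity. The a priori bound makes these solutions Cauchy, and closedness of the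
  -- graph gives the limit.
  obtain ⟨w, -, -, hmem⟩ := P.exists_truncated_resolvent l j
  set y : ℕ → E := fun n => l • w n - j + Real.exp (-l * n) • P.toFun n j with hy
  have hmem' : ∀ n : ℕ, (w n, y n) ∈ P.generatorGraph := fun n => hmem n n.cast_nonneg
  have hlim : Tendsto (fun n : ℕ => l • w n - y n) atTop (𝓝 j) := by
    have e : ∀ n : ℕ, l • w n - y n = j - Real.exp (-l * n) • P.toFun n j := fun n => by
      simp only [hy]; abel
    simp_rw [e]
    have h0 : Tendsto (fun n : ℕ => Real.exp (-l * n) * ‖j‖) atTop (𝓝 0) := by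
      have h1 : Tendsto (fun n : ℕ => Real.exp (-l * n)) atTop (𝓝 0) := by
        refine Real.tendsto_exp_atBot.comp ?_
        exact (tendsto_natCast_atTop_atTop).const_mul_atTop_of_neg (by linarith)
      simpa using h1.mul_const ‖j‖
    have h2 : Tendsto (fun n : ℕ => Real.exp (-l * n) • P.toFun n j) atTop (𝓝 0) := by
      refine squeeze_zero_norm (fun n => ?_) h0
      rw [norm_smul, Real.norm_eq_abs, Real.abs_exp]
      exact mul_le_mul_of_nonneg_left (P.norm_orbit_le hd j n.cast_nonneg) (Real.exp_pos _).le
    simpa using tendsto_const_nhds.sub h2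
  have hcau : CauchySeq (fun n : ℕ => w n) := by
    have h1 := hlim.cauchySeq
    rw [Metric.cauchySeq_iff'] at h1 ⊢
    intro ε hε
    obtain ⟨N, hN⟩ := h1 (l * ε) (by positivity)
    refine ⟨N, fun n hn => ?_⟩
    have h2 := hN n hn
    rw [dist_eq_norm] at h2 ⊢
    have h3 := norm_le_of_dissipative (hd _ (P.generatorGraph_sub (hmem' n) (hmem' N))) l
    have e : l • (w n - w N) - (y n - y N) = l • w n - y n - (l • w N - y N) := by
      rw [smul_sub]; abel
    simp only at h3
    rw [e] at h3
    exact lt_of_mul_lt_mul_left (h3.trans_lt h2) hl.le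
  obtain ⟨u, hu⟩ := cauchySeq_tendsto_of_complete hcau
  have hv : Tendsto y atTop (𝓝 (l • u - j)) := by
    have := (hu.const_smul l).sub hlim
    refine this.congr fun n => ?_
    abel
  exact ⟨(u, l • u - j), hc.mem_of_tendsto (hu.prodMk_nhds hv) (Eventually.of_forall hmem'),
    by simp⟩

/-- `HasConductivity` allows any solutions of the resolvent equation; by the a priori bound they all
agree, so the conductivity is a single number. -/
lemma C0Semigroup.resolvent_unique (P : C0Semigroup E)
    (hd : ∀ z ∈ P.generatorGraph, inner ℝ z.1 z.2 ≤ 0) {l : ℝ} (hl : 0 < l) {u v u' v' : E}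
    (h : (u, v) ∈ P.generatorGraph) (h' : (u', v') ∈ P.generatorGraph)
    (e : l • u - v = l • u' - v') : u = u' := by
  have h3 := norm_le_of_dissipative (hd _ (P.generatorGraph_sub h h')) l
  have e' : l • (u - u') - (v - v') = 0 := by
    rw [← sub_eq_zero.2 e, smul_sub]; abel
  simp only at h3
  rw [e', norm_zero] at h3
  have : ‖u - u'‖ ≤ 0 := by
    by_contra hn
    nlinarith
  exact sub_eq_zero.1 (norm_le_zero_iff.1 this)

end Semigroup

end OscillatorChain

namespace OscillatorChain

/-! ### The limit of the resolvent at `l ↓ 0`, in an abstract inner product space. -/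

section Limit

variable {E : Type*} [NormedAddCommGroup E] [InnerProductSpace ℝ E]

/-- The limit of `⟪j, (l - L)⁻¹ j⟫` as `l ↓ 0` exists, when `j` is odd for a reversal `R` with
respect to which `L` is symmetric and `-L` is coercive on odd vectors. -/
theorem exists_tendsto_inner_resolvent (P : C0Semigroup E) (R : E →L[ℝ] E)
    (hRs : ∀ u w, inner ℝ (R u) w = inner ℝ u (R w)) (hRR : ∀ u, R (R u) = u)
    {c : ℝ} (hc : 0 < c)
    (hcoer : ∀ z ∈ P.generatorGraph, c * ‖z.1 - R z.1‖ ^ 2 ≤ -inner ℝ z.1 z.2)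
    (hsym : ∀ z ∈ P.generatorGraph, ∀ z' ∈ P.generatorGraph,
      inner ℝ (R z.1) z'.2 = inner ℝ (R z.2) z'.1)
    {j : E} (hj : R j = -j) {u v : ℝ → E}
    (huv : ∀ l : ℝ, 0 < l → (u l, v l) ∈ P.generatorGraph ∧ l • u l - v l = j) :
    ∃ A : ℝ, Tendsto (fun l => inner ℝ j (u l)) (𝓝[>] 0) (𝓝 A) ∧
      ∃ M, ∀ l, 0 < l → l * ‖u l‖ ^ 2 ≤ M := by
  have hd : ∀ z ∈ P.generatorGraph, inner ℝ z.1 z.2 ≤ 0 := fun z hz => by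
    nlinarith [hcoer z hz, sq_nonneg ‖z.1 - R z.1‖]
  have hv : ∀ l, 0 < l → v l = l • u l - j := fun l hl => by rw [← (huv l hl).2]; abel
  -- Energy identity: both terms on the right are nonnegative, so each is at most `⟪j, u_l⟫`.
  have hΦ : ∀ l, 0 < l → inner ℝ j (u l) = l * ‖u l‖ ^ 2 - inner ℝ (u l) (v l) := fun l hl => by
    rw [hv l hl, inner_sub_right, inner_smul_right, real_inner_self_eq_norm_sq,
      real_inner_comm j (u l)]
    ring
  -- Since `j` is odd, only the odd part of `u_l` contributes to the pairing.
  have hodd : ∀ l, inner ℝ j (u l) ≤ ‖j‖ * ‖u l - R (u l)‖ / 2 := fun l => by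
    have h1 : inner ℝ j (u l - R (u l)) = 2 * inner ℝ j (u l) := by
      rw [inner_sub_right, ← hRs, hj, inner_neg_left]; ring
    have h2 := real_inner_le_norm j (u l - R (u l))
    linarith
  -- With `d = ‖u_l - R u_l‖`, coercivity and the two previous facts give `c d² ≤ ‖j‖ d / 2`, a
  -- bound uniform in `l`.
  have hdb : ∀ l, 0 < l → ‖u l - R (u l)‖ ≤ ‖j‖ / (2 * c) := fun l hl => by
    have h1 := hcoer _ (huv l hl).1
    have h2 := hΦ l hl
    have h3 := hodd l
    have h4 : 0 ≤ l * ‖u l‖ ^ 2 := by positivity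
    simp only at h1
    rw [le_div_iff₀ (by positivity)]
    by_contra hn
    push Not at hn
    have h5 : 0 < ‖u l - R (u l)‖ := by
      by_contra h0
      have : ‖u l - R (u l)‖ = 0 := le_antisymm (not_lt.1 h0) (norm_nonneg _)
      rw [this, zero_mul] at hn
      exact absurd hn (not_lt.2 (norm_nonneg _))
    nlinarith
  have hRn : ∀ w, ‖R w‖ ^ 2 = ‖w‖ ^ 2 := fun w => by
    rw [← real_inner_self_eq_norm_sq, ← real_inner_self_eq_norm_sq, hRs, hRR]
  -- `⟪R u, u⟫ = ‖u‖² - ‖u - R u‖² / 2`, so `C` bounds the only negative contribution to the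
  -- derivative of `⟪j, u_l⟫`.
  set C := (‖j‖ / (2 * c)) ^ 2 / 2 with hC
  have hRu : ∀ l, 0 < l → -C ≤ inner ℝ (R (u l)) (u l) := fun l hl => by
    have h1 := norm_sub_sq_real (u l) (R (u l))
    rw [hRn, real_inner_comm] at h1
    have h2 := pow_le_pow_left₀ (norm_nonneg _) (hdb l hl) 2
    nlinarith [sq_nonneg ‖u l‖]
  -- The resolvent identity, written with `R` in place of the adjoint: apply the symmetry to `u_l`
  -- and `u_m` and use `R j = -j`.
  have hres : ∀ l m, 0 < l → 0 < m →
      inner ℝ j (u l) - inner ℝ j (u m) = (l - m) * inner ℝ (R (u l)) (u m) := by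
    intro l m hl hm
    have h1 := hsym _ (huv l hl).1 _ (huv m hm).1
    simp only at h1
    rw [hv l hl, hv m hm, inner_sub_right, inner_smul_right, map_sub, map_smul, inner_sub_left,
      inner_smul_left, hj, inner_neg_left, hRs (u l) j, hj, inner_neg_right,
      real_inner_comm j (u l)] at h1
    simp only [conj_trivial] at h1
    linarith
  have hdiff : ∀ l m, 0 < l → 0 < m → l * ‖u l - u m‖ ≤ |l - m| * ‖u m‖ := by
    intro l m hl hm
    have h1 := norm_le_of_dissipative
      (hd _ (P.generatorGraph_sub (huv l hl).1 (huv m hm).1)) l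
    have e : l • (u l - u m) - (v l - v m) = (m - l) • u m := by
      rw [hv l hl, hv m hm, smul_sub, sub_smul]; abel
    simp only at h1
    rwa [e, norm_smul, Real.norm_eq_abs, abs_sub_comm] at h1
  have hcont : ∀ m, 0 < m → Tendsto u (𝓝 m) (𝓝 (u m)) := by
    intro m hm
    rw [tendsto_iff_norm_sub_tendsto_zero]
    have h1 : Tendsto (fun l => |l - m| * ‖u m‖ / l) (𝓝 m) (𝓝 0) := by
      have : ContinuousAt (fun l => |l - m| * ‖u m‖ / l) m := by
        refine ContinuousAt.div (by fun_prop) continuousAt_id hm.ne'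
      simpa [ContinuousAt] using this
    refine squeeze_zero' (Eventually.of_forall fun _ => norm_nonneg _) ?_ h1
    filter_upwards [lt_mem_nhds hm] with l hl
    rw [le_div_iff₀ hl, mul_comm]
    exact hdiff l m hl hm
  have hderiv : ∀ m, 0 < m →
      HasDerivAt (fun l => inner ℝ j (u l) + C * l) (inner ℝ (R (u m)) (u m) + C) m := by
    intro m hm
    refine HasDerivAt.add ?_ (by simpa using (hasDerivAt_id m).const_mul C)
    rw [hasDerivAt_iff_tendsto_slope]
    have h1 : Tendsto (fun l => inner ℝ (R (u l)) (u m)) (𝓝[≠] m)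
        (𝓝 (inner ℝ (R (u m)) (u m))) :=
      (((R.continuous.tendsto _).comp (hcont m hm)).inner tendsto_const_nhds).mono_left
        nhdsWithin_le_nhds
    refine h1.congr' ?_
    filter_upwards [self_mem_nhdsWithin, mem_nhdsWithin_of_mem_nhds (lt_mem_nhds hm)] with l hl hl'
    rw [slope_def_field, hres l m hl' hm]
    field_simp [sub_ne_zero.2 hl]
  -- The linear correction `C l` makes the pairing monotone and disappears in the limit.
  have hmono : MonotoneOn (fun l => inner ℝ j (u l) + C * l) (Set.Ioi 0) := by
    refine monotoneOn_of_deriv_nonneg (convex_Ioi 0)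
      (fun m hm => (hderiv m hm).continuousAt.continuousWithinAt) ?_ ?_
    · rw [interior_Ioi]
      exact fun m hm => (hderiv m hm).differentiableAt.differentiableWithinAt
    · rw [interior_Ioi]
      intro m hm
      rw [(hderiv m hm).deriv]
      linarith [hRu m hm]
  have hbdd : BddBelow ((fun l => inner ℝ j (u l) + C * l) '' Set.Ioi 0) := by
    refine ⟨0, ?_⟩
    rintro _ ⟨l, hl, rfl⟩
    have hl : 0 < l := hl
    have h1 := hd _ (huv l hl).1
    simp only at h1 ⊢
    rw [hΦ l hl]
    have : 0 ≤ C := by positivity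
    have h2 : 0 ≤ l * ‖u l‖ ^ 2 := by positivity
    have h3 : 0 ≤ C * l := by positivity
    linarith
  have hlim := hmono.tendsto_nhdsGT hbdd
  have h0 : Tendsto (fun l : ℝ => C * l) (𝓝[>] 0) (𝓝 0) := by
    have : Tendsto (fun l : ℝ => C * l) (𝓝 0) (𝓝 (C * 0)) :=
      (continuous_const.mul continuous_id).tendsto 0
    rw [mul_zero] at this
    exact this.mono_left nhdsWithin_le_nhds
  refine ⟨_, by simpa using hlim.sub h0, ‖j‖ * (‖j‖ / (2 * c)) / 2, fun l hl => ?_⟩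
  have h1 := hd _ (huv l hl).1
  have h2 := hodd l
  have h3 := mul_le_mul_of_nonneg_left (hdb l hl) (norm_nonneg j)
  have h4 := hΦ l hl
  simp only at h1
  linarith

/-- Two-sided bounds for the limit of `⟪j, (l - L)⁻¹ j⟫` from a decomposition
`j = (k + L h) / 2`, with `L` acting weakly on `k` and `h`. -/
theorem bounds_of_tendsto_inner_resolvent (P : C0Semigroup E)
    (hd : ∀ z ∈ P.generatorGraph, inner ℝ z.1 z.2 ≤ 0)
    {j : E} {u v : ℝ → E}
    (huv : ∀ l : ℝ, 0 < l → (u l, v l) ∈ P.generatorGraph ∧ l • u l - v l = j)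
    {A : ℝ} (hA : Tendsto (fun l => inner ℝ j (u l)) (𝓝[>] 0) (𝓝 A))
    {M : ℝ} (hM : ∀ l, 0 < l → l * ‖u l‖ ^ 2 ≤ M)
    {k m h b : E} {s q C₁ C₂ : ℝ} (hjk : j = (2⁻¹ : ℝ) • k + (2⁻¹ : ℝ) • b)
    (hk : ∀ z ∈ P.generatorGraph, inner ℝ k z.2 = -(s * inner ℝ k z.1 + inner ℝ m z.1))
    (hh : ∀ z ∈ P.generatorGraph, inner ℝ h z.2 = -inner ℝ b z.1)
    (h1 : ∀ z ∈ P.generatorGraph,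
      (s * inner ℝ k z.1 + inner ℝ m z.1) ^ 2 ≤ C₁ * -inner ℝ z.1 z.2)
    (h2 : ∀ z ∈ P.generatorGraph, (inner ℝ k z.1) ^ 2 ≤ C₂ * -inner ℝ z.1 z.2)
    (hC₁ : 0 ≤ C₁) (hC₂ : 0 ≤ C₂)
    (hkj : inner ℝ k j = q) (hhj : inner ℝ h j = 0) :
    q ^ 2 ≤ C₁ * A ∧ A ≤ C₂ / 4 := by
  have hv : ∀ l, 0 < l → v l = l • u l - j := fun l hl => by rw [← (huv l hl).2]; abel
  have hΦ : ∀ l, 0 < l → inner ℝ j (u l) = l * ‖u l‖ ^ 2 - inner ℝ (u l) (v l) := fun l hl => by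
    rw [hv l hl, inner_sub_right, inner_smul_right, real_inner_self_eq_norm_sq,
      real_inner_comm j (u l)]
    ring
  have hΦ' : ∀ l, 0 < l → -inner ℝ (u l) (v l) ≤ inner ℝ j (u l) := fun l hl => by
    have : 0 ≤ l * ‖u l‖ ^ 2 := by positivity
    linarith [hΦ l hl]
  have hpos : ∀ l, 0 < l → 0 ≤ inner ℝ j (u l) := fun l hl => by
    have := hd _ (huv l hl).1
    simp only at this
    linarith [hΦ' l hl]
  have hA0 : 0 ≤ A := ge_of_tendsto hA (by
    filter_upwards [self_mem_nhdsWithin] with l hl using hpos l hl)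
  -- `(l ‖u_l‖)² = l * (l ‖u_l‖²) ≤ l M`: the term `l u_l` of the resolvent equation disappears in
  -- the limit.
  have hlu : Tendsto (fun l => l * ‖u l‖) (𝓝[>] 0) (𝓝 0) := by
    have h0 : Tendsto (fun l : ℝ => √(l * M)) (𝓝[>] 0) (𝓝 0) := by
      have : Tendsto (fun l : ℝ => √(l * M)) (𝓝 0) (𝓝 (√(0 * M))) :=
        (Real.continuous_sqrt.comp (continuous_id.mul continuous_const)).tendsto 0
      simp only [zero_mul, Real.sqrt_zero] at this
      exact this.mono_left nhdsWithin_le_nhds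
    refine squeeze_zero' ?_ ?_ h0
    · filter_upwards [self_mem_nhdsWithin] with l hl
      exact mul_nonneg (le_of_lt hl) (norm_nonneg _)
    · filter_upwards [self_mem_nhdsWithin] with l hl
      have hl : 0 < l := hl
      refine Real.le_sqrt_of_sq_le ?_
      nlinarith [hM l hl]
  have hlin : ∀ w : E, Tendsto (fun l => l * inner ℝ w (u l)) (𝓝[>] 0) (𝓝 0) := by
    intro w
    refine squeeze_zero_norm' ?_ (by simpa using hlu.const_mul ‖w‖)
    filter_upwards [self_mem_nhdsWithin] with l hl
    have hl : 0 < l := hl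
    rw [norm_mul, Real.norm_eq_abs, abs_of_pos hl]
    have := norm_inner_le_norm (𝕜 := ℝ) w (u l)
    nlinarith
  constructor
  -- Lower bound: pairing the resolvent equation with `k` shows that `s ⟪k, u_l⟫ + ⟪m, u_l⟫` tends
  -- to `q`, while its square is at most `C₁ ⟪j, u_l⟫`.
  · have hlim : Tendsto (fun l => (q - l * inner ℝ k (u l)) ^ 2) (𝓝[>] 0) (𝓝 ((q - 0) ^ 2)) :=
      (tendsto_const_nhds.sub (hlin k)).pow 2
    rw [sub_zero] at hlim
    refine le_of_tendsto_of_tendsto hlim (hA.const_mul C₁) ?_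
    filter_upwards [self_mem_nhdsWithin] with l hl
    have e1 := hk _ (huv l hl).1
    have e2 := h1 _ (huv l hl).1
    simp only at e1 e2
    rw [hv l hl, inner_sub_right, inner_smul_right, hkj] at e1
    have e3 : q - l * inner ℝ k (u l) = s * inner ℝ k (u l) + inner ℝ m (u l) := by linarith
    rw [e3]
    exact e2.trans (mul_le_mul_of_nonneg_left (hΦ' l hl) hC₁)
  -- Upper bound: pairing with `h` gives `⟪b, u_l⟫ = -l ⟪h, u_l⟫ → 0`, so in the limit `j` acts as
  -- `k / 2`. This yields `A² ≤ (C₂ / 4) A`.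
  · have hlim : Tendsto (fun l => (inner ℝ j (u l) + 2⁻¹ * (l * inner ℝ h (u l))) ^ 2) (𝓝[>] 0)
        (𝓝 ((A + 2⁻¹ * 0) ^ 2)) := (hA.add ((hlin h).const_mul _)).pow 2
    rw [mul_zero, add_zero] at hlim
    have hle : A ^ 2 ≤ C₂ / 4 * A := by
      refine le_of_tendsto_of_tendsto hlim (hA.const_mul (C₂ / 4)) ?_
      filter_upwards [self_mem_nhdsWithin] with l hl
      have e1 := hh _ (huv l hl).1
      have e2 := h2 _ (huv l hl).1
      simp only at e1 e2
      rw [hv l hl, inner_sub_right, inner_smul_right, hhj] at e1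
      have e3 : inner ℝ j (u l) = 2⁻¹ * inner ℝ k (u l) + 2⁻¹ * inner ℝ b (u l) := by
        conv_lhs => rw [hjk]
        simp [inner_add_left, inner_smul_left]
      have e4 : inner ℝ j (u l) + 2⁻¹ * (l * inner ℝ h (u l)) = 2⁻¹ * inner ℝ k (u l) := by
        linarith
      rw [e4, mul_pow]
      have e5 := mul_le_mul_of_nonneg_left (hΦ' l hl) hC₂
      linarith
    rcases hA0.eq_or_lt with h0 | h0
    · rw [← h0]; positivity
    · nlinarith

end Limit

end OscillatorChain

/-! ### Measure-theoretic tools: integration by parts, resampling, flips. -/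

namespace OscillatorChain

noncomputable section

/-! ### Integration by parts for a measure with a smooth density -/

/-- The measure `ν` satisfies `∫ φ' dν = ∫ U φ dν`. -/
def HasIBP (ν : Measure ℝ) (U : ℝ → ℝ) : Prop :=
  ∀ φ φ' : ℝ → ℝ, (∀ s, HasDerivAt φ (φ' s) s) → Integrable φ ν → Integrable φ' ν →
    Integrable (fun s => U s * φ s) ν → ∫ s, φ' s ∂ν = ∫ s, U s * φ s ∂ν

/-- Since `ρ' = -U ρ`, the derivative of `φ ρ` is `(φ' - U φ) ρ`. The three integrability conditions
remove the boundary terms at infinity. -/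
lemma hasIBP_withDensity {ρ U : ℝ → ℝ} (hρ : ∀ s, HasDerivAt ρ (-(U s * ρ s)) s)
    (h0 : ∀ s, 0 ≤ ρ s) : HasIBP (volume.withDensity fun s => ENNReal.ofReal (ρ s)) U := by
  intro φ φ' hφ h1 h2 h3
  have hm : Measurable ρ :=
    (continuous_iff_continuousAt.2 fun s => (hρ s).continuousAt).measurable
  have hlt : ∀ᵐ s ∂(volume : Measure ℝ), ENNReal.ofReal (ρ s) < ⊤ :=
    Eventually.of_forall fun s => ENNReal.ofReal_lt_top
  rw [integrable_withDensity_iff hm.ennreal_ofReal hlt] at h1 h2 h3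
  simp only [ENNReal.toReal_ofReal (h0 _)] at h1 h2 h3
  rw [integral_withDensity_eq_integral_toReal_smul hm.ennreal_ofReal hlt,
    integral_withDensity_eq_integral_toReal_smul hm.ennreal_ofReal hlt]
  simp only [ENNReal.toReal_ofReal (h0 _), smul_eq_mul]
  have key := integral_mul_deriv_eq_deriv_mul_of_integrable (u := φ) (u' := φ') (v := ρ)
    (v' := fun s => -(U s * ρ s)) (fun s _ => hφ s) (fun s _ => hρ s)
    (by
      refine h3.neg.congr (Eventually.of_forall fun s => ?_)
      simp only [Pi.neg_apply, Pi.mul_apply]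
      ring) h2 h1
  have e1 : ∫ s, ρ s * φ' s = ∫ s, φ' s * ρ s := integral_congr_ae (by
    filter_upwards with s; ring)
  have e2 : ∫ s, ρ s * (U s * φ s) = -∫ s, φ s * (-(U s * ρ s)) := by
    rw [← integral_neg]
    exact integral_congr_ae (by filter_upwards with s; ring)
  rw [e1, e2, key, neg_neg]

lemma Chain.hasIBP_lawP (c : Chain) : HasIBP c.lawP (fun s => c.T⁻¹ * s) := by
  have hT := c.T_pos
  have hv : c.T.toNNReal ≠ 0 := by simpa using hT
  unfold Chain.lawP
  rw [gaussianReal_of_var_ne_zero _ hv]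
  refine hasIBP_withDensity (ρ := gaussianPDFReal 0 c.T.toNNReal) (fun s => ?_)
    (fun s => gaussianPDFReal_nonneg _ _ _)
  unfold gaussianPDFReal
  rw [Real.coe_toNNReal _ hT.le]
  have h1 : HasDerivAt (fun s : ℝ => -(s - 0) ^ 2 / (2 * c.T)) (-(c.T⁻¹ * s)) s := by
    have := (((hasDerivAt_id s).sub_const 0).pow 2).neg.div_const (2 * c.T)
    refine this.congr_deriv ?_
    simp
    field_simp
  refine (h1.exp.const_mul _).congr_deriv ?_
  ring

lemma Chain.hasIBP_lawR (c : Chain) (hV : Differentiable ℝ c.V) :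
    HasIBP c.lawR (fun s => c.T⁻¹ * deriv c.V s) := by
  have hT := c.T_pos
  unfold Chain.lawR Measure.tilted
  refine hasIBP_withDensity (fun s => ?_) (fun s => ?_)
  · have h1 : HasDerivAt (fun s : ℝ => -c.V s / c.T) (-(c.T⁻¹ * deriv c.V s)) s := by
      refine ((hV s).hasDerivAt.neg.div_const c.T).congr_deriv ?_
      field_simp
    refine (h1.exp.div_const _).congr_deriv ?_
    ring
  · exact div_nonneg (Real.exp_pos _).le (integral_nonneg fun _ => (Real.exp_pos _).le)

/-- Integration by parts in one coordinate of a product. -/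
lemma HasIBP.integral_eq {ν : Measure ℝ} [IsProbabilityMeasure ν] {U : ℝ → ℝ} (hν : HasIBP ν U)
    {Ω : Type*} [MeasurableSpace Ω] {μ : Measure Ω} [IsProbabilityMeasure μ] {Ψ : Ω × ℝ → Ω}
    (hΨ : MeasurePreserving Ψ (μ.prod ν) μ) {f f' g : Ω → ℝ}
    (hf : ∀ ω s, HasDerivAt (fun t => f (Ψ (ω, t))) (f' (Ψ (ω, s))) s)
    (hg : ∀ ω s, g (Ψ (ω, s)) = U s * f (Ψ (ω, s)))
    (h1 : Integrable f μ) (h2 : Integrable f' μ) (h3 : Integrable g μ) :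
    ∫ ω, f' ω ∂μ = ∫ ω, g ω ∂μ := by
  have key : ∀ {k : Ω → ℝ}, Integrable k μ →
      Integrable (fun z => k (Ψ z)) (μ.prod ν) ∧ ∫ ω, k ω ∂μ = ∫ ω, ∫ s, k (Ψ (ω, s)) ∂ν ∂μ := by
    intro k hk
    have hi : Integrable (fun z => k (Ψ z)) (μ.prod ν) := hΨ.integrable_comp_of_integrable hk
    refine ⟨hi, ?_⟩
    rw [← integral_prod _ hi]
    conv_lhs => rw [← hΨ.map_eq]
    refine integral_map hΨ.aemeasurable ?_
    rw [hΨ.map_eq]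
    exact hk.aestronglyMeasurable
  obtain ⟨i1, -⟩ := key h1
  obtain ⟨i2, e2⟩ := key h2
  obtain ⟨i3, e3⟩ := key h3
  rw [e2, e3]
  refine integral_congr_ae ?_
  filter_upwards [i1.prod_right_ae, i2.prod_right_ae, i3.prod_right_ae] with ω a1 a2 a3
  rw [hν _ _ (hf ω) a1 a2 (by simpa only [hg] using a3)]
  exact integral_congr_ae (Eventually.of_forall fun s => (hg ω s).symm)

/-! ### Resampling one coordinate -/

/-- Checked on finite cylinders, according to whether `x` is a constrained site. It supplies the
fibres along which one-dimensional integration by parts is applied in the infinite product. -/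
lemma measurePreserving_update (c : Chain) (x : ℤ) :
    MeasurePreserving (fun z : Config × (ℝ × ℝ) => Function.update z.1 x z.2)
      (c.gibbs.prod (c.lawR.prod c.lawP)) c.gibbs := by
  have hm : Measurable (fun z : Config × (ℝ × ℝ) => Function.update z.1 x z.2) := by
    refine measurable_pi_lambda _ fun y => ?_
    by_cases hy : y = x
    · subst hy; simpa using measurable_snd
    · simp only [Function.update_of_ne hy]; fun_prop
  refine ⟨hm, ?_⟩
  conv_rhs => unfold Chain.gibbs
  refine Measure.eq_infinitePi _ fun s t ht => ?_
  rw [Measure.map_apply hm (MeasurableSet.pi s.countable_toSet fun i _ => ht i)]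
  by_cases hx : x ∈ s
  · have e : (fun z : Config × (ℝ × ℝ) => Function.update z.1 x z.2) ⁻¹' ((s : Set ℤ).pi t)
        = ((s.erase x : Finset ℤ) : Set ℤ).pi t ×ˢ t x := by
      ext z
      simp only [Set.mem_preimage, Set.mem_pi, Finset.mem_coe, Set.mem_prod, Finset.mem_erase]
      constructor
      · intro h
        refine ⟨fun i hi => ?_, by simpa using h x hx⟩
        simpa [hi.1] using h i hi.2
      · rintro ⟨h1, h2⟩ i hi
        by_cases hix : i = x
        · subst hix; simpa using h2
        · simpa [hix] using h1 i ⟨hix, hi⟩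
    rw [e, Measure.prod_prod, Chain.gibbs, Measure.infinitePi_pi _ (fun i _ => ht i),
      Finset.prod_erase_mul _ _ hx]
  · have e : (fun z : Config × (ℝ × ℝ) => Function.update z.1 x z.2) ⁻¹' ((s : Set ℤ).pi t)
        = (s : Set ℤ).pi t ×ˢ Set.univ := by
      ext z
      simp only [Set.mem_preimage, Set.mem_pi, Finset.mem_coe, Set.mem_prod, Set.mem_univ, and_true]
      refine forall₂_congr fun i hi => ?_
      have hix : i ≠ x := fun h => hx (h ▸ hi)
      simp [hix]
    rw [e, Measure.prod_prod, Chain.gibbs, Measure.infinitePi_pi _ (fun i _ => ht i)]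
    simp

/-- Replace `r_x` by `s`. -/
def setR (x : ℤ) (z : Config × ℝ) : Config := Function.update z.1 x (z.2, (z.1 x).2)

/-- Replace `p_x` by `s`. -/
def setP (x : ℤ) (z : Config × ℝ) : Config := Function.update z.1 x ((z.1 x).1, z.2)

lemma measurable_setR (x : ℤ) : Measurable (setR x) := by
  refine measurable_pi_lambda _ fun y => ?_
  by_cases hy : y = x
  · subst hy; simp only [setR, Function.update_self]; fun_prop
  · simp only [setR, Function.update_of_ne hy]; fun_prop

lemma measurable_setP (x : ℤ) : Measurable (setP x) := by
  refine measurable_pi_lambda _ fun y => ?_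
  by_cases hy : y = x
  · subst hy; simp only [setP, Function.update_self]; fun_prop
  · simp only [setP, Function.update_of_ne hy]; fun_prop

/-- Represent the configuration itself as the result of resampling the whole site `x`. Overwriting
the momentum is then again a full resampling, with a recombined independent pair. -/
lemma measurePreserving_setP (c : Chain) (x : ℤ) :
    MeasurePreserving (setP x) (c.gibbs.prod c.lawP) c.gibbs := by
  refine ⟨measurable_setP x, ?_⟩
  have h1 := (measurePreserving_update c x).prod (MeasurePreserving.id c.lawP)
  have h2 : MeasurePreserving (fun z : (Config × (ℝ × ℝ)) × ℝ => (z.1.1, (z.1.2.1, z.2)))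
      ((c.gibbs.prod (c.lawR.prod c.lawP)).prod c.lawP)
      (c.gibbs.prod (c.lawR.prod c.lawP)) := by
    have h3 := (MeasurePreserving.id c.gibbs).prod
      ((measurePreserving_fst (μ := c.lawR) (ν := c.lawP)).prod (MeasurePreserving.id c.lawP))
    exact h3.comp (measurePreserving_prodAssoc c.gibbs (c.lawR.prod c.lawP) c.lawP)
  rw [← h1.map_eq, Measure.map_map (measurable_setP x) h1.measurable]
  have e : setP x ∘ (Prod.map (fun z : Config × (ℝ × ℝ) => Function.update z.1 x z.2) id)
      = (fun z : Config × (ℝ × ℝ) => Function.update z.1 x z.2) ∘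
        (fun z : (Config × (ℝ × ℝ)) × ℝ => (z.1.1, (z.1.2.1, z.2))) := by
    funext z
    simp [setP]
  rw [e, ← Measure.map_map (measurePreserving_update c x).measurable h2.measurable, h2.map_eq,
    (measurePreserving_update c x).map_eq]

lemma measurePreserving_setR (c : Chain) (x : ℤ) :
    MeasurePreserving (setR x) (c.gibbs.prod c.lawR) c.gibbs := by
  refine ⟨measurable_setR x, ?_⟩
  have h1 := (measurePreserving_update c x).prod (MeasurePreserving.id c.lawR)
  have h2 : MeasurePreserving (fun z : (Config × (ℝ × ℝ)) × ℝ => (z.1.1, (z.2, z.1.2.2)))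
      ((c.gibbs.prod (c.lawR.prod c.lawP)).prod c.lawR)
      (c.gibbs.prod (c.lawR.prod c.lawP)) := by
    have h4 : MeasurePreserving (fun z : (ℝ × ℝ) × ℝ => (z.2, z.1.2))
        ((c.lawR.prod c.lawP).prod c.lawR) (c.lawR.prod c.lawP) :=
      (Measure.measurePreserving_swap (μ := c.lawP) (ν := c.lawR)).comp
        ((measurePreserving_snd (μ := c.lawR) (ν := c.lawP)).prod (MeasurePreserving.id c.lawR))
    have h3 := (MeasurePreserving.id c.gibbs).prod h4
    exact h3.comp (measurePreserving_prodAssoc c.gibbs (c.lawR.prod c.lawP) c.lawR)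
  rw [← h1.map_eq, Measure.map_map (measurable_setR x) h1.measurable]
  have e : setR x ∘ (Prod.map (fun z : Config × (ℝ × ℝ) => Function.update z.1 x z.2) id)
      = (fun z : Config × (ℝ × ℝ) => Function.update z.1 x z.2) ∘
        (fun z : (Config × (ℝ × ℝ)) × ℝ => (z.1.1, (z.2, z.1.2.2))) := by
    funext z
    simp [setR]
  rw [e, ← Measure.map_map (measurePreserving_update c x).measurable h2.measurable, h2.map_eq,
    (measurePreserving_update c x).map_eq]

/-! ### Momentum flips -/

/-- Flip the momenta of all the particles in `S`. -/
def flipOn (S : Set ℤ) (ω : Config) : Config := fun x =>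
  open Classical in if x ∈ S then ((ω x).1, -(ω x).2) else ω x

lemma measurePreserving_flip_site (c : Chain) :
    MeasurePreserving (fun v : ℝ × ℝ => (v.1, -v.2)) (c.lawR.prod c.lawP)
      (c.lawR.prod c.lawP) := by
  have h : MeasurePreserving (fun s : ℝ => -s) c.lawP c.lawP := by
    refine ⟨measurable_neg, ?_⟩
    unfold Chain.lawP
    rw [gaussianReal_map_neg, neg_zero]
  exact (MeasurePreserving.id c.lawR).prod h

lemma measurePreserving_flipOn (c : Chain) (S : Set ℤ) :
    MeasurePreserving (flipOn S) c.gibbs c.gibbs := by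
  classical
  let F : ℤ → ℝ × ℝ → ℝ × ℝ := fun x v => if x ∈ S then (v.1, -v.2) else v
  have hF : ∀ x, MeasurePreserving (F x) (c.lawR.prod c.lawP) (c.lawR.prod c.lawP) := fun x => by
    by_cases hx : x ∈ S
    · simpa [F, hx] using measurePreserving_flip_site c
    · have e : F x = id := by funext v; simp [F, hx]
      rw [e]
      exact MeasurePreserving.id _
  have e : flipOn S = fun (ω : Config) x => F x (ω x) := by
    funext ω x
    by_cases hx : x ∈ S <;> simp [flipOn, F, hx]
  rw [e]
  refine ⟨measurable_pi_lambda _ fun x => (hF x).measurable.comp (measurable_pi_apply x), ?_⟩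
  unfold Chain.gibbs
  rw [Measure.infinitePi_map_pi _ (fun x => (hF x).measurable)]
  congr 1
  funext x
  exact (hF x).map_eq

lemma flipAt_eq_flipOn (x : ℤ) : flipAt x = flipOn {x} := by
  funext ω y
  by_cases hy : y = x
  · subst hy; simp [flipAt, flipOn]
  · simp [flipAt, flipOn, hy]

lemma flipOn_flipOn (S S' : Set ℤ) (ω : Config) :
    flipOn S (flipOn S' ω) = flipOn S' (flipOn S ω) := by
  funext x
  by_cases h : x ∈ S <;> by_cases h' : x ∈ S' <;> simp [flipOn, h, h']

lemma flipOn_self (S : Set ℤ) (ω : Config) : flipOn S (flipOn S ω) = ω := by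
  funext x
  by_cases h : x ∈ S <;> simp [flipOn, h]

lemma shift_flipOn (S : Set ℤ) (z : ℤ) (ω : Config) :
    shift z (flipOn S ω) = flipOn ((fun x => x + z) ⁻¹' S) (shift z ω) := by
  funext x
  by_cases h : x + z ∈ S <;> simp [flipOn, shift, h]

end

end OscillatorChain

/-! ### Function classes for the calculus: moments, partial derivatives, test functions. -/

namespace OscillatorChain

noncomputable section

/-! ### Local functions with finite moments -/

/-- Measurable local functions with finite moments of all orders. -/
def Chain.Mod (c : Chain) (f : Config → ℝ) : Prop :=
  Measurable f ∧ (∃ Λ : Finset ℤ, DependsOn f (Λ : Set ℤ)) ∧ ∀ q : ℕ, MemLp f q c.gibbs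

namespace Chain.Mod

variable {c : Chain} {f g : Config → ℝ}

lemma memLp_two (h : c.Mod f) : MemLp f 2 c.gibbs := by simpa using h.2.2 2

lemma integrable (h : c.Mod f) : Integrable f c.gibbs := by
  rw [← memLp_one_iff_integrable]; simpa using h.2.2 1

lemma const (a : ℝ) : c.Mod fun _ => a :=
  ⟨measurable_const, ⟨∅, fun _ _ _ => rfl⟩, fun _ => memLp_const a⟩

lemma add (h : c.Mod f) (h' : c.Mod g) : c.Mod fun ω => f ω + g ω := by
  obtain ⟨h1, ⟨Λ, h2⟩, h3⟩ := h
  obtain ⟨h1', ⟨Λ', h2'⟩, h3'⟩ := h'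
  refine ⟨h1.add h1', ⟨Λ ∪ Λ', fun x y hxy => ?_⟩, fun q => (h3 q).add (h3' q)⟩
  have e1 := h2 (x := x) (y := y) fun i hi => hxy i (by simp [Finset.mem_coe.1 hi])
  have e2 := h2' (x := x) (y := y) fun i hi => hxy i (by simp [Finset.mem_coe.1 hi])
  simp [e1, e2]

/-- Hölder with exponents `2q` and `2q`; closure under products is the reason for requiring moments
of all orders. -/
lemma mul (h : c.Mod f) (h' : c.Mod g) : c.Mod fun ω => f ω * g ω := by
  obtain ⟨h1, ⟨Λ, h2⟩, h3⟩ := h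
  obtain ⟨h1', ⟨Λ', h2'⟩, h3'⟩ := h'
  refine ⟨h1.mul h1', ⟨Λ ∪ Λ', fun x y hxy => ?_⟩, fun q => ?_⟩
  · have e1 := h2 (x := x) (y := y) fun i hi => hxy i (by simp [Finset.mem_coe.1 hi])
    have e2 := h2' (x := x) (y := y) fun i hi => hxy i (by simp [Finset.mem_coe.1 hi])
    simp [e1, e2]
  · have : ENNReal.HolderTriple ((2 * q : ℕ) : ENNReal) ((2 * q : ℕ) : ENNReal) (q : ENNReal) := by
      refine ⟨?_⟩
      push_cast
      rw [ENNReal.mul_inv (by simp) (by simp), ← add_mul, ENNReal.inv_two_add_inv_two, one_mul]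
    exact MemLp.mul (h3' (2 * q)) (h3 (2 * q))

lemma const_mul (h : c.Mod f) (a : ℝ) : c.Mod fun ω => a * f ω := (const a).mul h

lemma neg (h : c.Mod f) : c.Mod fun ω => -f ω := by simpa using h.const_mul (-1)

lemma sub (h : c.Mod f) (h' : c.Mod g) : c.Mod fun ω => f ω - g ω := by
  simpa [sub_eq_add_neg] using h.add h'.neg

lemma sum {ι : Type*} (s : Finset ι) {F : ι → Config → ℝ} (h : ∀ i ∈ s, c.Mod (F i)) :
    c.Mod fun ω => ∑ i ∈ s, F i ω := by
  classical
  induction s using Finset.induction_on with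
  | empty => simpa using const 0
  | insert i s hi ih =>
    simp only [Finset.sum_insert hi]
    exact (h i (by simp)).add (ih fun k hk => h k (by simp [hk]))

lemma shift (h : c.Mod f) (z : ℤ) : c.Mod fun ω => f (shift z ω) := by
  obtain ⟨h1, ⟨Λ, h2⟩, h3⟩ := h
  refine ⟨h1.comp (measurable_shift z), ⟨Λ.map (Equiv.addRight z).toEmbedding, fun x y hxy => ?_⟩,
    fun q => (h3 q).comp_measurePreserving (measurePreserving_shift c z)⟩
  exact h2 fun i hi => hxy (i + z) (by simpa using hi)

lemma flipOn (h : c.Mod f) (S : Set ℤ) : c.Mod fun ω => f (flipOn S ω) := by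
  obtain ⟨h1, ⟨Λ, h2⟩, h3⟩ := h
  have hm := measurePreserving_flipOn c S
  refine ⟨h1.comp hm.measurable, ⟨Λ, fun x y hxy => ?_⟩,
    fun q => (h3 q).comp_measurePreserving hm⟩
  exact h2 fun i hi => by simp [OscillatorChain.flipOn, hxy i hi]

lemma integrable_mul (h : c.Mod f) (h' : c.Mod g) : Integrable (fun ω => f ω * g ω) c.gibbs :=
  (h.mul h').integrable

lemma of_bounded (h1 : Measurable f) {Λ : Finset ℤ} (h2 : DependsOn f (Λ : Set ℤ)) {C : ℝ}
    (h3 : ∀ ω, ‖f ω‖ ≤ C) : c.Mod f :=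
  ⟨h1, ⟨Λ, h2⟩, fun _ => MemLp.of_bound h1.aestronglyMeasurable C (Eventually.of_forall h3)⟩

lemma ofR {φ : ℝ → ℝ} (hm : Measurable φ) (hφ : ∀ q : ℕ, MemLp φ q c.lawR) (x : ℤ) :
    c.Mod fun ω => φ (ω x).1 := by
  refine ⟨by fun_prop, ⟨{x}, fun ω ω' h => by simp [h x (by simp)]⟩, fun q => ?_⟩
  have h1 : MeasurePreserving (fun ω : Config => (ω x).1) c.gibbs c.lawR :=
    measurePreserving_fst.comp
      (measurePreserving_eval_infinitePi (fun _ : ℤ => c.lawR.prod c.lawP) x)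
  exact (hφ q).comp_measurePreserving h1

lemma p (x : ℤ) : c.Mod fun ω => (ω x).2 := by
  refine ⟨by fun_prop, ⟨{x}, fun ω ω' h => by simp [h x (by simp)]⟩, fun q => ?_⟩
  have h1 : MeasurePreserving (fun ω : Config => (ω x).2) c.gibbs c.lawP :=
    measurePreserving_snd.comp
      (measurePreserving_eval_infinitePi (fun _ : ℤ => c.lawR.prod c.lawP) x)
  exact (memLp_id_gaussianReal' q (by simp)).comp_measurePreserving h1

end Chain.Mod

/-! ### Partial derivatives -/

lemma setR_setR (x : ℤ) (ω : Config) (s t : ℝ) : setR x (setR x (ω, s), t) = setR x (ω, t) := by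
  simp [setR]

lemma setP_setP (x : ℤ) (ω : Config) (s t : ℝ) : setP x (setP x (ω, s), t) = setP x (ω, t) := by
  simp [setP]

lemma setR_self (x : ℤ) (ω : Config) : setR x (ω, (ω x).1) = ω := by simp [setR]

lemma setP_self (x : ℤ) (ω : Config) : setP x (ω, (ω x).2) = ω := by simp [setP]

lemma setR_apply (x y : ℤ) (ω : Config) (s : ℝ) :
    setR x (ω, s) y = if y = x then (s, (ω y).2) else ω y := by
  by_cases h : y = x
  · subst h; simp [setR]
  · simp [setR, h]

lemma setP_apply (x y : ℤ) (ω : Config) (s : ℝ) :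
    setP x (ω, s) y = if y = x then ((ω y).1, s) else ω y := by
  by_cases h : y = x
  · subst h; simp [setP]
  · simp [setP, h]

lemma dr_eq (x : ℤ) (f : Config → ℝ) (ω : Config) :
    dr x f ω = deriv (fun s => f (setR x (ω, s))) (ω x).1 := rfl

lemma dp_eq (x : ℤ) (f : Config → ℝ) (ω : Config) :
    dp x f ω = deriv (fun s => f (setP x (ω, s))) (ω x).2 := rfl

lemma dr_eq_zero {f : Config → ℝ} {Λ : Set ℤ} (hf : DependsOn f Λ) {x : ℤ} (hx : x ∉ Λ)
    (ω : Config) : dr x f ω = 0 := by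
  have : (fun s => f (setR x (ω, s))) = fun _ => f ω := by
    funext s
    refine hf fun i hi => ?_
    have : i ≠ x := fun h => hx (h ▸ hi)
    simp [setR_apply, this]
  rw [dr_eq, this, deriv_const]

lemma dp_eq_zero {f : Config → ℝ} {Λ : Set ℤ} (hf : DependsOn f Λ) {x : ℤ} (hx : x ∉ Λ)
    (ω : Config) : dp x f ω = 0 := by
  have : (fun s => f (setP x (ω, s))) = fun _ => f ω := by
    funext s
    refine hf fun i hi => ?_
    have : i ≠ x := fun h => hx (h ▸ hi)
    simp [setP_apply, this]
  rw [dp_eq, this, deriv_const]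

/-- Functions with finite moments, differentiable in each coordinate, whose partial derivatives
have finite moments. -/
structure Chain.Adm (c : Chain) (f : Config → ℝ) : Prop where
  mod : c.Mod f
  mod_dr : ∀ x, c.Mod (dr x f)
  mod_dp : ∀ x, c.Mod (dp x f)
  diff_r : ∀ x ω, DifferentiableAt ℝ (fun s => f (setR x (ω, s))) (ω x).1
  diff_p : ∀ x ω, DifferentiableAt ℝ (fun s => f (setP x (ω, s))) (ω x).2

namespace Chain.Adm

variable {c : Chain} {f g : Config → ℝ}

lemma hasDerivAt_r (h : c.Adm f) (x : ℤ) (ω : Config) (s : ℝ) :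
    HasDerivAt (fun t => f (setR x (ω, t))) (dr x f (setR x (ω, s))) s := by
  have h1 := (h.diff_r x (setR x (ω, s))).hasDerivAt
  rw [← dr_eq] at h1
  simpa [setR_setR, setR_apply] using h1

lemma hasDerivAt_p (h : c.Adm f) (x : ℤ) (ω : Config) (s : ℝ) :
    HasDerivAt (fun t => f (setP x (ω, t))) (dp x f (setP x (ω, s))) s := by
  have h1 := (h.diff_p x (setP x (ω, s))).hasDerivAt
  rw [← dp_eq] at h1
  simpa [setP_setP, setP_apply] using h1

/-- It suffices to give the partial derivatives. -/
lemma of_hasDerivAt (hf : c.Mod f) {fr fp : ℤ → Config → ℝ}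
    (hr : ∀ x ω, HasDerivAt (fun s => f (setR x (ω, s))) (fr x ω) (ω x).1)
    (hp : ∀ x ω, HasDerivAt (fun s => f (setP x (ω, s))) (fp x ω) (ω x).2)
    (hfr : ∀ x, c.Mod (fr x)) (hfp : ∀ x, c.Mod (fp x)) :
    c.Adm f ∧ (∀ x ω, dr x f ω = fr x ω) ∧ (∀ x ω, dp x f ω = fp x ω) := by
  have e1 : ∀ x ω, dr x f ω = fr x ω := fun x ω => (hr x ω).deriv
  have e2 : ∀ x ω, dp x f ω = fp x ω := fun x ω => (hp x ω).deriv
  refine ⟨⟨hf, fun x => ?_, fun x => ?_, fun x ω => (hr x ω).differentiableAt,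
    fun x ω => (hp x ω).differentiableAt⟩, e1, e2⟩
  · rw [funext (e1 x)]; exact hfr x
  · rw [funext (e2 x)]; exact hfp x

lemma hasDerivAt_r_self (h : c.Adm f) (x : ℤ) (ω : Config) :
    HasDerivAt (fun t => f (setR x (ω, t))) (dr x f ω) (ω x).1 := (h.diff_r x ω).hasDerivAt

lemma hasDerivAt_p_self (h : c.Adm f) (x : ℤ) (ω : Config) :
    HasDerivAt (fun t => f (setP x (ω, t))) (dp x f ω) (ω x).2 := (h.diff_p x ω).hasDerivAt

lemma add_aux (hf : c.Adm f) (hg : c.Adm g) :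
    c.Adm (fun ω => f ω + g ω) ∧
      (∀ x ω, dr x (fun ω => f ω + g ω) ω = dr x f ω + dr x g ω) ∧
      (∀ x ω, dp x (fun ω => f ω + g ω) ω = dp x f ω + dp x g ω) :=
  of_hasDerivAt (hf.mod.add hg.mod)
    (fun x ω => (hf.hasDerivAt_r_self x ω).add (hg.hasDerivAt_r_self x ω))
    (fun x ω => (hf.hasDerivAt_p_self x ω).add (hg.hasDerivAt_p_self x ω))
    (fun x => (hf.mod_dr x).add (hg.mod_dr x)) (fun x => (hf.mod_dp x).add (hg.mod_dp x))

lemma mul_aux (hf : c.Adm f) (hg : c.Adm g) :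
    c.Adm (fun ω => f ω * g ω) ∧
      (∀ x ω, dr x (fun ω => f ω * g ω) ω = dr x f ω * g ω + f ω * dr x g ω) ∧
      (∀ x ω, dp x (fun ω => f ω * g ω) ω = dp x f ω * g ω + f ω * dp x g ω) :=
  of_hasDerivAt (hf.mod.mul hg.mod)
    (fun x ω => by
      refine ((hf.hasDerivAt_r_self x ω).mul (hg.hasDerivAt_r_self x ω)).congr_deriv ?_
      simp [setR_self])
    (fun x ω => by
      refine ((hf.hasDerivAt_p_self x ω).mul (hg.hasDerivAt_p_self x ω)).congr_deriv ?_
      simp [setP_self])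
    (fun x => ((hf.mod_dr x).mul hg.mod).add (hf.mod.mul (hg.mod_dr x)))
    (fun x => ((hf.mod_dp x).mul hg.mod).add (hf.mod.mul (hg.mod_dp x)))

lemma const_aux (a : ℝ) : c.Adm (fun _ => a) ∧
      (∀ x ω, dr x (fun _ => a) ω = 0) ∧ (∀ x ω, dp x (fun _ => a) ω = 0) :=
  of_hasDerivAt (Mod.const a) (fun _ _ => hasDerivAt_const _ _) (fun _ _ => hasDerivAt_const _ _)
    (fun _ => Mod.const 0) (fun _ => Mod.const 0)

lemma p_aux (y : ℤ) : c.Adm (fun ω => (ω y).2) ∧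
      (∀ x ω, dr x (fun ω => (ω y).2) ω = 0) ∧
      (∀ x ω, dp x (fun ω => (ω y).2) ω = if y = x then 1 else 0) :=
  of_hasDerivAt (fr := fun _ _ => 0) (fp := fun x _ => if y = x then 1 else 0) (Mod.p y)
    (fun x ω => by
      have : (fun s => (setR x (ω, s) y).2) = fun _ => (ω y).2 := by
        funext s; rw [setR_apply]; split_ifs <;> rfl
      rw [this]
      exact hasDerivAt_const _ _)
    (fun x ω => by
      by_cases h : y = x
      · simpa [setP_apply, h] using hasDerivAt_id' _
      · simpa [setP_apply, h] using hasDerivAt_const _ _)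
    (fun _ => Mod.const 0) (fun _ => Mod.const _)

lemma r_aux {φ : ℝ → ℝ} (hφ : Differentiable ℝ φ) (h1 : ∀ q : ℕ, MemLp φ q c.lawR)
    (h2 : ∀ q : ℕ, MemLp (deriv φ) q c.lawR) (y : ℤ) : c.Adm (fun ω => φ (ω y).1) ∧
      (∀ x ω, dr x (fun ω => φ (ω y).1) ω = if y = x then deriv φ (ω y).1 else 0) ∧
      (∀ x ω, dp x (fun ω => φ (ω y).1) ω = 0) :=
  of_hasDerivAt (fr := fun x ω => if y = x then deriv φ (ω y).1 else 0) (fp := fun _ _ => 0)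
    (Mod.ofR hφ.continuous.measurable h1 y)
    (fun x ω => by
      by_cases h : y = x
      · subst h; simpa [setR_apply] using (hφ (ω y).1).hasDerivAt
      · simpa [setR_apply, h] using hasDerivAt_const _ _)
    (fun x ω => by
      have : (fun s => φ (setP x (ω, s) y).1) = fun _ => φ (ω y).1 := by
        funext s; rw [setP_apply]; split_ifs <;> rfl
      rw [this]
      exact hasDerivAt_const _ _)
    (fun x => by
      by_cases h : y = x
      · simpa [h] using Mod.ofR (measurable_deriv φ) h2 x
      · simpa [h] using Mod.const 0)
    (fun _ => Mod.const 0)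

lemma shift_setR (z x : ℤ) (ω : Config) (s : ℝ) :
    OscillatorChain.shift z (setR x (ω, s)) = setR (x - z) (OscillatorChain.shift z ω, s) := by
  funext y
  simp only [OscillatorChain.shift, setR_apply, eq_sub_iff_add_eq]

lemma shift_setP (z x : ℤ) (ω : Config) (s : ℝ) :
    OscillatorChain.shift z (setP x (ω, s)) = setP (x - z) (OscillatorChain.shift z ω, s) := by
  funext y
  simp only [OscillatorChain.shift, setP_apply, eq_sub_iff_add_eq]

lemma shift_aux (hf : c.Adm f) (z : ℤ) : c.Adm (fun ω => f (shift z ω)) ∧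
      (∀ x ω, dr x (fun ω => f (OscillatorChain.shift z ω)) ω =
        dr (x - z) f (OscillatorChain.shift z ω)) ∧
      (∀ x ω, dp x (fun ω => f (OscillatorChain.shift z ω)) ω =
        dp (x - z) f (OscillatorChain.shift z ω)) :=
  of_hasDerivAt (hf.mod.shift z)
    (fun x ω => by
      have := hf.hasDerivAt_r_self (x - z) (OscillatorChain.shift z ω)
      simpa [shift_setR, OscillatorChain.shift] using this)
    (fun x ω => by
      have := hf.hasDerivAt_p_self (x - z) (OscillatorChain.shift z ω)
      simpa [shift_setP, OscillatorChain.shift] using this)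
    (fun x => (hf.mod_dr (x - z)).shift z) (fun x => (hf.mod_dp (x - z)).shift z)

lemma flipOn_setR (S : Set ℤ) (x : ℤ) (ω : Config) (s : ℝ) :
    OscillatorChain.flipOn S (setR x (ω, s)) = setR x (OscillatorChain.flipOn S ω, s) := by
  funext y
  by_cases h' : y = x
  · subst h'
    by_cases h : y ∈ S <;> simp [OscillatorChain.flipOn, setR_apply, h]
  · simp [OscillatorChain.flipOn, setR_apply, h']

open Classical in
lemma flipOn_setP (S : Set ℤ) (x : ℤ) (ω : Config) (s : ℝ) :
    OscillatorChain.flipOn S (setP x (ω, s)) =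
      setP x (OscillatorChain.flipOn S ω, if x ∈ S then -s else s) := by
  funext y
  by_cases h' : y = x
  · subst h'
    by_cases h : y ∈ S <;> simp [OscillatorChain.flipOn, setP_apply, h]
  · simp [OscillatorChain.flipOn, setP_apply, h']

open Classical in
lemma flipOn_aux (hf : c.Adm f) (S : Set ℤ) : c.Adm (fun ω => f (flipOn S ω)) ∧
      (∀ x ω, dr x (fun ω => f (OscillatorChain.flipOn S ω)) ω =
        dr x f (OscillatorChain.flipOn S ω)) ∧
      (∀ x ω, dp x (fun ω => f (OscillatorChain.flipOn S ω)) ω =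
        (if x ∈ S then -1 else 1) * dp x f (OscillatorChain.flipOn S ω)) :=
  of_hasDerivAt (fp := fun x ω => (if x ∈ S then -1 else 1) * dp x f (OscillatorChain.flipOn S ω))
    (hf.mod.flipOn S)
    (fun x ω => by
      have := hf.hasDerivAt_r_self x (OscillatorChain.flipOn S ω)
      have e : (OscillatorChain.flipOn S ω x).1 = (ω x).1 := by
        by_cases h : x ∈ S <;> simp [OscillatorChain.flipOn, h]
      simpa [flipOn_setR, e] using this)
    (fun x ω => by
      have := hf.hasDerivAt_p_self x (OscillatorChain.flipOn S ω)
      by_cases h : x ∈ S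
      · have e : (OscillatorChain.flipOn S ω x).2 = -(ω x).2 := by
          simp [OscillatorChain.flipOn, h]
        rw [e] at this
        have h2 := this.scomp (ω x).2 (hasDerivAt_neg (ω x).2)
        simpa [flipOn_setP, h, Function.comp_def] using h2
      · have e : (OscillatorChain.flipOn S ω x).2 = (ω x).2 := by
          simp [OscillatorChain.flipOn, h]
        simpa [flipOn_setP, e, h] using this)
    (fun x => (hf.mod_dr x).flipOn S) (fun x => ((hf.mod_dp x).flipOn S).const_mul _)

/-- Gaussian integration by parts. -/
lemma integral_dp (h : c.Adm f) (x : ℤ) :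
    ∫ ω, dp x f ω ∂c.gibbs = c.T⁻¹ * ∫ ω, (ω x).2 * f ω ∂c.gibbs := by
  rw [← integral_const_mul]
  refine c.hasIBP_lawP.integral_eq (measurePreserving_setP c x) (f := f)
    (fun ω s => h.hasDerivAt_p x ω s) (fun ω s => ?_) h.mod.integrable (h.mod_dp x).integrable
    (((Mod.p x).mul h.mod).const_mul _).integrable
  simp [setP_apply, mul_assoc]

end Chain.Adm

/-- Chains with a twice differentiable potential whose derivatives have finite moments. -/
structure Chain.Regular (c : Chain) : Prop where
  diff : Differentiable ℝ c.V
  diff_deriv : Differentiable ℝ (deriv c.V)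
  memLp : ∀ q : ℕ, MemLp c.V q c.lawR
  memLp_deriv : ∀ q : ℕ, MemLp (deriv c.V) q c.lawR
  memLp_deriv_deriv : ∀ q : ℕ, MemLp (deriv (deriv c.V)) q c.lawR

lemma Chain.Regular.mod_deriv {c : Chain} (hc : c.Regular) (x : ℤ) :
    c.Mod fun ω => deriv c.V (ω x).1 := Chain.Mod.ofR (measurable_deriv _) hc.memLp_deriv x

lemma Chain.Adm.integral_dr {c : Chain} {f : Config → ℝ} (hc : c.Regular) (h : c.Adm f) (x : ℤ) :
    ∫ ω, dr x f ω ∂c.gibbs = c.T⁻¹ * ∫ ω, deriv c.V (ω x).1 * f ω ∂c.gibbs := by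
  rw [← integral_const_mul]
  refine (c.hasIBP_lawR hc.diff).integral_eq (measurePreserving_setR c x) (f := f)
    (fun ω s => h.hasDerivAt_r x ω s) (fun ω s => ?_) h.mod.integrable (h.mod_dr x).integrable
    (((hc.mod_deriv x).mul h.mod).const_mul _).integrable
  simp [setR_apply, mul_assoc]

/-- Admissible functions whose derivatives in the momenta are admissible. -/
structure Chain.Adm2 (c : Chain) (f : Config → ℝ) : Prop where
  adm : c.Adm f
  adm_dp : ∀ x, c.Adm (dp x f)

namespace Chain.Adm2

variable {c : Chain} {f g : Config → ℝ}

lemma const (a : ℝ) : c.Adm2 fun _ => a := by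
  obtain ⟨h1, -, h3⟩ := Adm.const_aux (c := c) a
  exact ⟨h1, fun x => by rw [funext (h3 x)]; exact (Adm.const_aux 0).1⟩

lemma p (y : ℤ) : c.Adm2 fun ω => (ω y).2 := by
  obtain ⟨h1, -, h3⟩ := Adm.p_aux (c := c) y
  exact ⟨h1, fun x => by rw [funext (h3 x)]; exact (Adm.const_aux _).1⟩

lemma ofR {φ : ℝ → ℝ} (hφ : Differentiable ℝ φ) (h1 : ∀ q : ℕ, MemLp φ q c.lawR)
    (h2 : ∀ q : ℕ, MemLp (deriv φ) q c.lawR) (y : ℤ) : c.Adm2 fun ω => φ (ω y).1 := by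
  obtain ⟨h1, -, h3⟩ := Adm.r_aux hφ h1 h2 y
  exact ⟨h1, fun x => by rw [funext (h3 x)]; exact (Adm.const_aux _).1⟩

lemma add (hf : c.Adm2 f) (hg : c.Adm2 g) : c.Adm2 fun ω => f ω + g ω := by
  obtain ⟨h1, -, h3⟩ := Adm.add_aux hf.adm hg.adm
  refine ⟨h1, fun x => ?_⟩
  rw [funext (h3 x)]
  exact (Adm.add_aux (hf.adm_dp x) (hg.adm_dp x)).1

lemma mul (hf : c.Adm2 f) (hg : c.Adm2 g) : c.Adm2 fun ω => f ω * g ω := by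
  obtain ⟨h1, -, h3⟩ := Adm.mul_aux hf.adm hg.adm
  refine ⟨h1, fun x => ?_⟩
  rw [funext (h3 x)]
  exact (Adm.add_aux (Adm.mul_aux (hf.adm_dp x) hg.adm).1
    (Adm.mul_aux hf.adm (hg.adm_dp x)).1).1

lemma neg (hf : c.Adm2 f) : c.Adm2 fun ω => -f ω := by simpa using (const (-1)).mul hf

lemma sub (hf : c.Adm2 f) (hg : c.Adm2 g) : c.Adm2 fun ω => f ω - g ω := by
  simpa [sub_eq_add_neg] using hf.add hg.neg

lemma shift (hf : c.Adm2 f) (z : ℤ) : c.Adm2 fun ω => f (shift z ω) := by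
  obtain ⟨h1, -, h3⟩ := Adm.shift_aux hf.adm z
  refine ⟨h1, fun x => ?_⟩
  rw [funext (h3 x)]
  exact (Adm.shift_aux (hf.adm_dp (x - z)) z).1

lemma flipOn (hf : c.Adm2 f) (S : Set ℤ) : c.Adm2 fun ω => f (flipOn S ω) := by
  obtain ⟨h1, -, h3⟩ := Adm.flipOn_aux hf.adm S
  refine ⟨h1, fun x => ?_⟩
  rw [funext (h3 x)]
  exact (Adm.mul_aux (Adm.const_aux _).1 (Adm.flipOn_aux (hf.adm_dp x) S).1).1

end Chain.Adm2

/-! ### Test functions -/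

lemma IsTestFunction.mod (c : Chain) {k : ℕ} {f : Config → ℝ} (hf : IsTestFunction k f) :
    c.Mod f := by
  obtain ⟨Λ, F, hF, hs, e⟩ := hf
  obtain ⟨C, hC⟩ := hF.continuous.bounded_above_of_compact_support hs
  obtain rfl : f = fun ω => F fun x => ω x := funext e
  refine Chain.Mod.of_bounded (Λ := Λ) (C := C) ?_ (fun x y h => ?_) fun ω => hC _
  · exact hF.continuous.measurable.comp (by fun_prop)
  · congr 1
    funext i
    exact h i i.2

/-- The curve `v` with velocity `e` covers `∂_{r_x}` and `∂_{p_x}` at once. The result is a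
directional derivative of `F`, still compactly supported and of one class lower. -/
lemma IsTestFunction.partial {k : ℕ} {f : Config → ℝ} (hf : IsTestFunction (k + 1) f)
    (x : ℤ) (e : ℝ × ℝ) : ∃ g : Config → ℝ, IsTestFunction k g ∧
      ∀ (ω : Config) (v : ℝ → ℝ × ℝ) (s : ℝ), HasDerivAt v e s → v s = ω x →
        HasDerivAt (fun t => f (Function.update ω x (v t))) (g ω) s := by
  obtain ⟨Λ, F, hF, hs, he⟩ := hf
  by_cases hx : x ∈ Λ
  · refine ⟨fun ω => fderiv ℝ F (fun y => ω y) (Pi.single ⟨x, hx⟩ e),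
      ⟨Λ, fun y => fderiv ℝ F y (Pi.single ⟨x, hx⟩ e), ?_, hs.fderiv_apply (𝕜 := ℝ) _,
        fun _ => rfl⟩, ?_⟩
    · exact (hF.fderiv_right (m := k) (by norm_cast)).clm_apply contDiff_const
    · intro ω v s hv hvs
      have h1 : ∀ t, f (Function.update ω x (v t))
          = F (Function.update (fun y : Λ => ω y) ⟨x, hx⟩ (v t)) := fun t => by
        rw [he]
        congr 1
        funext y
        by_cases hy : (y : ℤ) = x
        · obtain rfl : y = ⟨x, hx⟩ := Subtype.ext hy
          simp
        · have : y ≠ ⟨x, hx⟩ := fun h => hy (congrArg Subtype.val h)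
          simp [hy, this]
      simp only [h1]
      have h2 : HasDerivAt (fun t => Function.update (fun y : Λ => ω y) ⟨x, hx⟩ (v t))
          (Pi.single ⟨x, hx⟩ e) s := by
        rw [hasDerivAt_pi]
        intro y
        by_cases hy : y = ⟨x, hx⟩
        · subst hy; simpa using hv
        · simpa [hy] using hasDerivAt_const _ _
      have h3 : Function.update (fun y : Λ => ω y) ⟨x, hx⟩ (v s) = fun y : Λ => ω y := by
        rw [hvs]
        exact Function.update_eq_self (⟨x, hx⟩ : Λ) (fun y : Λ => ω y)
      have h4 : HasFDerivAt F (fderiv ℝ F fun y : Λ => ω y)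
          (Function.update (fun y : Λ => ω y) ⟨x, hx⟩ (v s)) := by
        rw [h3]
        exact (hF.differentiable (by simp) _).hasFDerivAt
      exact h4.comp_hasDerivAt s h2
  · refine ⟨fun _ => 0, ⟨∅, fun _ => 0, contDiff_const, HasCompactSupport.zero, fun _ => rfl⟩, ?_⟩
    intro ω v s hv hvs
    have h1 : ∀ t, f (Function.update ω x (v t)) = f ω := fun t => by
      rw [he, he]
      congr 1
      funext y
      have : (y : ℤ) ≠ x := fun h => hx (h ▸ y.2)
      simp [this]
    simp only [h1]
    exact hasDerivAt_const _ _

/-- Stated for `k + 1` so that it can be applied twice: to a `C²` function, then to its `C¹`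
momentum derivatives. -/
lemma IsTestFunction.adm_aux (c : Chain) {k : ℕ} {f : Config → ℝ}
    (hf : IsTestFunction (k + 1) f) :
    c.Adm f ∧ ∀ x, IsTestFunction k (dp x f) := by
  choose gr hgr1 hgr2 using fun x => hf.partial x (1, 0)
  choose gp hgp1 hgp2 using fun x => hf.partial x (0, 1)
  have h := Chain.Adm.of_hasDerivAt (c := c) (hf.mod c) (fr := gr) (fp := gp)
    (fun x ω => hgr2 x ω (fun s => (s, (ω x).2)) _
      ((hasDerivAt_id _).prodMk (hasDerivAt_const _ _)) rfl)
    (fun x ω => hgp2 x ω (fun s => ((ω x).1, s)) _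
      ((hasDerivAt_const _ _).prodMk (hasDerivAt_id _)) rfl)
    (fun x => (hgr1 x).mod c) (fun x => (hgp1 x).mod c)
  refine ⟨h.1, fun x => ?_⟩
  rw [funext (h.2.2 x)]
  exact hgp1 x

lemma IsTestFunction.adm2 (c : Chain) {f : Config → ℝ} (hf : IsTestFunction 2 f) : c.Adm2 f :=
  ⟨(hf.adm_aux c).1, fun x => (((hf.adm_aux c).2 x).adm_aux (k := 0) c).1⟩

end

end OscillatorChain

/-! ### The generator and its formal adjoint under the Gibbs measure. -/

namespace OscillatorChain

noncomputable section

/-! ### Covariance under shifts, locality -/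

lemma dr_shift (f : Config → ℝ) (x z : ℤ) (ω : Config) :
    dr x (fun ω => f (shift z ω)) ω = dr (x - z) f (shift z ω) := by
  simp only [dr_eq, Chain.Adm.shift_setR, shift, sub_add_cancel]

lemma dp_shift (f : Config → ℝ) (x z : ℤ) (ω : Config) :
    dp x (fun ω => f (shift z ω)) ω = dp (x - z) f (shift z ω) := by
  simp only [dp_eq, Chain.Adm.shift_setP, shift, sub_add_cancel]

lemma rot_shift (f : Config → ℝ) (x z : ℤ) (ω : Config) :
    rot x (fun ω => f (shift z ω)) ω = rot (x - z) f (shift z ω) := by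
  have e : x + 1 - z = x - z + 1 := by ring
  simp only [rot, dp_shift, e]
  simp only [shift, sub_add_cancel]
  have e' : x - z + 1 + z = x + 1 := by ring
  rw [e']

/-- `f(ω^x) - f(ω)`. -/
def flipDiff (x : ℤ) (f : Config → ℝ) (ω : Config) : ℝ := f (flipAt x ω) - f ω

lemma shift_flipAt (x z : ℤ) (ω : Config) :
    shift z (flipAt x ω) = flipAt (x - z) (shift z ω) := by
  rw [flipAt_eq_flipOn, flipAt_eq_flipOn, shift_flipOn]
  congr 1
  ext y
  simp only [Set.mem_preimage, Set.mem_singleton_iff, eq_sub_iff_add_eq]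

lemma flipDiff_shift (f : Config → ℝ) (x z : ℤ) (ω : Config) :
    flipDiff x (fun ω => f (shift z ω)) ω = flipDiff (x - z) f (shift z ω) := by
  simp only [flipDiff, shift_flipAt]

/-- The summand of the Liouville operator. -/
def Chain.liouvilleTerm (c : Chain) (x : ℤ) (f : Config → ℝ) (ω : Config) : ℝ :=
  ((ω x).2 - (ω (x - 1)).2) * dr x f ω + (deriv c.V (ω (x + 1)).1 - deriv c.V (ω x).1) * dp x f ω

lemma Chain.liouvilleTerm_shift (c : Chain) (f : Config → ℝ) (x z : ℤ) (ω : Config) :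
    c.liouvilleTerm x (fun ω => f (shift z ω)) ω = c.liouvilleTerm (x - z) f (shift z ω) := by
  have e1 : x - z - 1 + z = x - 1 := by ring
  have e2 : x - z + 1 + z = x + 1 := by ring
  simp only [Chain.liouvilleTerm, dr_shift, dp_shift]
  simp only [shift, sub_add_cancel, e1, e2]

lemma Chain.liouville_shift (c : Chain) (f : Config → ℝ) (z : ℤ) (ω : Config) :
    c.liouville (fun ω => f (shift z ω)) ω = c.liouville f (shift z ω) :=
  (tsum_congr fun x => c.liouvilleTerm_shift f x z ω).trans
    ((Equiv.subRight z).tsum_eq fun x => c.liouvilleTerm x f (shift z ω))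

lemma flipNoise_shift (f : Config → ℝ) (z : ℤ) (ω : Config) :
    flipNoise (fun ω => f (shift z ω)) ω = flipNoise f (shift z ω) :=
  (tsum_congr fun x => flipDiff_shift f x z ω).trans
    ((Equiv.subRight z).tsum_eq fun x => flipDiff x f (shift z ω))

lemma exchangeNoise_shift (f : Config → ℝ) (z : ℤ) (ω : Config) :
    exchangeNoise (fun ω => f (shift z ω)) ω = exchangeNoise f (shift z ω) := by
  rw [exchangeNoise, exchangeNoise, ← (Equiv.subRight z).tsum_eq fun x => rot x (rot x f) (shift z ω)]
  congr 1
  refine tsum_congr fun x => ?_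
  rw [show rot x (fun ω => f (shift z ω)) = fun ω => rot (x - z) f (shift z ω) from
    funext (rot_shift f x z), rot_shift]
  rfl

lemma flipDiff_eq_zero {f : Config → ℝ} {Λ : Set ℤ} (hf : DependsOn f Λ) {x : ℤ} (hx : x ∉ Λ)
    (ω : Config) : flipDiff x f ω = 0 := by
  refine sub_eq_zero.2 (hf fun i hi => ?_)
  have : i ≠ x := fun h => hx (h ▸ hi)
  simp [flipAt, this]

lemma rot_eq_zero {f : Config → ℝ} {Λ : Set ℤ} (hf : DependsOn f Λ) {x : ℤ} (hx : x ∉ Λ)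
    (hx' : x + 1 ∉ Λ) (ω : Config) : rot x f ω = 0 := by
  simp [rot, dp_eq_zero hf hx, dp_eq_zero hf hx']

lemma Chain.liouvilleTerm_eq_zero (c : Chain) {f : Config → ℝ} {Λ : Set ℤ} (hf : DependsOn f Λ)
    {x : ℤ} (hx : x ∉ Λ) (ω : Config) : c.liouvilleTerm x f ω = 0 := by
  simp [liouvilleTerm, dp_eq_zero hf hx, dr_eq_zero hf hx]

lemma rot_zero (x : ℤ) (ω : Config) : rot x (fun _ => 0) ω = 0 := by
  simp [rot, dp_eq]

/-- A finite set of sites outside which all the local operators vanish at `f`. -/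
lemma Chain.Mod.exists_finset {c : Chain} {f : Config → ℝ} (hf : c.Mod f) :
    ∃ I : Finset ℤ, ∀ x ∉ I, (∀ ω, flipDiff x f ω = 0) ∧ (∀ ω, rot x f ω = 0) ∧
      ∀ ω, c.liouvilleTerm x f ω = 0 := by
  obtain ⟨-, ⟨Λ, h⟩, -⟩ := hf
  refine ⟨Λ ∪ Λ.map (Equiv.subRight (1 : ℤ)).toEmbedding, fun x hx => ?_⟩
  rw [Finset.mem_union, not_or] at hx
  have h1 : x ∉ (Λ : Set ℤ) := fun h => hx.1 (Finset.mem_coe.1 h)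
  have h2 : x + 1 ∉ (Λ : Set ℤ) := fun h => hx.2 (by simpa using Finset.mem_coe.1 h)
  exact ⟨flipDiff_eq_zero h h1, rot_eq_zero h h1 h2, c.liouvilleTerm_eq_zero h h1⟩

/-! ### The Liouville operator is antisymmetric -/

variable {c : Chain} {f g : Config → ℝ}

lemma Chain.Adm.mod_liouvilleTerm (hc : c.Regular) (hf : c.Adm f) (x : ℤ) :
    c.Mod (c.liouvilleTerm x f) :=
  (((Mod.p _).sub (Mod.p _)).mul (hf.mod_dr x)).add
    (((hc.mod_deriv _).sub (hc.mod_deriv _)).mul (hf.mod_dp x))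

lemma Chain.liouville_eq_sum {I : Finset ℤ} (h : ∀ x ∉ I, ∀ ω, c.liouvilleTerm x f ω = 0)
    (ω : Config) : c.liouville f ω = ∑ x ∈ I, c.liouvilleTerm x f ω :=
  tsum_eq_sum fun x hx => h x hx ω

lemma Chain.Adm.mod_liouville (hc : c.Regular) (hf : c.Adm f) : c.Mod (c.liouville f) := by
  obtain ⟨I, hI⟩ := hf.mod.exists_finset
  rw [funext (Chain.liouville_eq_sum fun x hx => (hI x hx).2.2)]
  exact Mod.sum I fun x _ => hf.mod_liouvilleTerm hc x

/-- The mean of the derivative of a function along the flow vanishes. -/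
lemma Chain.Adm.integral_liouville (hc : c.Regular) (hf : c.Adm f) :
    ∫ ω, c.liouville f ω ∂c.gibbs = 0 := by
  have hT := c.T_pos
  -- After integration by parts in `r_x` and `p_x`, the on-site terms `p_x V'(r_x) f` cancel; what
  -- remains at `x` is `T⁻¹ (G x - G (x - 1))`, which telescopes.
  let G : ℤ → ℝ := fun x => ∫ ω, (ω x).2 * (deriv c.V (ω (x + 1)).1 * f ω) ∂c.gibbs
  have hW : ∀ y, c.Adm fun ω => deriv c.V (ω y).1 := fun y =>
    (Adm.r_aux hc.diff_deriv hc.memLp_deriv hc.memLp_deriv_deriv y).1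
  have hWp : ∀ x y ω, dp x (fun ω => deriv c.V (ω y).1) ω = 0 := fun x y =>
    (Adm.r_aux hc.diff_deriv hc.memLp_deriv hc.memLp_deriv_deriv y).2.2 x
  have e1 : ∀ x y, ∫ ω, (ω y).2 * dr x f ω ∂c.gibbs
      = c.T⁻¹ * ∫ ω, deriv c.V (ω x).1 * ((ω y).2 * f ω) ∂c.gibbs := fun x y => by
    have h := Adm.mul_aux (Adm.p_aux (c := c) y).1 hf
    rw [← Adm.integral_dr hc h.1 x]
    refine integral_congr_ae (Eventually.of_forall fun ω => ?_)
    simp only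
    rw [h.2.1, (Adm.p_aux (c := c) y).2.1]
    ring
  have e2 : ∀ x y, ∫ ω, deriv c.V (ω y).1 * dp x f ω ∂c.gibbs
      = c.T⁻¹ * ∫ ω, (ω x).2 * (deriv c.V (ω y).1 * f ω) ∂c.gibbs := fun x y => by
    have h := Adm.mul_aux (hW y) hf
    rw [← h.1.integral_dp x]
    refine integral_congr_ae (Eventually.of_forall fun ω => ?_)
    simp only
    rw [h.2.2, hWp]
    ring
  have i1 : ∀ x y, Integrable (fun ω => (ω y).2 * dr x f ω) c.gibbs := fun x y =>
    (Mod.p y).integrable_mul (hf.mod_dr x)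
  have i2 : ∀ x y, Integrable (fun ω => deriv c.V (ω y).1 * dp x f ω) c.gibbs := fun x y =>
    (hc.mod_deriv y).integrable_mul (hf.mod_dp x)
  have hterm : ∀ x, ∫ ω, c.liouvilleTerm x f ω ∂c.gibbs = c.T⁻¹ * (G x - G (x - 1)) := by
    intro x
    have : ∀ ω, c.liouvilleTerm x f ω = ((ω x).2 * dr x f ω - (ω (x - 1)).2 * dr x f ω)
        + (deriv c.V (ω (x + 1)).1 * dp x f ω - deriv c.V (ω x).1 * dp x f ω) := fun ω => by
      rw [liouvilleTerm]; ring
    simp only [this]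
    have i3 : Integrable (fun ω => (ω x).2 * dr x f ω - (ω (x - 1)).2 * dr x f ω) c.gibbs :=
      (i1 _ _).sub (i1 _ _)
    have i4 : Integrable (fun ω => deriv c.V (ω (x + 1)).1 * dp x f ω
        - deriv c.V (ω x).1 * dp x f ω) c.gibbs := (i2 _ _).sub (i2 _ _)
    rw [integral_add i3 i4, integral_sub (i1 _ _) (i1 _ _),
      integral_sub (i2 _ _) (i2 _ _), e1, e1, e2, e2]
    simp only [G, sub_add_cancel]
    have s1 : ∫ ω, deriv c.V (ω x).1 * ((ω x).2 * f ω) ∂c.gibbs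
        = ∫ ω, (ω x).2 * (deriv c.V (ω x).1 * f ω) ∂c.gibbs := by
      congr 1; funext ω; ring
    have s2 : ∫ ω, deriv c.V (ω x).1 * ((ω (x - 1)).2 * f ω) ∂c.gibbs
        = ∫ ω, (ω (x - 1)).2 * (deriv c.V (ω x).1 * f ω) ∂c.gibbs := by
      congr 1; funext ω; ring
    rw [s1, s2]
    ring
  obtain ⟨Λ, hΛ⟩ := hf.mod.2.1
  -- `G x` is a multiple of the mean of `V'(r_{x+1}) ∂_{p_x} f`, which vanishes off the support of
  -- `f`.
  have hG0 : ∀ x ∉ Λ, G x = 0 := fun x hx => by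
    have h := e2 x (x + 1)
    simp only [dp_eq_zero hΛ (fun h => hx (Finset.mem_coe.1 h)), mul_zero, integral_zero] at h
    simpa [hT.ne'] using h.symm
  have hGs : Summable G := summable_of_ne_finset_zero (s := Λ) hG0
  have hl0 : ∀ x ∉ Λ, ∀ ω, c.liouvilleTerm x f ω = 0 := fun x hx =>
    c.liouvilleTerm_eq_zero hΛ fun h => hx (Finset.mem_coe.1 h)
  rw [funext (Chain.liouville_eq_sum hl0),
    integral_finsetSum _ fun x _ => (hf.mod_liouvilleTerm hc x).integrable]
  have e3 : ∑ x ∈ Λ, ∫ ω, c.liouvilleTerm x f ω ∂c.gibbs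
      = ∑' x, ∫ ω, c.liouvilleTerm x f ω ∂c.gibbs :=
    (tsum_eq_sum fun x hx => by simp [hl0 x hx]).symm
  have hGs' : Summable fun x => G (x - 1) := (Equiv.subRight (1 : ℤ)).summable_iff.2 hGs
  rw [e3, tsum_congr hterm, tsum_mul_left, hGs.tsum_sub hGs',
    show ∑' x, G (x - 1) = ∑' x, G x from (Equiv.subRight (1 : ℤ)).tsum_eq G, sub_self, mul_zero]

lemma Chain.liouville_mul (hf : c.Adm f) (hg : c.Adm g) (ω : Config) :
    c.liouville (fun ω => f ω * g ω) ω = f ω * c.liouville g ω + c.liouville f ω * g ω := by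
  obtain ⟨I, hI⟩ := hf.mod.exists_finset
  obtain ⟨I', hI'⟩ := hg.mod.exists_finset
  have h := Adm.mul_aux hf hg
  have e : ∀ x, c.liouvilleTerm x (fun ω => f ω * g ω) ω
      = f ω * c.liouvilleTerm x g ω + c.liouvilleTerm x f ω * g ω := fun x => by
    simp only [liouvilleTerm, h.2.1, h.2.2]
    ring
  have s1 : Summable fun x => c.liouvilleTerm x f ω :=
    summable_of_ne_finset_zero (s := I) fun x hx => (hI x hx).2.2 ω
  have s2 : Summable fun x => c.liouvilleTerm x g ω :=
    summable_of_ne_finset_zero (s := I') fun x hx => (hI' x hx).2.2 ω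
  change ∑' x, c.liouvilleTerm x (fun ω => f ω * g ω) ω
    = f ω * ∑' x, c.liouvilleTerm x g ω + (∑' x, c.liouvilleTerm x f ω) * g ω
  rw [tsum_congr e, (s2.mul_left _).tsum_add (s1.mul_right _), tsum_mul_left, tsum_mul_right]

/-- Invariance of the Gibbs measure applied to the product `f g`, `𝔄` being a derivation. -/
lemma Chain.Adm.integral_mul_liouville (hc : c.Regular) (hf : c.Adm f) (hg : c.Adm g) :
    ∫ ω, f ω * c.liouville g ω ∂c.gibbs = -∫ ω, c.liouville f ω * g ω ∂c.gibbs := by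
  have h := (Adm.mul_aux hf hg).1.integral_liouville hc
  simp only [Chain.liouville_mul hf hg] at h
  rw [integral_add (hf.mod.integrable_mul (hg.mod_liouville hc))
    ((hf.mod_liouville hc).integrable_mul hg.mod)] at h
  linarith

/-! ### The noise is symmetric -/

lemma Chain.Mod.flipDiff (hf : c.Mod f) (x : ℤ) : c.Mod (flipDiff x f) := by
  have := hf.flipOn {x}
  rw [← flipAt_eq_flipOn] at this
  exact this.sub hf

lemma Chain.Adm2.adm_rot (hf : c.Adm2 f) (x : ℤ) : c.Adm (rot x f) := by
  have h1 := (Adm.mul_aux (Adm.p_aux (x + 1)).1 (hf.adm_dp x)).1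
  have h2 := (Adm.mul_aux (Adm.p_aux x).1 (hf.adm_dp (x + 1))).1
  have h3 := (Adm.add_aux h1 (Adm.mul_aux (Adm.const_aux (-1)).1 h2).1).1
  convert h3 using 2 with ω
  simp only [rot]
  ring

lemma Chain.Adm.mod_rot (hf : c.Adm f) (x : ℤ) : c.Mod (rot x f) :=
  ((Mod.p _).mul (hf.mod_dp x)).sub ((Mod.p _).mul (hf.mod_dp (x + 1)))

lemma integral_comp_flipOn (S : Set ℤ) (hf : c.Mod f) :
    ∫ ω, f (flipOn S ω) ∂c.gibbs = ∫ ω, f ω ∂c.gibbs := by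
  have hm := measurePreserving_flipOn c S
  conv_rhs => rw [← hm.map_eq]
  rw [integral_map hm.aemeasurable]
  exact hf.1.aestronglyMeasurable

lemma integral_comp_shift (z : ℤ) (hf : c.Mod f) :
    ∫ ω, f (shift z ω) ∂c.gibbs = ∫ ω, f ω ∂c.gibbs := by
  have hm := measurePreserving_shift c z
  conv_rhs => rw [← hm.map_eq]
  rw [integral_map hm.aemeasurable]
  exact hf.1.aestronglyMeasurable

lemma flipAt_flipAt (x : ℤ) (ω : Config) : flipAt x (flipAt x ω) = ω := by
  rw [flipAt_eq_flipOn, flipOn_self]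

lemma integral_comp_flipAt (x : ℤ) (hf : c.Mod f) :
    ∫ ω, f (flipAt x ω) ∂c.gibbs = ∫ ω, f ω ∂c.gibbs := by
  rw [flipAt_eq_flipOn]; exact integral_comp_flipOn _ hf

lemma Chain.Mod.flipAt (hf : c.Mod f) (x : ℤ) : c.Mod fun ω => f (flipAt x ω) := by
  rw [flipAt_eq_flipOn]; exact hf.flipOn _

lemma integral_mul_comp_flipAt (hf : c.Mod f) (hg : c.Mod g) (x : ℤ) :
    ∫ ω, f ω * g (flipAt x ω) ∂c.gibbs = ∫ ω, f (flipAt x ω) * g ω ∂c.gibbs := by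
  have := integral_comp_flipAt x (hf.mul (hg.flipAt x))
  simp only [flipAt_flipAt] at this
  exact this.symm

/-- `flipDiff x g` changes sign under the flip at `x`, so only the antisymmetric part of `f`, namely
`-flipDiff x f / 2`, contributes. -/
lemma integral_mul_flipDiff (hf : c.Mod f) (hg : c.Mod g) (x : ℤ) :
    ∫ ω, f ω * flipDiff x g ω ∂c.gibbs
      = -(1 / 2) * ∫ ω, flipDiff x f ω * flipDiff x g ω ∂c.gibbs := by
  have h1 := integral_mul_comp_flipAt hf hg x
  have h2 := integral_comp_flipAt x (hf.mul hg)
  have i1 := hf.integrable_mul (hg.flipAt x)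
  have i2 := (hf.flipAt x).integrable_mul hg
  have i3 := (hf.flipAt x).integrable_mul (hg.flipAt x)
  have i4 := hf.integrable_mul hg
  have e1 : ∀ ω, f ω * flipDiff x g ω = f ω * g (flipAt x ω) - f ω * g ω := fun ω => by
    rw [flipDiff]; ring
  have e2 : ∀ ω, flipDiff x f ω * flipDiff x g ω
      = (f (flipAt x ω) * g (flipAt x ω) - f (flipAt x ω) * g ω)
        - (f ω * g (flipAt x ω) - f ω * g ω) := fun ω => by
    rw [flipDiff, flipDiff]; ring
  have i5 : Integrable (fun ω => f (flipAt x ω) * g (flipAt x ω) - f (flipAt x ω) * g ω) c.gibbs :=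
    i3.sub i2
  have i6 : Integrable (fun ω => f ω * g (flipAt x ω) - f ω * g ω) c.gibbs := i1.sub i4
  simp only [e1, e2]
  rw [integral_sub i1 i4, integral_sub i5 i6, integral_sub i3 i2,
    integral_sub i1 i4, h2, ← h1]
  ring

/-- Gaussian integration by parts turns both terms into `T⁻¹` times the mean of `p_x p_{x+1} f`;
they cancel because the two variances are equal. -/
lemma Chain.Adm.integral_rot (hf : c.Adm f) (x : ℤ) : ∫ ω, rot x f ω ∂c.gibbs = 0 := by
  have e : ∀ x y, y ≠ x → ∫ ω, (ω y).2 * dp x f ω ∂c.gibbs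
      = c.T⁻¹ * ∫ ω, (ω x).2 * ((ω y).2 * f ω) ∂c.gibbs := fun x y hxy => by
    have h := Adm.mul_aux (Adm.p_aux (c := c) y).1 hf
    rw [← h.1.integral_dp x]
    refine integral_congr_ae (Eventually.of_forall fun ω => ?_)
    simp only
    rw [h.2.2, (Adm.p_aux (c := c) y).2.2, if_neg hxy]
    ring
  simp only [rot]
  rw [integral_sub ((Mod.p _).integrable_mul (hf.mod_dp x))
    ((Mod.p _).integrable_mul (hf.mod_dp (x + 1))), e _ _ (by omega), e _ _ (by omega)]
  rw [sub_eq_zero]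
  congr 2
  funext ω
  ring

lemma rot_mul (hf : c.Adm f) (hg : c.Adm g) (x : ℤ) (ω : Config) :
    rot x (fun ω => f ω * g ω) ω = f ω * rot x g ω + rot x f ω * g ω := by
  have h := Chain.Adm.mul_aux hf hg
  simp only [rot, h.2.2]
  ring

lemma Chain.Adm.integral_mul_rot (hf : c.Adm f) (hg : c.Adm g) (x : ℤ) :
    ∫ ω, f ω * rot x g ω ∂c.gibbs = -∫ ω, rot x f ω * g ω ∂c.gibbs := by
  have h := (Adm.mul_aux hf hg).1.integral_rot x
  simp only [rot_mul hf hg] at h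
  rw [integral_add (hf.mod.integrable_mul (hg.mod_rot x))
    ((hf.mod_rot x).integrable_mul hg.mod)] at h
  linarith

lemma rot_rot_eq_zero {x : ℤ} (h : ∀ ω, rot x f ω = 0) (ω : Config) :
    rot x (rot x f) ω = 0 := by
  rw [show rot x f = fun _ => 0 from funext h, rot_zero]

lemma Chain.Adm2.mod_exchangeNoise (hf : c.Adm2 f) : c.Mod (exchangeNoise f) := by
  obtain ⟨I, hI⟩ := hf.adm.mod.exists_finset
  have e : exchangeNoise f = fun ω => (1 / 2) * ∑ x ∈ I, rot x (rot x f) ω := by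
    funext ω
    rw [exchangeNoise, tsum_eq_sum fun x hx => rot_rot_eq_zero (hI x hx).2.1 ω]
  rw [e]
  exact (Mod.sum I fun x _ => (hf.adm_rot x).mod_rot x).const_mul _

lemma Chain.Mod.flipNoise (hf : c.Mod f) : c.Mod (flipNoise f) := by
  obtain ⟨I, hI⟩ := hf.exists_finset
  have e : OscillatorChain.flipNoise f = fun ω => ∑ x ∈ I, OscillatorChain.flipDiff x f ω := by
    funext ω
    exact tsum_eq_sum fun x hx => (hI x hx).1 ω
  rw [e]
  exact Mod.sum I fun x _ => hf.flipDiff x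

lemma integral_mul_exchangeNoise (hf : c.Adm2 f) (hg : c.Adm2 g) :
    ∫ ω, f ω * exchangeNoise g ω ∂c.gibbs
      = -(1 / 2) * ∑' x, ∫ ω, rot x f ω * rot x g ω ∂c.gibbs := by
  obtain ⟨I, hI⟩ := hg.adm.mod.exists_finset
  have e : ∀ ω, f ω * exchangeNoise g ω = ∑ x ∈ I, (1 / 2) * (f ω * rot x (rot x g) ω) := by
    intro ω
    rw [exchangeNoise, tsum_eq_sum fun x hx => rot_rot_eq_zero (hI x hx).2.1 ω, Finset.mul_sum,
      Finset.mul_sum]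
    exact Finset.sum_congr rfl fun x _ => by ring
  simp only [e]
  rw [integral_finsetSum _ fun x _ =>
      ((hf.adm.mod.integrable_mul ((hg.adm_rot x).mod_rot x)).const_mul _),
    tsum_eq_sum (s := I) fun x hx => by simp [(hI x hx).2.1], Finset.mul_sum]
  refine Finset.sum_congr rfl fun x _ => ?_
  rw [integral_const_mul, hf.adm.integral_mul_rot (hg.adm_rot x)]
  ring

lemma integral_mul_flipNoise (hf : c.Mod f) (hg : c.Mod g) :
    ∫ ω, f ω * flipNoise g ω ∂c.gibbs
      = -(1 / 2) * ∑' x, ∫ ω, flipDiff x f ω * flipDiff x g ω ∂c.gibbs := by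
  obtain ⟨I, hI⟩ := hg.exists_finset
  have e : ∀ ω, f ω * flipNoise g ω = ∑ x ∈ I, f ω * flipDiff x g ω := by
    intro ω
    have : flipNoise g ω = ∑ x ∈ I, flipDiff x g ω := tsum_eq_sum fun x hx => (hI x hx).1 ω
    rw [this, Finset.mul_sum]
  simp only [e]
  rw [integral_finsetSum _ fun x _ => hf.integrable_mul (hg.flipDiff x),
    tsum_eq_sum (s := I) fun x hx => by simp [(hI x hx).1], Finset.mul_sum]
  exact Finset.sum_congr rfl fun x _ => integral_mul_flipDiff hf hg x

/-- The formal adjoint of the generator. -/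
def Chain.genAdj (c : Chain) (f : Config → ℝ) (ω : Config) : ℝ :=
  -c.liouville f ω + c.γ * (flipNoise f ω + exchangeNoise f ω)

lemma Chain.gen_shift (c : Chain) (f : Config → ℝ) (z : ℤ) (ω : Config) :
    c.gen (fun ω => f (shift z ω)) ω = c.gen f (shift z ω) := by
  simp only [Chain.gen, Chain.liouville_shift, flipNoise_shift, exchangeNoise_shift]

lemma Chain.Adm2.mod_gen (hc : c.Regular) (hf : c.Adm2 f) : c.Mod (c.gen f) :=
  (hf.adm.mod_liouville hc).add ((hf.adm.mod.flipNoise.add hf.mod_exchangeNoise).const_mul _)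

lemma Chain.Adm2.integral_mul_gen (hc : c.Regular) (hf : c.Adm2 f) (hg : c.Adm2 g) :
    ∫ ω, f ω * c.gen g ω ∂c.gibbs = ∫ ω, f ω * c.liouville g ω ∂c.gibbs
      + c.γ * (∫ ω, f ω * flipNoise g ω ∂c.gibbs + ∫ ω, f ω * exchangeNoise g ω ∂c.gibbs) := by
  have e : ∀ ω, f ω * c.gen g ω = f ω * c.liouville g ω
      + c.γ * (f ω * flipNoise g ω + f ω * exchangeNoise g ω) := fun ω => by
    rw [Chain.gen]; ring
  have i1 := hf.adm.mod.integrable_mul (hg.adm.mod_liouville hc)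
  have i2 := hf.adm.mod.integrable_mul hg.adm.mod.flipNoise
  have i3 := hf.adm.mod.integrable_mul hg.mod_exchangeNoise
  simp only [e]
  rw [integral_add i1 ((i2.fun_add i3).const_mul _), integral_const_mul, integral_add i2 i3]

/-- Antisymmetry of `𝔄` and symmetry of the noise. Compact support is not needed on either side, so
unbounded observables such as the currents can be tested against `𝔏'`. -/
lemma Chain.Adm2.integral_mul_gen_eq (hc : c.Regular) (hf : c.Adm2 f) (hg : c.Adm2 g) :
    ∫ ω, f ω * c.gen g ω ∂c.gibbs = ∫ ω, c.genAdj f ω * g ω ∂c.gibbs := by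
  have e : ∀ ω, c.genAdj f ω * g ω = -(c.liouville f ω * g ω)
      + c.γ * (g ω * flipNoise f ω + g ω * exchangeNoise f ω) := fun ω => by
    rw [Chain.genAdj]; ring
  have i1 := (hf.adm.mod_liouville hc).integrable_mul hg.adm.mod
  have i2 := hg.adm.mod.integrable_mul hf.adm.mod.flipNoise
  have i3 := hg.adm.mod.integrable_mul hf.mod_exchangeNoise
  rw [hf.integral_mul_gen hc hg, hf.adm.integral_mul_liouville hc hg.adm]
  simp only [e]
  rw [integral_add i1.fun_neg ((i2.fun_add i3).const_mul _), integral_const_mul, integral_add i2 i3,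
    integral_neg, integral_mul_flipNoise hf.adm.mod hg.adm.mod,
    integral_mul_flipNoise hg.adm.mod hf.adm.mod, integral_mul_exchangeNoise hf hg,
    integral_mul_exchangeNoise hg hf]
  simp only [mul_comm]

lemma Chain.gen_one (c : Chain) (ω : Config) : c.gen (fun _ => 1) ω = 0 := by
  simp [Chain.gen, Chain.liouville, flipNoise, exchangeNoise, dr_eq, dp_eq, rot]

lemma Chain.genAdj_one (c : Chain) (ω : Config) : c.genAdj (fun _ => 1) ω = 0 := by
  simp [Chain.genAdj, Chain.liouville, flipNoise, exchangeNoise, dr_eq, dp_eq, rot]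

lemma Chain.Adm2.integral_gen (hc : c.Regular) (hf : c.Adm2 f) :
    ∫ ω, c.gen f ω ∂c.gibbs = 0 := by
  have := (Adm2.const (c := c) 1).integral_mul_gen_eq hc hf
  simpa [Chain.genAdj_one] using this

lemma Chain.Adm2.integral_genAdj (hc : c.Regular) (hf : c.Adm2 f) :
    ∫ ω, c.genAdj f ω ∂c.gibbs = 0 := by
  have := hf.integral_mul_gen_eq hc (Adm2.const (c := c) 1)
  simpa [Chain.gen_one] using this.symm

lemma Chain.semiInner_eq_of_integral_right (c : Chain) (f : Config → ℝ) {g : Config → ℝ}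
    (hg : ∫ ω, g ω ∂c.gibbs = 0) :
    c.semiInner f g = ∑' z : ℤ, ∫ ω, f ω * g (shift z ω) ∂c.gibbs := by
  simp [Chain.semiInner, hg]

lemma Chain.semiInner_eq_of_integral_left (c : Chain) {f : Config → ℝ} (g : Config → ℝ)
    (hf : ∫ ω, f ω ∂c.gibbs = 0) :
    c.semiInner f g = ∑' z : ℤ, ∫ ω, f ω * g (shift z ω) ∂c.gibbs := by
  simp [Chain.semiInner, hf]

/-- The adjoint relation for the semi-inner product. -/
lemma Chain.Adm2.semiInner_gen (hc : c.Regular) (hf : c.Adm2 f) (hg : c.Adm2 g) :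
    c.semiInner f (c.gen g) = c.semiInner (c.genAdj f) g := by
  rw [c.semiInner_eq_of_integral_right f (hg.integral_gen hc),
    c.semiInner_eq_of_integral_left g (hf.integral_genAdj hc)]
  refine tsum_congr fun z => ?_
  simp only [← Chain.gen_shift]
  exact hf.integral_mul_gen_eq hc (hg.shift z)

end

end OscillatorChain

/-! ### The semi-inner product: Dirichlet form, duality, spectral gap, reversal. -/

namespace OscillatorChain

noncomputable section

variable {c : Chain} {f g h : Config → ℝ}

/-! ### The semi-inner product on functions with finite moments -/

/-- A function with finite moments as an element of `LocalFun`. -/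
def Chain.Mod.toLoc (hf : c.Mod f) : c.LocalFun :=
  (⟨f, hf.1, hf.2.1, hf.memLp_two⟩ : c.localSubmodule)

@[simp] lemma Chain.Mod.toLoc_fn (hf : c.Mod f) : hf.toLoc.fn = f := rfl

lemma Chain.Mod.semiInner_comm (hf : c.Mod f) (hg : c.Mod g) :
    c.semiInner f g = c.semiInner g f := OscillatorChain.semiInner_comm c hf.toLoc hg.toLoc

lemma Chain.Mod.semiInner_add_left (hf : c.Mod f) (hg : c.Mod g) (hh : c.Mod h) :
    c.semiInner (fun ω => f ω + g ω) h = c.semiInner f h + c.semiInner g h :=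
  OscillatorChain.semiInner_add_left c hf.toLoc hg.toLoc hh.toLoc

lemma Chain.Mod.semiInner_const_mul_left (hf : c.Mod f) (hg : c.Mod g) (a : ℝ) :
    c.semiInner (fun ω => a * f ω) g = a * c.semiInner f g :=
  OscillatorChain.semiInner_smul_left c hf.toLoc hg.toLoc a

lemma Chain.Mod.semiInner_add_right (hf : c.Mod f) (hg : c.Mod g) (hh : c.Mod h) :
    c.semiInner f (fun ω => g ω + h ω) = c.semiInner f g + c.semiInner f h := by
  rw [hf.semiInner_comm (hg.add hh), hg.semiInner_add_left hh hf, hf.semiInner_comm hg,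
    hf.semiInner_comm hh]

lemma Chain.Mod.semiInner_const_mul_right (hf : c.Mod f) (hg : c.Mod g) (a : ℝ) :
    c.semiInner f (fun ω => a * g ω) = a * c.semiInner f g := by
  rw [hf.semiInner_comm (hg.const_mul a), hg.semiInner_const_mul_left hf, hf.semiInner_comm hg]

lemma Chain.Mod.semiInner_sub_left (hf : c.Mod f) (hg : c.Mod g) (hh : c.Mod h) :
    c.semiInner (fun ω => f ω - g ω) h = c.semiInner f h - c.semiInner g h := by
  have := hf.semiInner_add_left (hg.const_mul (-1)) hh
  rw [hg.semiInner_const_mul_left hh] at this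
  simp only [neg_mul, one_mul, ← sub_eq_add_neg] at this
  exact this

lemma Chain.Mod.semiInner_shift_left (hf : c.Mod f) (hg : c.Mod g) (y : ℤ) :
    c.semiInner (fun ω => f (OscillatorChain.shift y ω)) g = c.semiInner f g := by
  rw [Chain.semiInner, Chain.semiInner, integral_comp_shift y hf,
    ← (Equiv.subRight y).tsum_eq fun z : ℤ => (∫ ω, f ω * g (OscillatorChain.shift z ω) ∂c.gibbs)
      - (∫ ω, f ω ∂c.gibbs) * ∫ ω, g ω ∂c.gibbs]
  refine tsum_congr fun z => ?_
  congr 1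
  rw [← integral_comp_shift y (hf.mul (hg.shift _))]
  simp only [shift_shift, Equiv.subRight_apply, sub_add_cancel]

/-- Functions that differ by a spatial gradient are equivalent. -/
lemma Chain.Mod.semiInner_add_gradient_left (hf : c.Mod f) (hh : c.Mod h) (hg : c.Mod g) :
    c.semiInner (fun ω => f ω + (h (OscillatorChain.shift 1 ω) - h ω)) g = c.semiInner f g := by
  rw [hf.semiInner_add_left ((hh.shift 1).sub hh) hg, (hh.shift 1).semiInner_sub_left hh hg,
    hh.semiInner_shift_left hg, sub_self, add_zero]

/-! ### Gradients -/

/-- The sum `∑_x θ_{-x} F_x`. -/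
def grad (F : ℤ → Config → ℝ) (ω : Config) : ℝ := ∑' x : ℤ, F x (shift (-x) ω)

lemma grad_eq_sum {F : ℤ → Config → ℝ} {I : Finset ℤ} (h0 : ∀ x ∉ I, ∀ ω, F x ω = 0)
    (ω : Config) : grad F ω = ∑ x ∈ I, F x (shift (-x) ω) :=
  tsum_eq_sum fun x hx => h0 x hx _

lemma mod_grad {F : ℤ → Config → ℝ} (hF : ∀ x, c.Mod (F x)) {I : Finset ℤ}
    (h0 : ∀ x ∉ I, ∀ ω, F x ω = 0) : c.Mod (grad F) := by
  rw [funext (grad_eq_sum h0)]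
  exact Chain.Mod.sum I fun x _ => (hF x).shift (-x)

lemma integral_mul_grad {F : ℤ → Config → ℝ} (hf : c.Mod f) (hF : ∀ x, c.Mod (F x))
    {I : Finset ℤ} (h0 : ∀ x ∉ I, ∀ ω, F x ω = 0) :
    ∫ ω, f ω * grad F ω ∂c.gibbs = ∑' x : ℤ, ∫ ω, f ω * F x (shift (-x) ω) ∂c.gibbs := by
  rw [tsum_eq_sum (s := I) fun x hx => by simp [h0 x hx]]
  simp only [grad_eq_sum h0, Finset.mul_sum]
  exact integral_finsetSum _ fun x _ => hf.integrable_mul ((hF x).shift (-x))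

/-- Shifting the `(z, x)` term by `-x` makes it the pairing of the translates of `F x` and `G y` to
the origin, with `y = x - z`. The double sum then factorises; finite supports justify the
interchange. -/
lemma tsum_tsum_integral {F G : ℤ → Config → ℝ} (hF : ∀ x, c.Mod (F x)) (hG : ∀ x, c.Mod (G x))
    {I : Finset ℤ} (hF0 : ∀ x ∉ I, ∀ ω, F x ω = 0) {I' : Finset ℤ}
    (hG0 : ∀ x ∉ I', ∀ ω, G x ω = 0) :
    ∑' z : ℤ, ∑' x : ℤ, ∫ ω, F x ω * G (x - z) (shift z ω) ∂c.gibbs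
      = ∫ ω, grad F ω * grad G ω ∂c.gibbs := by
  let C : ℤ → ℤ → ℝ := fun x y => ∫ ω, F x (shift (-x) ω) * G y (shift (-y) ω) ∂c.gibbs
  have hC : ∀ z x, ∫ ω, F x ω * G (x - z) (shift z ω) ∂c.gibbs = C x (x - z) := by
    intro z x
    rw [← integral_comp_shift (-x) ((hF x).mul ((hG (x - z)).shift z))]
    simp only [C, shift_shift, neg_sub]
    rfl
  have hC0 : ∀ x y, ¬(x ∈ I ∧ y ∈ I') → C x y = 0 := by
    intro x y hxy
    rcases not_and_or.1 hxy with h | h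
    · simp [C, hF0 x h]
    · simp [C, hG0 y h]
  have hs : Summable (Function.uncurry fun z x : ℤ => C x (x - z)) := by
    refine summable_of_ne_finset_zero
      (s := (I ×ˢ I').image fun p : ℤ × ℤ => (p.1 - p.2, p.1)) ?_
    rintro ⟨z, x⟩ hzx
    refine hC0 _ _ fun hh => hzx (Finset.mem_image.2 ⟨(x, x - z), ?_, ?_⟩)
    · exact Finset.mem_product.2 hh
    · simp
  simp only [hC]
  have e0 : ∑' z : ℤ, ∑' x : ℤ, C x (x - z) = ∑' x : ℤ, ∑' z : ℤ, C x (x - z) :=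
    hs.tsum_comm.symm
  rw [e0]
  have e1 : ∀ x, ∑' z, C x (x - z) = ∑' y, C x y := fun x => (Equiv.subLeft x).tsum_eq (C x)
  simp only [e1]
  have e2 : ∀ x, ∑' y, C x y = ∫ ω, F x (shift (-x) ω) * grad G ω ∂c.gibbs := fun x =>
    (integral_mul_grad ((hF x).shift (-x)) hG hG0).symm
  simp only [e2]
  have e3 := integral_mul_grad (mod_grad hG hG0) hF hF0
  simp only [mul_comm (grad G _)] at e3
  exact e3.symm

/-- The total variation at the origin under a momentum flip. -/
def gradFlip (f : Config → ℝ) : Config → ℝ := grad fun x => flipDiff x f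

/-- The total derivative along the rotation of the momenta at `0` and `1`. -/
def gradRot (f : Config → ℝ) : Config → ℝ := grad fun x => rot x f

lemma Chain.Mod.gradFlip (hf : c.Mod f) : c.Mod (gradFlip f) := by
  obtain ⟨I, hI⟩ := hf.exists_finset
  exact mod_grad (fun x => hf.flipDiff x) fun x hx => (hI x hx).1

lemma Chain.Adm.mod_gradRot (hf : c.Adm f) : c.Mod (gradRot f) := by
  obtain ⟨I, hI⟩ := hf.mod.exists_finset
  exact mod_grad (fun x => hf.mod_rot x) fun x hx => (hI x hx).2.1

lemma flipDiff_shift_neg (f : Config → ℝ) (x : ℤ) (ω : Config) :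
    flipDiff x f (shift (-x) ω) = flipDiff 0 (fun ω => f (shift (-x) ω)) ω := by
  rw [flipDiff_shift, sub_neg_eq_add, zero_add]

lemma rot_shift_neg (f : Config → ℝ) (x : ℤ) (ω : Config) :
    rot x f (shift (-x) ω) = rot 0 (fun ω => f (shift (-x) ω)) ω := by
  rw [rot_shift, sub_neg_eq_add, zero_add]

lemma integral_eq_zero_of_odd (hf : c.Mod f) {x : ℤ} (hodd : ∀ ω, f (flipAt x ω) = -f ω) :
    ∫ ω, f ω ∂c.gibbs = 0 := by
  have := integral_comp_flipAt x hf
  simp only [hodd, integral_neg] at this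
  linarith

/-- Divergence formula for flips. Moving the flip onto `f`, odd in `p_0`, changes the sign, so both
terms of the difference contribute equally. -/
lemma integral_mul_gradFlip (hf : c.Mod f) (hodd : ∀ ω, f (flipAt 0 ω) = -f ω) (hg : c.Mod g) :
    ∫ ω, f ω * gradFlip g ω ∂c.gibbs = -2 * c.semiInner f g := by
  obtain ⟨I, hI⟩ := hg.exists_finset
  rw [gradFlip, integral_mul_grad hf (fun x => hg.flipDiff x) (fun x hx => (hI x hx).1),
    c.semiInner_eq_of_integral_left g (integral_eq_zero_of_odd hf hodd), ← tsum_mul_left,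
    ← (Equiv.neg ℤ).tsum_eq fun z : ℤ => -2 * ∫ ω, f ω * g (shift z ω) ∂c.gibbs]
  refine tsum_congr fun x => ?_
  simp only [flipDiff_shift_neg, Equiv.neg_apply]
  have h1 := integral_mul_comp_flipAt hf (hg.shift (-x)) 0
  simp only [hodd] at h1
  have e : ∀ ω, f ω * flipDiff 0 (fun ω => g (shift (-x) ω)) ω
      = f ω * g (shift (-x) (flipAt 0 ω)) - f ω * g (shift (-x) ω) := fun ω => by
    rw [flipDiff]; ring
  simp only [e]
  rw [integral_sub (hf.integrable_mul ((hg.shift (-x)).flipAt 0))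
    (hf.integrable_mul (hg.shift (-x))), h1]
  simp only [neg_mul, integral_neg]
  ring

/-- Divergence formula for rotations: the field `rot 0` is antisymmetric under the Gibbs measure. -/
lemma integral_mul_gradRot (hf : c.Adm f) (hg : c.Adm g) :
    ∫ ω, f ω * gradRot g ω ∂c.gibbs = -c.semiInner (rot 0 f) g := by
  obtain ⟨I, hI⟩ := hg.mod.exists_finset
  rw [gradRot, integral_mul_grad hf.mod (fun x => hg.mod_rot x) (fun x hx => (hI x hx).2.1),
    c.semiInner_eq_of_integral_left g (hf.integral_rot 0), ← tsum_neg,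
    ← (Equiv.neg ℤ).tsum_eq fun z : ℤ => -∫ ω, rot 0 f ω * g (shift z ω) ∂c.gibbs]
  refine tsum_congr fun x => ?_
  simp only [rot_shift_neg, Equiv.neg_apply]
  exact hf.integral_mul_rot (Chain.Adm.shift_aux hg (-x)).1 0

/-! ### The Dirichlet form -/

lemma Chain.Adm.semiInner_liouville_self (hc : c.Regular) (hf : c.Adm f) :
    c.semiInner f (c.liouville f) = 0 := by
  have h1 : c.semiInner f (c.liouville f) = -c.semiInner (c.liouville f) f := by
    rw [c.semiInner_eq_of_integral_right f (hf.integral_liouville hc),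
      c.semiInner_eq_of_integral_left f (hf.integral_liouville hc), ← tsum_neg]
    refine tsum_congr fun z => ?_
    simp only [← Chain.liouville_shift]
    exact hf.integral_mul_liouville hc (Chain.Adm.shift_aux hf z).1
  rw [(hf.mod_liouville hc).semiInner_comm hf.mod] at h1
  linarith

lemma Chain.Mod.integral_flipNoise (hf : c.Mod f) :
    ∫ ω, OscillatorChain.flipNoise f ω ∂c.gibbs = 0 := by
  have := integral_mul_flipNoise (Mod.const (c := c) 1) hf
  simpa [OscillatorChain.flipDiff] using this

lemma Chain.Adm2.integral_exchangeNoise (hf : c.Adm2 f) :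
    ∫ ω, exchangeNoise f ω ∂c.gibbs = 0 := by
  have := integral_mul_exchangeNoise (Adm2.const (c := c) 1) hf
  simpa [rot, dp_eq] using this

/-- Summing the bilinear Dirichlet form of `f` and its translate over all translations and all
flipped sites gives the square of a single gradient at the origin, by `tsum_tsum_integral`. -/
lemma Chain.Mod.semiInner_flipNoise (hf : c.Mod f) :
    c.semiInner f (OscillatorChain.flipNoise f)
      = -(1 / 2) * ∫ ω, OscillatorChain.gradFlip f ω ^ 2 ∂c.gibbs := by
  obtain ⟨I, hI⟩ := hf.exists_finset
  rw [c.semiInner_eq_of_integral_right f hf.integral_flipNoise]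
  simp only [← flipNoise_shift, pow_two]
  rw [OscillatorChain.gradFlip, ← tsum_tsum_integral (fun x => hf.flipDiff x)
    (fun x => hf.flipDiff x) (fun x hx => (hI x hx).1) (fun x hx => (hI x hx).1), ← tsum_mul_left]
  refine tsum_congr fun z => ?_
  rw [integral_mul_flipNoise hf (hf.shift z)]
  simp only [flipDiff_shift]

lemma Chain.Adm2.semiInner_exchangeNoise (hf : c.Adm2 f) :
    c.semiInner f (exchangeNoise f) = -(1 / 2) * ∫ ω, gradRot f ω ^ 2 ∂c.gibbs := by
  obtain ⟨I, hI⟩ := hf.adm.mod.exists_finset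
  rw [c.semiInner_eq_of_integral_right f hf.integral_exchangeNoise]
  simp only [← exchangeNoise_shift, pow_two]
  rw [OscillatorChain.gradRot, ← tsum_tsum_integral (fun x => hf.adm.mod_rot x)
    (fun x => hf.adm.mod_rot x) (fun x hx => (hI x hx).2.1) (fun x hx => (hI x hx).2.1),
    ← tsum_mul_left]
  refine tsum_congr fun z => ?_
  rw [integral_mul_exchangeNoise hf (hf.shift z)]
  simp only [rot_shift]

/-- The Dirichlet form of the dynamics. -/
lemma Chain.Adm2.semiInner_gen_self (hc : c.Regular) (hf : c.Adm2 f) :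
    c.semiInner f (c.gen f) = -(c.γ / 2) *
      (∫ ω, gradFlip f ω ^ 2 ∂c.gibbs + ∫ ω, gradRot f ω ^ 2 ∂c.gibbs) := by
  have h1 : c.semiInner f (c.gen f) = c.semiInner f (c.liouville f)
      + c.γ * (c.semiInner f (flipNoise f) + c.semiInner f (exchangeNoise f)) := by
    have hm := hf.adm.mod
    have hl := hf.adm.mod_liouville hc
    have hs := hm.flipNoise
    have he := hf.mod_exchangeNoise
    rw [← hm.semiInner_add_right hs he, ← hm.semiInner_const_mul_right (hs.add he),
      ← hm.semiInner_add_right hl ((hs.add he).const_mul _)]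
    rfl
  rw [h1, hf.adm.semiInner_liouville_self hc, hf.adm.mod.semiInner_flipNoise,
    hf.semiInner_exchangeNoise]
  ring

/-- Cauchy-Schwarz for pairs of functions: the mean square of `(F + t F', G + t G')` is a
nonnegative quadratic in `t`, so its discriminant is at most `0`. -/
lemma sq_integral_mul_add_le {F G F' G' : Config → ℝ} (hf : c.Mod F) (hg : c.Mod G)
    (hf' : c.Mod F') (hg' : c.Mod G') :
    (∫ ω, F ω * F' ω ∂c.gibbs + ∫ ω, G ω * G' ω ∂c.gibbs) ^ 2
      ≤ (∫ ω, F ω ^ 2 ∂c.gibbs + ∫ ω, G ω ^ 2 ∂c.gibbs)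
        * (∫ ω, F' ω ^ 2 ∂c.gibbs + ∫ ω, G' ω ^ 2 ∂c.gibbs) := by
  have key : ∀ {u v : Config → ℝ}, c.Mod u → c.Mod v → ∀ t : ℝ,
      0 ≤ (∫ ω, v ω ^ 2 ∂c.gibbs) * (t * t) + 2 * (∫ ω, u ω * v ω ∂c.gibbs) * t
        + ∫ ω, u ω ^ 2 ∂c.gibbs := by
    intro u v hu hv t
    have h1 : 0 ≤ ∫ ω, (u ω + t * v ω) ^ 2 ∂c.gibbs := integral_nonneg fun _ => sq_nonneg _
    have e : ∀ ω, (u ω + t * v ω) ^ 2 = (u ω * u ω + 2 * t * (u ω * v ω)) + t * t * (v ω * v ω) :=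
      fun ω => by ring
    simp only [e] at h1
    rw [integral_add ((hu.mul hu).add ((hu.mul hv).const_mul _)).integrable
      ((hv.mul hv).const_mul _).integrable, integral_add (hu.mul hu).integrable
      ((hu.mul hv).const_mul _).integrable, integral_const_mul, integral_const_mul] at h1
    simp only [pow_two]
    linarith
  have hd := discrim_le_zero (a := ∫ ω, F' ω ^ 2 ∂c.gibbs + ∫ ω, G' ω ^ 2 ∂c.gibbs)
    (b := 2 * (∫ ω, F ω * F' ω ∂c.gibbs + ∫ ω, G ω * G' ω ∂c.gibbs))
    (c := ∫ ω, F ω ^ 2 ∂c.gibbs + ∫ ω, G ω ^ 2 ∂c.gibbs) fun t => by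
      have h1 := key hf hf' t
      have h2 := key hg hg' t
      linarith
  rw [discrim] at hd
  linarith

/-- Duality between the Dirichlet form and divergences. -/
lemma Chain.Adm2.sq_pairing_le (hc : c.Regular) (hf : c.Adm2 f) {α β : Config → ℝ}
    (hα : c.Mod α) (hodd : ∀ ω, α (flipAt 0 ω) = -α ω) (hβ : c.Adm β) :
    (2 * c.semiInner α f + c.semiInner (rot 0 β) f) ^ 2
      ≤ (∫ ω, α ω ^ 2 ∂c.gibbs + ∫ ω, β ω ^ 2 ∂c.gibbs)
        * (2 / c.γ * -c.semiInner f (c.gen f)) := by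
  have h1 := sq_integral_mul_add_le hα hβ.mod hf.adm.mod.gradFlip hf.adm.mod_gradRot
  rw [integral_mul_gradFlip hα hodd hf.adm.mod, integral_mul_gradRot hβ hf.adm] at h1
  have hγ := c.γ_pos
  have e : 2 / c.γ * -c.semiInner f (c.gen f)
      = ∫ ω, gradFlip f ω ^ 2 ∂c.gibbs + ∫ ω, gradRot f ω ^ 2 ∂c.gibbs := by
    rw [hf.semiInner_gen_self hc]
    field_simp
  rw [e]
  refine le_trans (le_of_eq ?_) h1
  ring

/-! ### The spectral gap of the velocity flip on odd functions -/

/-- The reversal of all the momenta. -/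
def rev (f : Config → ℝ) (ω : Config) : ℝ := f (flipOn Set.univ ω)

lemma Chain.Mod.rev (hf : c.Mod f) : c.Mod (rev f) := hf.flipOn _

lemma flipAt_flipOn_Iio (x : ℤ) (ω : Config) :
    flipAt x (flipOn (Set.Iio x) ω) = flipOn (Set.Iio (x + 1)) ω := by
  rw [flipAt_eq_flipOn]
  funext y
  by_cases h : y = x
  · subst h; simp [flipOn]
  · have : y < x + 1 ↔ y < x := by omega
    simp [flipOn, h, this]

lemma flipDiff_flipAt (x : ℤ) (f : Config → ℝ) (ω : Config) :
    flipDiff x f (flipAt x ω) = -flipDiff x f ω := by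
  simp [flipDiff, flipAt_flipAt]

lemma flipOn_flipAt (S : Set ℤ) (x : ℤ) (ω : Config) :
    flipOn S (flipAt x ω) = flipAt x (flipOn S ω) := by
  rw [flipAt_eq_flipOn, flipOn_flipOn]

/-- Reverse the momenta one site at a time from left to right. The increments telescope, and only an
interval containing the support of `f` matters; adding further sites adds zero terms. -/
lemma exists_sub_rev_eq_sum (hf : c.Mod f) : ∃ J : Finset ℤ, ∀ I, J ⊆ I →
    (∀ x ∉ I, ∀ ω, flipDiff x f ω = 0) ∧
    ∀ ω, f ω - rev f ω = -∑ x ∈ I, flipDiff x f (flipOn (Set.Iio x) ω) := by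
  obtain ⟨-, ⟨Λ, hΛ⟩, -⟩ := hf
  obtain ⟨N, hN⟩ : ∃ N : ℕ, ∀ x ∈ Λ, -(N : ℤ) ≤ x ∧ x < N := by
    refine ⟨∑ x ∈ Λ, x.natAbs + 1, fun x hx => ?_⟩
    have : x.natAbs ≤ ∑ x ∈ Λ, x.natAbs :=
      Finset.single_le_sum (f := fun x : ℤ => x.natAbs) (fun _ _ => Nat.zero_le _) hx
    omega
  let J : Finset ℤ := (Finset.range (2 * N)).image fun i : ℕ => -(N : ℤ) + i
  have hJ : Λ ⊆ J := fun x hx => by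
    obtain ⟨h1, h2⟩ := hN x hx
    exact Finset.mem_image.2 ⟨(x + N).toNat, Finset.mem_range.2 (by omega), by omega⟩
  have h0 : ∀ x ∉ Λ, ∀ ω, flipDiff x f ω = 0 := fun x hx =>
    flipDiff_eq_zero hΛ fun h => hx (Finset.mem_coe.1 h)
  refine ⟨J, fun I hI => ⟨fun x hx => h0 x fun h => hx (hI (hJ h)), fun ω => ?_⟩⟩
  rw [← Finset.sum_subset hI fun x _ hx => h0 x (fun h => hx (hJ h)) _,
    Finset.sum_image fun i _ j _ h => by simpa using h]
  have e : ∀ i : ℕ, flipDiff (-(N : ℤ) + i) f (flipOn (Set.Iio (-(N : ℤ) + i)) ω)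
      = f (flipOn (Set.Iio (-(N : ℤ) + (i + 1 : ℕ))) ω) - f (flipOn (Set.Iio (-(N : ℤ) + i)) ω) := by
    intro i
    rw [flipDiff, flipAt_flipOn_Iio]
    push_cast
    rw [add_assoc]
  simp only [e]
  rw [Finset.sum_range_sub fun i : ℕ => f (flipOn (Set.Iio (-(N : ℤ) + i)) ω)]
  have e1 : f (flipOn (Set.Iio (-(N : ℤ) + (2 * N : ℕ))) ω) = rev f ω := by
    refine hΛ fun i hi => ?_
    have := (hN i (Finset.mem_coe.1 hi)).2
    have h' : i < -(N : ℤ) + (2 * N : ℕ) := by push_cast; omega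
    simp only [flipOn, Set.mem_Iio, h', Set.mem_univ]
  have e2 : f (flipOn (Set.Iio (-(N : ℤ) + (0 : ℕ))) ω) = f ω := by
    refine hΛ fun i hi => ?_
    have := (hN i (Finset.mem_coe.1 hi)).1
    have h' : ¬ i < -(N : ℤ) + (0 : ℕ) := by push_cast; omega
    simp only [flipOn, Set.mem_Iio, h', if_false]
  rw [e1, e2]
  ring

lemma integral_rev (hf : c.Mod f) : ∫ ω, rev f ω ∂c.gibbs = ∫ ω, f ω ∂c.gibbs :=
  integral_comp_flipOn _ hf

/-- Flips commute, so composing with `flipOn S` keeps `flipDiff x f` antisymmetric under the flip at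
`x`. -/
lemma integral_flipDiff_flipOn_mul (hf : c.Mod f) (hg : c.Mod g) (S : Set ℤ) (x : ℤ) :
    ∫ ω, flipDiff x f (flipOn S ω) * g ω ∂c.gibbs
      = -(1 / 2) * ∫ ω, flipDiff x f (flipOn S ω) * flipDiff x g ω ∂c.gibbs := by
  have hd := (hf.flipDiff x).flipOn S
  have h1 := integral_mul_comp_flipAt hd hg x
  simp only [flipOn_flipAt, flipDiff_flipAt, neg_mul, integral_neg] at h1
  have e : ∀ ω, flipDiff x f (flipOn S ω) * flipDiff x g ω
      = flipDiff x f (flipOn S ω) * g (flipAt x ω) - flipDiff x f (flipOn S ω) * g ω :=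
    fun ω => by simp only [flipDiff]; ring
  simp only [e]
  rw [integral_sub (hd.integrable_mul (hg.flipAt x)) (hd.integrable_mul hg), h1]
  ring

/-- Translating the `x`-th telescoping step to the origin turns `Iio x` into `Iio 0`. All steps thus
involve the same flip, and they add up to `gradFlip f` composed with one measure-preserving map. The
inequality `2 u v ≤ u² + v²` then concludes, with no dependence on the size of the support. -/
lemma Chain.Mod.semiInner_sub_rev_le (hf : c.Mod f) :
    c.semiInner (fun ω => f ω - OscillatorChain.rev f ω) f
      ≤ (1 / 2) * ∫ ω, OscillatorChain.gradFlip f ω ^ 2 ∂c.gibbs := by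
  obtain ⟨J, hJ⟩ := exists_sub_rev_eq_sum hf
  obtain ⟨h0, hsum⟩ := hJ J subset_rfl
  have hF : ∀ x, c.Mod fun ω =>
      OscillatorChain.flipDiff x f (OscillatorChain.flipOn (Set.Iio x) ω) := fun x =>
    (hf.flipDiff x).flipOn _
  have hmean : ∫ ω, (f ω - OscillatorChain.rev f ω) ∂c.gibbs = 0 := by
    rw [integral_sub hf.integrable hf.rev.integrable, integral_rev hf, sub_self]
  have h1 : c.semiInner (fun ω => f ω - OscillatorChain.rev f ω) f = (1 / 2) *
      ∫ ω, grad (fun x ω =>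
          OscillatorChain.flipDiff x f (OscillatorChain.flipOn (Set.Iio x) ω)) ω
        * OscillatorChain.gradFlip f ω ∂c.gibbs := by
    rw [c.semiInner_eq_of_integral_left f hmean, OscillatorChain.gradFlip,
      ← tsum_tsum_integral hF (fun x => hf.flipDiff x) (fun x hx ω => h0 x hx _) h0,
      ← tsum_mul_left]
    refine tsum_congr fun z => ?_
    simp only [hsum, neg_mul, integral_neg, Finset.sum_mul]
    rw [integral_finsetSum _ fun x _ => (hF x).integrable_mul (hf.shift z),
      tsum_eq_sum (s := J) fun x hx => by simp [h0 x hx], Finset.mul_sum, ← Finset.sum_neg_distrib]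
    refine Finset.sum_congr rfl fun x _ => ?_
    rw [integral_flipDiff_flipOn_mul hf (hf.shift z)]
    simp only [flipDiff_shift]
    ring
  have h2 : grad (fun x ω =>
      OscillatorChain.flipDiff x f (OscillatorChain.flipOn (Set.Iio x) ω))
      = fun ω => OscillatorChain.gradFlip f (OscillatorChain.flipOn (Set.Iio 0) ω) := by
    funext ω
    refine tsum_congr fun x => ?_
    have e : (fun y : ℤ => y + -x) ⁻¹' Set.Iio 0 = Set.Iio x := by ext y; simp
    rw [shift_flipOn, e]
  have hG := hf.gradFlip
  have hG' := hG.flipOn (Set.Iio 0)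
  have h3 := integral_comp_flipOn (Set.Iio 0) (hG.mul hG)
  have h4 : 0 ≤ ∫ ω, (OscillatorChain.gradFlip f (OscillatorChain.flipOn (Set.Iio 0) ω)
      - OscillatorChain.gradFlip f ω) ^ 2 ∂c.gibbs := integral_nonneg fun _ => sq_nonneg _
  have e : ∀ ω, (OscillatorChain.gradFlip f (OscillatorChain.flipOn (Set.Iio 0) ω)
      - OscillatorChain.gradFlip f ω) ^ 2
      = OscillatorChain.gradFlip f (OscillatorChain.flipOn (Set.Iio 0) ω)
          * OscillatorChain.gradFlip f (OscillatorChain.flipOn (Set.Iio 0) ω)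
        + (OscillatorChain.gradFlip f ω * OscillatorChain.gradFlip f ω
          + (-2) * (OscillatorChain.gradFlip f (OscillatorChain.flipOn (Set.Iio 0) ω)
            * OscillatorChain.gradFlip f ω)) := fun ω => by ring
  simp only [e] at h4
  rw [integral_add (hG'.mul hG').integrable ((hG.mul hG).add ((hG'.mul hG).const_mul _)).integrable,
    integral_add (hG.mul hG).integrable ((hG'.mul hG).const_mul _).integrable,
    integral_const_mul, h3] at h4
  rw [h1, h2]
  simp only [pow_two]
  linarith

/-- Coercivity on odd functions. -/
lemma Chain.Adm2.semiInner_sub_rev_le (hc : c.Regular) (hf : c.Adm2 f) :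
    c.γ * c.semiInner (fun ω => f ω - rev f ω) f ≤ -c.semiInner f (c.gen f) := by
  have h1 := hf.adm.mod.semiInner_sub_rev_le
  have h2 : 0 ≤ ∫ ω, gradRot f ω ^ 2 ∂c.gibbs := integral_nonneg fun _ => sq_nonneg _
  have hγ := c.γ_pos
  rw [hf.semiInner_gen_self hc]
  nlinarith

/-! ### Reversal of the momenta -/

lemma Chain.Adm2.rev (hf : c.Adm2 f) : c.Adm2 (rev f) := hf.flipOn _

lemma dr_rev (hf : c.Adm f) (x : ℤ) (ω : Config) :
    dr x (rev f) ω = dr x f (flipOn Set.univ ω) := (Chain.Adm.flipOn_aux hf _).2.1 x ω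

lemma dp_rev (hf : c.Adm f) (x : ℤ) (ω : Config) :
    dp x (rev f) ω = -dp x f (flipOn Set.univ ω) := by
  refine ((Chain.Adm.flipOn_aux hf Set.univ).2.2 x ω).trans ?_
  simp

lemma rot_rev (hf : c.Adm f) (x : ℤ) (ω : Config) : rot x (rev f) ω = rev (rot x f) ω := by
  simp only [rot, rev, dp_rev hf]
  simp only [flipOn, Set.mem_univ, if_true]
  ring

/-- Reversing all momenta changes the sign of `𝔄` and commutes with the flips and with each rotation
field. -/
lemma Chain.genAdj_rev (hf : c.Adm2 f) (ω : Config) : c.genAdj (rev f) ω = rev (c.gen f) ω := by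
  have h1 : c.liouville (OscillatorChain.rev f) ω
      = -c.liouville f (OscillatorChain.flipOn Set.univ ω) := by
    rw [Chain.liouville, Chain.liouville, ← tsum_neg]
    refine tsum_congr fun x => ?_
    rw [dr_rev hf.adm, dp_rev hf.adm]
    simp only [OscillatorChain.flipOn, Set.mem_univ, if_true]
    ring
  have h2 : flipNoise (OscillatorChain.rev f) ω
      = flipNoise f (OscillatorChain.flipOn Set.univ ω) := by
    refine tsum_congr fun x => ?_
    simp only [OscillatorChain.rev, flipOn_flipAt]
  have h3 : exchangeNoise (OscillatorChain.rev f) ω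
      = exchangeNoise f (OscillatorChain.flipOn Set.univ ω) := by
    rw [exchangeNoise, exchangeNoise]
    congr 1
    refine tsum_congr fun x => ?_
    rw [show rot x (OscillatorChain.rev f) = OscillatorChain.rev (rot x f) from
      funext (rot_rev hf.adm x), rot_rev (hf.adm_rot x)]
    rfl
  simp only [Chain.genAdj, h1, h2, h3, OscillatorChain.rev, Chain.gen]
  ring

/-- The generator is symmetric with respect to the reversed inner product. -/
lemma Chain.Adm2.semiInner_rev_gen (hc : c.Regular) (hf : c.Adm2 f) (hg : c.Adm2 g) :
    c.semiInner (OscillatorChain.rev f) (c.gen g)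
      = c.semiInner (OscillatorChain.rev (c.gen f)) g := by
  rw [hf.rev.semiInner_gen hc hg, funext (Chain.genAdj_rev hf)]

end

end OscillatorChain

/-! ### Explicit computations for potentials with `V'' = a - V'`. -/

namespace OscillatorChain

noncomputable section

variable {c : Chain} {f g : Config → ℝ}

/-! ### Moments -/

lemma dp_eq_zero_of_const {x : ℤ} {ω : Config} (h : ∀ s, f (setP x (ω, s)) = f ω) :
    dp x f ω = 0 := by
  rw [dp_eq, funext h, deriv_const]

lemma dr_eq_zero_of_const {x : ℤ} {ω : Config} (h : ∀ s, f (setR x (ω, s)) = f ω) :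
    dr x f ω = 0 := by
  rw [dr_eq, funext h, deriv_const]

lemma Chain.Adm.integral_p_mul (hf : c.Adm f) {x : ℤ} (h : ∀ ω s, f (setP x (ω, s)) = f ω) :
    ∫ ω, (ω x).2 * f ω ∂c.gibbs = 0 := by
  have h1 := hf.integral_dp x
  simp only [fun ω => dp_eq_zero_of_const (h ω), integral_zero] at h1
  have := c.T_pos
  rcases mul_eq_zero.1 h1.symm with h2 | h2
  · exact absurd h2 (by positivity)
  · exact h2

lemma Chain.Adm.integral_p_sq_mul (hf : c.Adm f) {x : ℤ} (h : ∀ ω s, f (setP x (ω, s)) = f ω) :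
    ∫ ω, (ω x).2 ^ 2 * f ω ∂c.gibbs = c.T * ∫ ω, f ω ∂c.gibbs := by
  have h0 := Adm.mul_aux (Adm.p_aux (c := c) x).1 hf
  have h1 := h0.1.integral_dp x
  simp only [h0.2.2, (Adm.p_aux (c := c) x).2.2, fun ω => dp_eq_zero_of_const (h ω), if_true,
    one_mul, mul_zero, add_zero] at h1
  have := c.T_pos
  rw [h1, ← mul_assoc, mul_inv_cancel₀ this.ne', one_mul]
  simp only [pow_two, mul_assoc]

/-- The derivative of the potential at the site `y`. -/
def Chain.W (c : Chain) (y : ℤ) (ω : Config) : ℝ := deriv c.V (ω y).1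

lemma Chain.Regular.W_aux (hc : c.Regular) (y : ℤ) : c.Adm (c.W y) ∧
      (∀ x ω, dr x (c.W y) ω = if y = x then deriv (deriv c.V) (ω y).1 else 0) ∧
      (∀ x ω, dp x (c.W y) ω = 0) :=
  Adm.r_aux hc.diff_deriv hc.memLp_deriv hc.memLp_deriv_deriv y

lemma Chain.Regular.adm2_W (hc : c.Regular) (y : ℤ) : c.Adm2 (c.W y) :=
  Adm2.ofR hc.diff_deriv hc.memLp_deriv hc.memLp_deriv_deriv y

lemma Chain.Adm.integral_W_mul (hc : c.Regular) (hf : c.Adm f) {x : ℤ}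
    (h : ∀ ω s, f (setR x (ω, s)) = f ω) : ∫ ω, c.W x ω * f ω ∂c.gibbs = 0 := by
  have h1 := hf.integral_dr hc x
  simp only [fun ω => dr_eq_zero_of_const (h ω), integral_zero] at h1
  have := c.T_pos
  rcases mul_eq_zero.1 h1.symm with h2 | h2
  · exact absurd h2 (by positivity)
  · exact h2

/-- Integrate by parts in `r_x`: one factor `V'` becomes `T` times a derivative of the other. In
`V'' = a - V'` the term `V'` has mean zero against functions not depending on `r_x`. -/
lemma Chain.Adm.integral_W_sq_mul (hc : c.Regular) {a : ℝ}
    (hV : ∀ r, deriv (deriv c.V) r = a - deriv c.V r) (hf : c.Adm f) {x : ℤ}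
    (h : ∀ ω s, f (setR x (ω, s)) = f ω) :
    ∫ ω, c.W x ω ^ 2 * f ω ∂c.gibbs = c.T * a * ∫ ω, f ω ∂c.gibbs := by
  have h0 := Adm.mul_aux (hc.W_aux x).1 hf
  have h1 := h0.1.integral_dr hc x
  have e : ∀ ω, dr x (c.W x) ω * f ω + c.W x ω * dr x f ω = a * f ω - c.W x ω * f ω := fun ω => by
    rw [(hc.W_aux x).2.1, if_pos rfl, hV, dr_eq_zero_of_const (h ω)]
    simp only [Chain.W]
    ring
  simp only [h0.2.1, e] at h1
  rw [integral_sub (hf.mod.const_mul a).integrable h0.1.mod.integrable, hf.integral_W_mul hc h,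
    integral_const_mul, sub_zero] at h1
  have := c.T_pos
  have e2 : ∫ ω, c.W x ω ^ 2 * f ω ∂c.gibbs = ∫ ω, deriv c.V (ω x).1 * (c.W x ω * f ω) ∂c.gibbs := by
    congr 1
    funext ω
    simp only [Chain.W]
    ring
  rw [e2, mul_assoc, h1, ← mul_assoc, mul_inv_cancel₀ this.ne', one_mul]

lemma Chain.Regular.integral_W_sq (hc : c.Regular) {a : ℝ}
    (hV : ∀ r, deriv (deriv c.V) r = a - deriv c.V r) (x : ℤ) :
    ∫ ω, c.W x ω ^ 2 ∂c.gibbs = c.T * a := by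
  have := (Adm.const_aux (c := c) 1).1.integral_W_sq_mul hc hV (x := x) fun _ _ => rfl
  simpa using this

lemma Chain.Regular.integral_W_mul_W (hc : c.Regular) {x y : ℤ} (hxy : y ≠ x) :
    ∫ ω, c.W x ω * c.W y ω ∂c.gibbs = 0 :=
  (hc.W_aux y).1.integral_W_mul hc fun ω s => by simp [Chain.W, setR_apply, hxy]

lemma Chain.Regular.integral_W_add_W_sq (hc : c.Regular) {a : ℝ}
    (hV : ∀ r, deriv (deriv c.V) r = a - deriv c.V r) {x y : ℤ} (hxy : y ≠ x) :
    ∫ ω, (c.W x ω + c.W y ω) ^ 2 ∂c.gibbs = 2 * (c.T * a) := by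
  have hx := (hc.W_aux x).1.mod
  have hy := (hc.W_aux y).1.mod
  have e : ∀ ω, (c.W x ω + c.W y ω) ^ 2
      = (c.W x ω * c.W x ω + c.W y ω * c.W y ω) + 2 * (c.W x ω * c.W y ω) := fun ω => by ring
  have h1 := hc.integral_W_sq hV x
  have h2 := hc.integral_W_sq hV y
  simp only [pow_two (c.W _ _)] at h1 h2
  simp only [e]
  rw [integral_add ((hx.mul hx).add (hy.mul hy)).integrable ((hx.mul hy).const_mul 2).integrable,
    integral_add (hx.mul hx).integrable (hy.mul hy).integrable, integral_const_mul,
    hc.integral_W_mul_W hxy, h1, h2]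
  ring

/-! ### The symmetrised current -/

/-- The symmetrised energy current, up to a spatial gradient and a factor `2`. -/
def Chain.symCurrent (c : Chain) (ω : Config) : ℝ := -((ω 0).2 * (c.W 0 ω + c.W 1 ω))

/-- The derivative of `symCurrent` along the flow, up to a spatial gradient. -/
def Chain.symCurrentDrift (c : Chain) (ω : Config) : ℝ :=
  c.W 1 ω * ((ω 1).2 * (ω 1).2 - (ω 0).2 * (ω 0).2)

/-- The derivative of the potential energy of a bond along the flow. -/
def Chain.bondDrift (c : Chain) (ω : Config) : ℝ := ((ω 1).2 - (ω 0).2) * c.W 1 ω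

lemma Chain.Regular.adm2_symCurrent (hc : c.Regular) : c.Adm2 c.symCurrent :=
  ((Adm2.p 0).mul ((hc.adm2_W 0).add (hc.adm2_W 1))).neg

lemma Chain.Regular.adm2_symCurrentDrift (hc : c.Regular) : c.Adm2 c.symCurrentDrift :=
  (hc.adm2_W 1).mul (((Adm2.p 1).mul (Adm2.p 1)).sub ((Adm2.p 0).mul (Adm2.p 0)))

lemma Chain.Regular.adm2_bondDrift (hc : c.Regular) : c.Adm2 c.bondDrift :=
  ((Adm2.p 1).sub (Adm2.p 0)).mul (hc.adm2_W 1)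

lemma Chain.Regular.adm2_bondEnergy (hc : c.Regular) : c.Adm2 fun ω => c.V (ω 1).1 :=
  Adm2.ofR hc.diff hc.memLp hc.memLp_deriv 1

lemma Chain.symCurrent_dependsOn (c : Chain) : DependsOn c.symCurrent ({0, 1} : Set ℤ) :=
  fun ω ω' h => by simp [symCurrent, W, h 0 (by simp), h 1 (by simp)]

lemma Chain.flipNoise_symCurrent (c : Chain) (ω : Config) :
    flipNoise c.symCurrent ω = -2 * c.symCurrent ω := by
  have h0 : ∀ x ∉ ({0} : Finset ℤ), flipDiff x c.symCurrent ω = 0 := by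
    intro x hx
    have hx : x ≠ 0 := by simpa using hx
    have hx1 : (flipAt x ω 1).1 = (ω 1).1 := by
      by_cases h : x = 1
      · subst h; simp [flipAt]
      · simp [flipAt, Ne.symm h]
    simp [flipDiff, symCurrent, W, flipAt, hx.symm] at hx1 ⊢
    simp [hx1]
  have e : flipNoise c.symCurrent ω = ∑ x ∈ ({0} : Finset ℤ), flipDiff x c.symCurrent ω :=
    tsum_eq_sum h0
  rw [e, Finset.sum_singleton]
  simp [flipDiff, symCurrent, W, flipAt]
  ring

lemma dp_symCurrent (hc : c.Regular) (x : ℤ) (ω : Config) :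
    dp x c.symCurrent ω = if (0 : ℤ) = x then -(c.W 0 ω + c.W 1 ω) else 0 := by
  have hW := Chain.Adm.add_aux (hc.W_aux 0).1 (hc.W_aux 1).1
  have h1 := Chain.Adm.mul_aux (Chain.Adm.p_aux (c := c) 0).1 hW.1
  have h2 := Chain.Adm.mul_aux (Chain.Adm.const_aux (c := c) (-1)).1 h1.1
  have e : c.symCurrent = fun ω => -1 * ((ω 0).2 * (c.W 0 ω + c.W 1 ω)) := by
    funext ω; simp [Chain.symCurrent]
  rw [e, h2.2.2, h1.2.2, hW.2.2, (hc.W_aux 0).2.2, (hc.W_aux 1).2.2, (Chain.Adm.p_aux (c := c) 0).2.2,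
    (Chain.Adm.const_aux (c := c) (-1)).2.2]
  split_ifs <;> ring

lemma dr_symCurrent (hc : c.Regular) (x : ℤ) (ω : Config) :
    dr x c.symCurrent ω = -((ω 0).2 * ((if (0 : ℤ) = x then deriv (deriv c.V) (ω 0).1 else 0)
      + if (1 : ℤ) = x then deriv (deriv c.V) (ω 1).1 else 0)) := by
  have hW := Chain.Adm.add_aux (hc.W_aux 0).1 (hc.W_aux 1).1
  have h1 := Chain.Adm.mul_aux (Chain.Adm.p_aux (c := c) 0).1 hW.1
  have h2 := Chain.Adm.mul_aux (Chain.Adm.const_aux (c := c) (-1)).1 h1.1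
  have e : c.symCurrent = fun ω => -1 * ((ω 0).2 * (c.W 0 ω + c.W 1 ω)) := by
    funext ω; simp [Chain.symCurrent]
  rw [e, h2.2.1, h1.2.1, hW.2.1, (hc.W_aux 0).2.1, (hc.W_aux 1).2.1, (Chain.Adm.p_aux (c := c) 0).2.1,
    (Chain.Adm.const_aux (c := c) (-1)).2.1]
  ring

lemma dp_p_mul_W (hc : c.Regular) (y x : ℤ) (ω : Config) :
    dp x (fun ω => (ω y).2 * (c.W 0 ω + c.W 1 ω)) ω
      = if y = x then c.W 0 ω + c.W 1 ω else 0 := by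
  have hW := Chain.Adm.add_aux (hc.W_aux 0).1 (hc.W_aux 1).1
  have h1 := Chain.Adm.mul_aux (Chain.Adm.p_aux (c := c) y).1 hW.1
  rw [h1.2.2, hW.2.2, (hc.W_aux 0).2.2, (hc.W_aux 1).2.2, (Chain.Adm.p_aux (c := c) y).2.2]
  split_ifs <;> ring

/-- Only the rotations at the bonds `(-1, 0)` and `(0, 1)` move `p_0`, and each squared rotation
multiplies it by `-1`; the factor `1/2` leaves rate `1`. With rate `2` from the flips, the total
relaxation rate is `3γ`. -/
lemma Chain.Regular.exchangeNoise_symCurrent (hc : c.Regular) (ω : Config) :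
    exchangeNoise c.symCurrent ω = -c.symCurrent ω := by
  have hdp := dp_symCurrent hc
  have r0 : rot 0 c.symCurrent = fun ω => -1 * ((ω 1).2 * (c.W 0 ω + c.W 1 ω)) := by
    funext ω
    simp [rot, hdp]
    ring
  have r1 : rot (-1) c.symCurrent = fun ω => (ω (-1)).2 * (c.W 0 ω + c.W 1 ω) := by
    funext ω
    simp [rot, hdp]
    ring
  have hz : ∀ x ∉ ({-1, 0} : Finset ℤ), rot x (rot x c.symCurrent) ω = 0 := by
    intro x hx
    refine rot_rot_eq_zero (fun ω => ?_) ω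
    simp only [Finset.mem_insert, Finset.mem_singleton, not_or] at hx
    have h1 : (0 : ℤ) ≠ x := fun h => hx.2 h.symm
    have h2 : (0 : ℤ) ≠ x + 1 := fun h => hx.1 (by omega)
    simp [rot, hdp, h1, h2]
  have hA : c.Adm fun ω => (ω 1).2 * (c.W 0 ω + c.W 1 ω) :=
    ((Adm2.p 1).mul ((hc.adm2_W 0).add (hc.adm2_W 1))).adm
  have hd : ∀ x ω, dp x (fun ω => -1 * ((ω 1).2 * (c.W 0 ω + c.W 1 ω))) ω
      = -1 * dp x (fun ω => (ω 1).2 * (c.W 0 ω + c.W 1 ω)) ω := fun x ω => by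
    rw [(Adm.mul_aux (Adm.const_aux (c := c) (-1)).1 hA).2.2, (Adm.const_aux (c := c) (-1)).2.2]
    ring
  rw [exchangeNoise, tsum_eq_sum hz, Finset.sum_pair (by norm_num), r0, r1]
  simp only [rot, hd, dp_p_mul_W hc]
  simp [symCurrent]
  ring

/-- The potential of the spatial gradient in `liouville_symCurrent`. -/
def Chain.symCurrentPotential (c : Chain) (a : ℝ) (ω : Config) : ℝ :=
  (ω (-1)).2 * ((ω 0).2 * (c.W 0 ω - a)) - (c.W 0 ω * c.W 0 ω + (ω 0).2 * ((ω 0).2 * c.W 0 ω))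

lemma Chain.Regular.adm2_symCurrentPotential (hc : c.Regular) (a : ℝ) :
    c.Adm2 (c.symCurrentPotential a) :=
  ((Adm2.p (-1)).mul ((Adm2.p 0).mul ((hc.adm2_W 0).sub (Adm2.const a)))).sub
    (((hc.adm2_W 0).mul (hc.adm2_W 0)).add ((Adm2.p 0).mul ((Adm2.p 0).mul (hc.adm2_W 0))))

/-- The Toda identity enters here. With `V'' = a - V'`, the products of neighbouring momenta,
including all terms in `a`, form a spatial gradient, as do the squares of `V'`; a single-bond
expression in `p_1² - p_0²` remains. -/
lemma Chain.Regular.liouville_symCurrent (hc : c.Regular) {a : ℝ}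
    (hV : ∀ r, deriv (deriv c.V) r = a - deriv c.V r) (ω : Config) :
    c.liouville c.symCurrent ω = c.symCurrentDrift ω
      + (c.symCurrentPotential a (shift 1 ω) - c.symCurrentPotential a ω) := by
  rw [Chain.liouville_eq_sum (I := {0, 1}) fun x hx =>
    c.liouvilleTerm_eq_zero c.symCurrent_dependsOn (by simpa using hx),
    Finset.sum_pair (by norm_num)]
  simp only [liouvilleTerm, dp_symCurrent hc, dr_symCurrent hc, hV]
  simp [symCurrentDrift, symCurrentPotential, shift, W]
  ring

/-- The adjoint is moved onto `symCurrent`, where the noise gives the eigenvalue `-3γ` and the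
gradient drops out. This weak form suffices: `symCurrent` need not be shown to lie in the domain of
the closure. -/
lemma Chain.Regular.semiInner_symCurrent_gen (hc : c.Regular) {a : ℝ}
    (hV : ∀ r, deriv (deriv c.V) r = a - deriv c.V r) (hf : c.Adm2 f) :
    c.semiInner c.symCurrent (c.gen f)
      = -(3 * c.γ * c.semiInner c.symCurrent f + c.semiInner c.symCurrentDrift f) := by
  have hk := hc.adm2_symCurrent.adm.mod
  have hm := hc.adm2_symCurrentDrift.adm.mod
  have hG := (hc.adm2_symCurrentPotential a).adm.mod
  have e : c.genAdj c.symCurrent = fun ω => (-(3 * c.γ)) * c.symCurrent ω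
      - (c.symCurrentDrift ω
        + (c.symCurrentPotential a (shift 1 ω) - c.symCurrentPotential a ω)) := by
    funext ω
    rw [Chain.genAdj, hc.liouville_symCurrent hV, c.flipNoise_symCurrent,
      hc.exchangeNoise_symCurrent]
    ring
  rw [hc.adm2_symCurrent.semiInner_gen hc hf, e,
    (hk.const_mul _).semiInner_sub_left (hm.add ((hG.shift 1).sub hG)) hf.adm.mod,
    hm.semiInner_add_gradient_left hG hf.adm.mod, hk.semiInner_const_mul_left hf.adm.mod]
  ring

/-- The bond energy does not depend on the momenta, so the noise vanishes on it. -/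
lemma Chain.Regular.genAdj_bondEnergy (hc : c.Regular) (ω : Config) :
    c.genAdj (fun ω => c.V (ω 1).1) ω = -c.bondDrift ω := by
  obtain ⟨-, h1, h2⟩ := Adm.r_aux hc.diff hc.memLp hc.memLp_deriv (c := c) 1
  have e1 : c.liouville (fun ω => c.V (ω 1).1) ω = c.bondDrift ω := by
    rw [Chain.liouville, tsum_eq_single 1 fun x hx => by simp [h1, h2, hx.symm]]
    simp [h1, h2, bondDrift, W]
  have e2 : flipNoise (fun ω => c.V (ω 1).1) ω = 0 := by
    have : ∀ x : ℤ, (flipAt x ω 1).1 = (ω 1).1 := fun x => by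
      by_cases h : x = 1
      · subst h; simp [flipAt]
      · simp [flipAt, Ne.symm h]
    simp [flipNoise, this]
  have e3 : exchangeNoise (fun ω => c.V (ω 1).1) ω = 0 := by
    have : ∀ x ω, rot x (fun ω => c.V (ω 1).1) ω = 0 := fun x ω => by simp [rot, h2]
    simp [exchangeNoise, fun x => rot_rot_eq_zero (this x) ω]
  rw [Chain.genAdj, e1, e2, e3]
  ring

lemma Chain.Regular.semiInner_bondEnergy_gen (hc : c.Regular) (hf : c.Adm2 f) :
    c.semiInner (fun ω => c.V (ω 1).1) (c.gen f) = -c.semiInner c.bondDrift f := by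
  have e : c.genAdj (fun ω => c.V (ω 1).1) = fun ω => (-1) * c.bondDrift ω := by
    funext ω
    rw [hc.genAdj_bondEnergy]
    ring
  rw [hc.adm2_bondEnergy.semiInner_gen hc hf, e,
    hc.adm2_bondDrift.adm.mod.semiInner_const_mul_left hf.adm.mod]
  ring

/-! ### The bounds -/

/-- The momentum exchange component of the gradient in the variational bounds. -/
def Chain.exchangeField (c : Chain) (s t : ℝ) (ω : Config) : ℝ :=
  ((ω 0).2 * (s * (c.W 1 ω + c.W 2 ω)) - (ω 1).2 * (s * (c.W 0 ω + c.W 1 ω)))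
    - (ω 0).2 * ((ω 1).2 * (2 * t * c.W 1 ω))

lemma Chain.Regular.adm2_exchangeField (hc : c.Regular) (s t : ℝ) :
    c.Adm2 (c.exchangeField s t) :=
  (((Adm2.p 0).mul ((Adm2.const s).mul ((hc.adm2_W 1).add (hc.adm2_W 2)))).sub
    ((Adm2.p 1).mul ((Adm2.const s).mul ((hc.adm2_W 0).add (hc.adm2_W 1))))).sub
    ((Adm2.p 0).mul ((Adm2.p 1).mul ((Adm2.const (2 * t)).mul (hc.adm2_W 1))))

lemma dp_exchangeField_zero (c : Chain) (s t : ℝ) (ω : Config) :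
    dp 0 (c.exchangeField s t) ω
      = s * (c.W 1 ω + c.W 2 ω) - (ω 1).2 * (2 * t * c.W 1 ω) := by
  have : HasDerivAt (fun p => c.exchangeField s t (setP 0 (ω, p)))
      (s * (c.W 1 ω + c.W 2 ω) - (ω 1).2 * (2 * t * c.W 1 ω)) (ω 0).2 := by
    have e : (fun p => c.exchangeField s t (setP 0 (ω, p)))
        = fun p => p * (s * (c.W 1 ω + c.W 2 ω)) - (ω 1).2 * (s * (c.W 0 ω + c.W 1 ω))
          - p * ((ω 1).2 * (2 * t * c.W 1 ω)) := by
      funext p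
      simp [Chain.exchangeField, setP_apply, Chain.W]
    rw [e]
    refine ((((hasDerivAt_id' (ω 0).2).mul_const (s * (c.W 1 ω + c.W 2 ω))).sub_const
      ((ω 1).2 * (s * (c.W 0 ω + c.W 1 ω)))).sub
      ((hasDerivAt_id' (ω 0).2).mul_const ((ω 1).2 * (2 * t * c.W 1 ω)))).congr_deriv ?_
    ring
  exact this.deriv

lemma dp_exchangeField_one (c : Chain) (s t : ℝ) (ω : Config) :
    dp 1 (c.exchangeField s t) ω
      = -(s * (c.W 0 ω + c.W 1 ω)) - (ω 0).2 * (2 * t * c.W 1 ω) := by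
  have : HasDerivAt (fun p => c.exchangeField s t (setP 1 (ω, p)))
      (-(s * (c.W 0 ω + c.W 1 ω)) - (ω 0).2 * (2 * t * c.W 1 ω)) (ω 1).2 := by
    have e : (fun p => c.exchangeField s t (setP 1 (ω, p)))
        = fun p => (ω 0).2 * (s * (c.W 1 ω + c.W 2 ω)) - p * (s * (c.W 0 ω + c.W 1 ω))
          - (ω 0).2 * (p * (2 * t * c.W 1 ω)) := by
      funext p
      simp [Chain.exchangeField, setP_apply, Chain.W]
    rw [e]
    refine ((((hasDerivAt_id' (ω 1).2).mul_const (s * (c.W 0 ω + c.W 1 ω))).const_sub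
      ((ω 0).2 * (s * (c.W 1 ω + c.W 2 ω)))).sub
      (((hasDerivAt_id' (ω 1).2).mul_const (2 * t * c.W 1 ω)).const_mul (ω 0).2)).congr_deriv ?_
    ring
  exact this.deriv

/-- This explains the choice of the field. Its `s`-part is `s` times `rot 0` of `symCurrent` plus
its translate, and a second rotation reproduces these two with a minus sign. Its `t`-part uses that
`rot 0` sends `p_0 p_1` to `p_1² - p_0²`. -/
lemma rot_exchangeField (c : Chain) (s t : ℝ) (ω : Config) :
    rot 0 (c.exchangeField s t) ω
      = ((-s) * c.symCurrent (shift 1 ω) + (-s) * c.symCurrent ω)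
        + (-2 * t) * c.symCurrentDrift ω := by
  rw [rot, zero_add, dp_exchangeField_zero, dp_exchangeField_one]
  simp [Chain.symCurrent, Chain.symCurrentDrift, shift, Chain.W]
  ring

/-- The three summands are orthogonal: every cross term is linear in one of the two momenta. Each of
the two `s`-squares has mean `s² * T * 2Ta`, and the `t`-square has mean `4 t² * T * T * Ta`. -/
lemma Chain.Regular.integral_exchangeField_sq (hc : c.Regular) {a : ℝ}
    (hV : ∀ r, deriv (deriv c.V) r = a - deriv c.V r) (s t : ℝ) :
    ∫ ω, c.exchangeField s t ω ^ 2 ∂c.gibbs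
      = 4 * s ^ 2 * c.T ^ 2 * a + 4 * t ^ 2 * c.T ^ 3 * a := by
  have hA := (hc.adm2_W 1).add (hc.adm2_W 2)
  have hB := (hc.adm2_W 0).add (hc.adm2_W 1)
  have hW := hc.adm2_W 1
  have p0 := Adm2.p (c := c) 0
  have p1 := Adm2.p (c := c) 1
  have n1 := hA.mul hA
  have n2 := hB.mul hB
  have n3 := hW.mul hW
  have n3' := (p1.mul p1).mul n3
  have n4 := p1.mul (hA.mul hB)
  have n5 := (p0.mul p0).mul (hA.mul hW)
  have n6 := (p1.mul p1).mul (hB.mul hW)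
  have i1 : ∫ ω, (ω 0).2 ^ 2 * ((c.W 1 ω + c.W 2 ω) * (c.W 1 ω + c.W 2 ω)) ∂c.gibbs
      = c.T * (2 * (c.T * a)) := by
    rw [n1.adm.integral_p_sq_mul fun ω q => by simp [W, setP_apply]]
    simp only [← pow_two]
    rw [hc.integral_W_add_W_sq hV (by norm_num)]
  have i2 : ∫ ω, (ω 1).2 ^ 2 * ((c.W 0 ω + c.W 1 ω) * (c.W 0 ω + c.W 1 ω)) ∂c.gibbs
      = c.T * (2 * (c.T * a)) := by
    rw [n2.adm.integral_p_sq_mul fun ω q => by simp [W, setP_apply]]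
    simp only [← pow_two]
    rw [hc.integral_W_add_W_sq hV (by norm_num)]
  have i3 : ∫ ω, (ω 0).2 ^ 2 * ((ω 1).2 * (ω 1).2 * (c.W 1 ω * c.W 1 ω)) ∂c.gibbs
      = c.T * (c.T * (c.T * a)) := by
    rw [n3'.adm.integral_p_sq_mul fun ω q => by simp [W, setP_apply]]
    simp only [← pow_two ((_ : Config) 1).2]
    rw [n3.adm.integral_p_sq_mul fun ω q => by simp [W, setP_apply]]
    simp only [← pow_two]
    rw [hc.integral_W_sq hV]
  have i4 : ∫ ω, (ω 0).2 * ((ω 1).2 * ((c.W 1 ω + c.W 2 ω) * (c.W 0 ω + c.W 1 ω))) ∂c.gibbs = 0 :=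
    n4.adm.integral_p_mul fun ω q => by simp [W, setP_apply]
  have i5 : ∫ ω, (ω 1).2 * ((ω 0).2 * (ω 0).2 * ((c.W 1 ω + c.W 2 ω) * c.W 1 ω)) ∂c.gibbs = 0 :=
    n5.adm.integral_p_mul fun ω q => by simp [W, setP_apply]
  have i6 : ∫ ω, (ω 0).2 * ((ω 1).2 * (ω 1).2 * ((c.W 0 ω + c.W 1 ω) * c.W 1 ω)) ∂c.gibbs = 0 :=
    n6.adm.integral_p_mul fun ω q => by simp [W, setP_apply]
  simp only [pow_two ((_ : Config) _).2] at i1 i2 i3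
  have m1 := ((p0.mul p0).mul n1).adm.mod
  have m2 := ((p1.mul p1).mul n2).adm.mod
  have m3 := ((p0.mul p0).mul n3').adm.mod
  have m4 := (p0.mul n4).adm.mod
  have m5 := (p1.mul n5).adm.mod
  have m6 := (p0.mul n6).adm.mod
  have e : ∀ ω, c.exchangeField s t ω ^ 2
      = s ^ 2 * ((ω 0).2 * (ω 0).2 * ((c.W 1 ω + c.W 2 ω) * (c.W 1 ω + c.W 2 ω)))
      + (s ^ 2 * ((ω 1).2 * (ω 1).2 * ((c.W 0 ω + c.W 1 ω) * (c.W 0 ω + c.W 1 ω)))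
      + (4 * t ^ 2 * ((ω 0).2 * (ω 0).2 * ((ω 1).2 * (ω 1).2 * (c.W 1 ω * c.W 1 ω)))
      + (-2 * s ^ 2 * ((ω 0).2 * ((ω 1).2 * ((c.W 1 ω + c.W 2 ω) * (c.W 0 ω + c.W 1 ω))))
      + (-4 * s * t * ((ω 1).2 * ((ω 0).2 * (ω 0).2 * ((c.W 1 ω + c.W 2 ω) * c.W 1 ω)))
      + 4 * s * t * ((ω 0).2 * ((ω 1).2 * (ω 1).2 * ((c.W 0 ω + c.W 1 ω) * c.W 1 ω))))))) :=
    fun ω => by rw [exchangeField]; ring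
  have q6 := m6.const_mul (4 * s * t)
  have q5 := (m5.const_mul (-4 * s * t)).add q6
  have q4 := (m4.const_mul (-2 * s ^ 2)).add q5
  have q3 := (m3.const_mul (4 * t ^ 2)).add q4
  have q2 := (m2.const_mul (s ^ 2)).add q3
  simp only [e]
  rw [integral_add (m1.const_mul _).integrable q2.integrable,
    integral_add (m2.const_mul _).integrable q3.integrable,
    integral_add (m3.const_mul _).integrable q4.integrable,
    integral_add (m4.const_mul _).integrable q5.integrable,
    integral_add (m5.const_mul _).integrable q6.integrable]
  simp only [integral_const_mul, i1, i2, i3, i4, i5, i6]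
  ring

lemma Chain.Regular.integral_flipField_sq (hc : c.Regular) {a : ℝ}
    (hV : ∀ r, deriv (deriv c.V) r = a - deriv c.V r) (s : ℝ) :
    ∫ ω, ((-2 * s) * c.symCurrent ω) ^ 2 ∂c.gibbs = 8 * s ^ 2 * c.T ^ 2 * a := by
  have hB := (hc.adm2_W 0).add (hc.adm2_W 1)
  have n2 := hB.mul hB
  have i1 := n2.adm.integral_p_sq_mul (x := 0) fun ω q => by simp [W, setP_apply]
  simp only [← pow_two] at i1
  rw [hc.integral_W_add_W_sq hV (by norm_num)] at i1
  have e : ∀ ω, ((-2 * s) * c.symCurrent ω) ^ 2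
      = 4 * s ^ 2 * ((ω 0).2 ^ 2 * (c.W 0 ω + c.W 1 ω) ^ 2) := fun ω => by
    rw [symCurrent]; ring
  simp only [e]
  rw [integral_const_mul, i1]
  ring

/-- Duality with flip component `-2s` times `symCurrent` and rotation component `exchangeField s t`.
The divergences add up to `-2` times the combination on the left: `6s = 4s + 2s`, from flip and
rotation. The energies add up to `4 (3 s² T² a + t² T³ a)`, and the factor `4` cancels. -/
lemma Chain.Regular.sq_semiInner_le (hc : c.Regular) {a : ℝ}
    (hV : ∀ r, deriv (deriv c.V) r = a - deriv c.V r) (hf : c.Adm2 f) (s t : ℝ) :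
    (3 * s * c.semiInner c.symCurrent f + t * c.semiInner c.symCurrentDrift f) ^ 2
      ≤ (3 * s ^ 2 * c.T ^ 2 * a + t ^ 2 * c.T ^ 3 * a)
        * (2 / c.γ * -c.semiInner f (c.gen f)) := by
  have hk := hc.adm2_symCurrent.adm.mod
  have hm := hc.adm2_symCurrentDrift.adm.mod
  have key := hf.sq_pairing_le hc (α := fun ω => (-2 * s) * c.symCurrent ω)
    (β := c.exchangeField s t) (hk.const_mul _)
    (fun ω => by simp [symCurrent, W, flipAt]) (hc.adm2_exchangeField s t).adm
  rw [hc.integral_flipField_sq hV, hc.integral_exchangeField_sq hV,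
    hk.semiInner_const_mul_left hf.adm.mod, funext (rot_exchangeField c s t),
    (((hk.shift 1).const_mul _).add (hk.const_mul _)).semiInner_add_left (hm.const_mul _) hf.adm.mod,
    ((hk.shift 1).const_mul _).semiInner_add_left (hk.const_mul _) hf.adm.mod,
    (hk.shift 1).semiInner_const_mul_left hf.adm.mod, hk.semiInner_const_mul_left hf.adm.mod,
    hm.semiInner_const_mul_left hf.adm.mod, hk.semiInner_shift_left hf.adm.mod] at key
  linarith

/-! ### The current -/

lemma Chain.current_eq (c : Chain) (ω : Config) : c.current ω = -((ω 0).2 * c.W 1 ω) := by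
  simp [current, W]

lemma Chain.Regular.adm2_current (hc : c.Regular) : c.Adm2 c.current := by
  rw [funext c.current_eq]
  exact ((Adm2.p 0).mul (hc.adm2_W 1)).neg

lemma Chain.Regular.integral_current (hc : c.Regular) : ∫ ω, c.current ω ∂c.gibbs = 0 :=
  integral_eq_zero_of_odd (x := 0) hc.adm2_current.adm.mod fun ω => by
    simp [current_eq, W, flipAt]

/-- Each term is the mean of `p_z` times a function of the distances alone. -/
lemma Chain.Regular.semiInner_bondEnergy_current (hc : c.Regular) :
    c.semiInner (fun ω => c.V (ω 1).1) c.current = 0 := by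
  rw [c.semiInner_eq_of_integral_right _ hc.integral_current]
  refine (tsum_congr fun z => ?_).trans tsum_zero
  have h := (hc.adm2_bondEnergy.mul (hc.adm2_W (1 + z))).adm.integral_p_mul (x := z)
    fun ω s => by
      simp only [W, setP_apply]
      split_ifs <;> rfl
  have e : ∀ ω, c.V (ω 1).1 * c.current (shift z ω)
      = -((ω z).2 * (c.V (ω 1).1 * c.W (1 + z) ω)) := fun ω => by
    simp [current_eq, shift, W]
    ring
  simp only [e]
  rw [integral_neg, h, neg_zero]

/-- For `z ≠ 0` the term is linear in `p_z` and vanishes. At `z = 0`, `p_0²` contributes `T` and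
`V'(r_1)²` contributes `T a`, while distinct bonds are orthogonal. -/
lemma Chain.Regular.semiInner_symCurrent_current (hc : c.Regular) {a : ℝ}
    (hV : ∀ r, deriv (deriv c.V) r = a - deriv c.V r) :
    c.semiInner c.symCurrent c.current = c.T ^ 2 * a := by
  have hB := (hc.adm2_W 0).add (hc.adm2_W 1)
  have e : ∀ z ω, c.symCurrent ω * c.current (shift z ω)
      = (ω z).2 * ((ω 0).2 * ((c.W 0 ω + c.W 1 ω) * c.W (1 + z) ω)) := fun z ω => by
    simp [current_eq, symCurrent, shift, W]
    ring
  rw [c.semiInner_eq_of_integral_right _ hc.integral_current, tsum_eq_single 0]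
  · simp only [e, add_zero]
    have e' : ∀ ω : Config, (ω 0).2 * ((ω 0).2 * ((c.W 0 ω + c.W 1 ω) * c.W 1 ω))
        = (ω 0).2 ^ 2 * ((c.W 0 ω + c.W 1 ω) * c.W 1 ω) := fun ω => by ring
    simp only [e']
    rw [(hB.mul (hc.adm2_W 1)).adm.integral_p_sq_mul fun ω q => by simp [W, setP_apply]]
    have e'' : ∀ ω : Config, (c.W 0 ω + c.W 1 ω) * c.W 1 ω
        = c.W 0 ω * c.W 1 ω + c.W 1 ω ^ 2 := fun ω => by ring
    have h0 := (hc.adm2_W 0).adm.mod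
    have h1 := (hc.adm2_W 1).adm.mod
    simp only [e'']
    rw [integral_add (h0.mul h1).integrable (by simpa [pow_two] using (h1.mul h1).integrable),
      hc.integral_W_mul_W (by norm_num), hc.integral_W_sq hV]
    ring
  · intro z hz
    simp only [e]
    refine ((Adm2.p 0).mul (hB.mul (hc.adm2_W (1 + z)))).adm.integral_p_mul fun ω s => ?_
    simp only [W, setP_apply, hz.symm, if_false]
    split_ifs <;> rfl

/-- The current is, up to a gradient, half of the symmetrised current plus half of the derivative
of the bond energy. -/
lemma Chain.Regular.semiInner_current (hc : c.Regular) (hf : c.Mod f) :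
    c.semiInner c.current f
      = 2⁻¹ * c.semiInner c.symCurrent f + 2⁻¹ * c.semiInner c.bondDrift f := by
  have hk := hc.adm2_symCurrent.adm.mod
  have hb := hc.adm2_bondDrift.adm.mod
  have hj := hc.adm2_current.adm.mod
  -- Adding the gradient of `p_0 V'(r_0) / 2` to the current gives `(symCurrent + bondDrift) / 2`
  -- exactly.
  have hG := (((Adm2.p 0).mul (hc.adm2_W 0)).adm.mod).const_mul 2⁻¹
  rw [← hj.semiInner_add_gradient_left hG hf, ← hk.semiInner_const_mul_left hf,
    ← hb.semiInner_const_mul_left hf, ← (hk.const_mul _).semiInner_add_left (hb.const_mul _) hf]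
  congr 1
  funext ω
  simp [current_eq, symCurrent, bondDrift, shift, W]
  ring

end

end OscillatorChain

/-! ### Passage to the Hilbert space, and the Toda potential. -/

namespace OscillatorChain

noncomputable section

/-! ### The reversal on the Hilbert space -/

variable {c : Chain}

/-- The reversal preserves the Gibbs measure and commutes with shifts. Measurability alone is
assumed because this is applied to all local functions, not only to those with finite moments. -/
lemma semiInner_rev_rev {f g : Config → ℝ} (hf : Measurable f) (hg : Measurable g) :
    c.semiInner (rev f) (rev g) = c.semiInner f g := by
  have h : ∀ {k : Config → ℝ}, Measurable k → ∫ ω, rev k ω ∂c.gibbs = ∫ ω, k ω ∂c.gibbs := by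
    intro k hk
    have hm := measurePreserving_flipOn c Set.univ
    conv_rhs => rw [← hm.map_eq]
    rw [integral_map hm.aemeasurable]
    · rfl
    · exact hk.aestronglyMeasurable
  rw [Chain.semiInner, Chain.semiInner, h hf, h hg]
  refine tsum_congr fun z => ?_
  congr 1
  have h' := h (k := fun ω => f ω * g (shift z ω)) (hf.mul (hg.comp (measurable_shift z)))
  rw [← h']
  simp only [rev, shift_flipOn, Set.preimage_univ]

lemma rev_rev (f : Config → ℝ) : rev (rev f) = f := by
  funext ω; simp [rev, flipOn_self]

/-- The reversal of the momenta on local functions. -/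
def Chain.revLocal (c : Chain) : c.LocalFun →ₗ[ℝ] c.LocalFun where
  toFun f := (⟨rev f, by
    obtain ⟨h1, ⟨Λ, h2⟩, h3⟩ := LocalFun.mem c f
    have hm := measurePreserving_flipOn c Set.univ
    exact ⟨h1.comp hm.measurable, ⟨Λ, fun x y hxy => h2 fun i hi => by simp [flipOn, hxy i hi]⟩,
      h3.comp_measurePreserving hm⟩⟩ : c.localSubmodule)
  map_add' _ _ := rfl
  map_smul' _ _ := rfl

lemma Chain.revLocal_fn (f : c.LocalFun) : (c.revLocal f).fn = rev f.fn := rfl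

lemma Chain.inner_local (f g : c.LocalFun) : inner ℝ f g = c.semiInner f g := rfl

/-- The reversal of the momenta on the Hilbert space. -/
def Chain.revH (c : Chain) : c.H →L[ℝ] c.H :=
  (c.revLocal.mkContinuous 1 fun f => by
    rw [one_mul]
    refine le_of_eq ((sq_eq_sq₀ (norm_nonneg _) (norm_nonneg _)).1 ?_)
    rw [← real_inner_self_eq_norm_sq, ← real_inner_self_eq_norm_sq, Chain.inner_local,
      Chain.inner_local, Chain.revLocal_fn,
      semiInner_rev_rev (LocalFun.measurable c f) (LocalFun.measurable c f)]).completion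

lemma Chain.revH_toH (f : c.LocalFun) : c.revH (c.toH f) = c.toH (c.revLocal f) :=
  ContinuousLinearMap.completion_apply_coe _ f

lemma Chain.inner_toH (f g : c.LocalFun) : inner ℝ (c.toH f) (c.toH g) = c.semiInner f g :=
  UniformSpace.Completion.inner_coe f g

lemma Chain.revH_revH (u : c.H) : c.revH (c.revH u) = u := by
  induction u using UniformSpace.Completion.induction_on with
  | hp => exact isClosed_eq (c.revH.continuous.comp c.revH.continuous) continuous_id
  | ih f =>
    change c.revH (c.revH (c.toH f)) = c.toH f
    rw [Chain.revH_toH, Chain.revH_toH]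
    congr 1
    exact Subtype.ext (rev_rev f.fn)

lemma Chain.inner_revH (u w : c.H) : inner ℝ (c.revH u) w = inner ℝ u (c.revH w) := by
  induction u, w using UniformSpace.Completion.induction_on₂ with
  | hp => exact isClosed_eq (by fun_prop) (by fun_prop)
  | ih f g =>
    change inner ℝ (c.revH (c.toH f)) (c.toH g) = inner ℝ (c.toH f) (c.revH (c.toH g))
    rw [Chain.revH_toH, Chain.revH_toH, Chain.inner_toH, Chain.inner_toH]
    have h := semiInner_rev_rev (c := c) (LocalFun.measurable c f)
      (LocalFun.measurable c (c.revLocal g))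
    rw [Chain.revLocal_fn, rev_rev] at h
    exact h

lemma Chain.revH_norm_sq (u : c.H) : ‖c.revH u‖ ^ 2 = ‖u‖ ^ 2 := by
  rw [← real_inner_self_eq_norm_sq, ← real_inner_self_eq_norm_sq, Chain.inner_revH,
    Chain.revH_revH]

/-! ### Properties of the generator -/

/-- A closed property of pairs in `ℋ × ℋ` holds on the graph of the generator if it holds for
the pairs `(f, 𝔏' f)` with `f` in `C_0^2`. -/
lemma Chain.forall_mem_closure_testGraph {p : c.H × c.H → Prop} (hp : IsClosed {z | p z})
    (h : ∀ f g : c.LocalFun, c.Adm2 f.fn → c.Mod g.fn → g.fn = c.gen f.fn → p (c.toH f, c.toH g))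
    (hc : c.Regular) : ∀ z ∈ closure c.testGraph, p z := by
  refine closure_minimal ?_ hp
  rintro _ ⟨f, g, hf, hg, rfl⟩
  have hf' : c.Adm2 f.fn := hf.adm2 c
  have e : g.fn = c.gen f.fn := funext hg
  exact h f g hf' (by rw [e]; exact hf'.mod_gen hc) e

/-- `R` is isometric and self-adjoint, so `‖u - R u‖² = 2 ⟪u - R u, u⟫`; hence the constant `γ / 2`.
-/
lemma Chain.Regular.coercive (hc : c.Regular) : ∀ z ∈ closure c.testGraph,
    c.γ / 2 * ‖z.1 - c.revH z.1‖ ^ 2 ≤ -inner ℝ z.1 z.2 := by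
  refine Chain.forall_mem_closure_testGraph (isClosed_le (by fun_prop) (by fun_prop))
    (fun f g hf hg e => ?_) hc
  have h1 := hf.semiInner_sub_rev_le hc
  rw [hf.adm.mod.semiInner_sub_left hf.rev.adm.mod hf.adm.mod, ← e] at h1
  have h2 := norm_sub_sq_real (c.toH f) (c.revH (c.toH f))
  have h3 := real_inner_self_eq_norm_sq (c.toH f)
  rw [Chain.inner_toH] at h3
  rw [Chain.revH_norm_sq, ← Chain.inner_revH, Chain.revH_toH, Chain.inner_toH,
    Chain.revLocal_fn, ← h3] at h2
  simp only [Chain.inner_toH, Chain.revH_toH]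
  rw [h2]
  linarith

/-- For each fixed value of one argument the relation is closed in the other, so it extends from
test functions one argument at a time. -/
lemma Chain.Regular.symmetric (hc : c.Regular) : ∀ z ∈ closure c.testGraph,
    ∀ z' ∈ closure c.testGraph, inner ℝ (c.revH z.1) z'.2 = inner ℝ (c.revH z.2) z'.1 := by
  refine Chain.forall_mem_closure_testGraph (p := fun z => ∀ z' ∈ closure c.testGraph,
    inner ℝ (c.revH z.1) z'.2 = inner ℝ (c.revH z.2) z'.1) ?_ (fun f g hf hg e => ?_) hc
  · simp only [Set.ofPred_forall]
    exact isClosed_biInter fun z' _ => isClosed_eq (by fun_prop) (by fun_prop)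
  · refine Chain.forall_mem_closure_testGraph (isClosed_eq (by fun_prop) (by fun_prop))
      (fun f' g' hf' hg' e' => ?_) hc
    simp only [Chain.revH_toH, Chain.inner_toH, Chain.revLocal_fn]
    rw [e, e', hf.semiInner_rev_gen hc hf']

variable {a : ℝ}

lemma Chain.Regular.inner_symCurrent (hc : c.Regular)
    (hV : ∀ r, deriv (deriv c.V) r = a - deriv c.V r) : ∀ z ∈ closure c.testGraph,
    inner ℝ (c.toH hc.adm2_symCurrent.adm.mod.toLoc) z.2
      = -(3 * c.γ * inner ℝ (c.toH hc.adm2_symCurrent.adm.mod.toLoc) z.1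
        + inner ℝ (c.toH hc.adm2_symCurrentDrift.adm.mod.toLoc) z.1) := by
  refine Chain.forall_mem_closure_testGraph (isClosed_eq (by fun_prop) (by fun_prop))
    (fun f g hf hg e => ?_) hc
  simp only [Chain.inner_toH, Chain.Mod.toLoc_fn]
  rw [e, hc.semiInner_symCurrent_gen hV hf]

lemma Chain.Regular.inner_bondEnergy (hc : c.Regular) : ∀ z ∈ closure c.testGraph,
    inner ℝ (c.toH hc.adm2_bondEnergy.adm.mod.toLoc) z.2
      = -inner ℝ (c.toH hc.adm2_bondDrift.adm.mod.toLoc) z.1 := by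
  refine Chain.forall_mem_closure_testGraph (isClosed_eq (by fun_prop) (by fun_prop))
    (fun f g hf hg e => ?_) hc
  simp only [Chain.inner_toH, Chain.Mod.toLoc_fn]
  rw [e, hc.semiInner_bondEnergy_gen hf]

lemma Chain.Regular.sq_inner_le (hc : c.Regular)
    (hV : ∀ r, deriv (deriv c.V) r = a - deriv c.V r) (s t : ℝ) : ∀ z ∈ closure c.testGraph,
    (3 * s * inner ℝ (c.toH hc.adm2_symCurrent.adm.mod.toLoc) z.1
        + t * inner ℝ (c.toH hc.adm2_symCurrentDrift.adm.mod.toLoc) z.1) ^ 2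
      ≤ (3 * s ^ 2 * c.T ^ 2 * a + t ^ 2 * c.T ^ 3 * a) * (2 / c.γ * -inner ℝ z.1 z.2) := by
  refine Chain.forall_mem_closure_testGraph (isClosed_le (by fun_prop) (by fun_prop))
    (fun f g hf hg e => ?_) hc
  simp only [Chain.inner_toH, Chain.Mod.toLoc_fn]
  rw [e]
  exact hc.sq_semiInner_le hV hf s t

/-- The two sides have the same pairing with every local function with finite moments. Their
difference is a combination of such functions, hence orthogonal to itself. -/
lemma Chain.Regular.toH_current (hc : c.Regular) :
    c.toH hc.adm2_current.adm.mod.toLoc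
      = (2⁻¹ : ℝ) • c.toH hc.adm2_symCurrent.adm.mod.toLoc
        + (2⁻¹ : ℝ) • c.toH hc.adm2_bondDrift.adm.mod.toLoc := by
  set j := c.toH hc.adm2_current.adm.mod.toLoc with hj
  set k := c.toH hc.adm2_symCurrent.adm.mod.toLoc with hk
  set b := c.toH hc.adm2_bondDrift.adm.mod.toLoc with hb
  have h : ∀ {f : Config → ℝ} (hf : c.Mod f),
      inner ℝ (j - ((2⁻¹ : ℝ) • k + (2⁻¹ : ℝ) • b)) (c.toH hf.toLoc) = 0 := by
    intro f hf
    rw [inner_sub_left, inner_add_left, real_inner_smul_left, real_inner_smul_left, hj, hk, hb]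
    simp only [Chain.inner_toH, Chain.Mod.toLoc_fn]
    rw [hc.semiInner_current hf, sub_self]
  rw [← sub_eq_zero, ← inner_self_eq_zero (𝕜 := ℝ)]
  conv_lhs => rw [inner_sub_right, inner_add_right, real_inner_smul_right, real_inner_smul_right]
  rw [h, h, h]
  simp

lemma Chain.Regular.revH_current (hc : c.Regular) :
    c.revH (c.toH hc.adm2_current.adm.mod.toLoc) = -c.toH hc.adm2_current.adm.mod.toLoc := by
  rw [Chain.revH_toH, Chain.toH, Chain.toH, ← UniformSpace.Completion.coe_neg]
  congr 1
  refine Subtype.ext (funext fun ω => ?_)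
  change rev c.current ω = -c.current ω
  simp [rev, Chain.current, flipOn]

/-- Existence of the conductivity, with bounds, for potentials with `V'' = a - V'`. -/
theorem Chain.Regular.exists_conductivity (hc : c.Regular) (ha : 0 < a)
    (hV : ∀ r, deriv (deriv c.V) r = a - deriv c.V r) (P : C0Semigroup c.H)
    (hP : c.IsDynamics P) :
    ∃ A : ℝ, (∀ κ' : ℝ, c.HasConductivity P κ' ↔ κ' = c.γ + (c.T ^ 2)⁻¹ * A) ∧
      (c.T ^ 2 * a) ^ 2 ≤ (6 * c.γ * c.T ^ 2 * a + 2 * c.T ^ 3 * a / c.γ) * A ∧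
      A ≤ c.T ^ 2 * a / (6 * c.γ) := by
  have hγ := c.γ_pos
  have hT := c.T_pos
  have hG : P.generatorGraph = closure c.testGraph := hP
  have hcoer := hc.coercive
  have hsym := hc.symmetric
  have hk := hc.inner_symCurrent hV
  have hh := hc.inner_bondEnergy
  have hsq := hc.sq_inner_le hV
  rw [← hG] at hcoer hsym hk hh hsq
  have hd : ∀ z ∈ P.generatorGraph, inner ℝ z.1 z.2 ≤ 0 := fun z hz => by
    have h1 := hcoer z hz
    have h2 : 0 ≤ c.γ / 2 * ‖z.1 - c.revH z.1‖ ^ 2 := by positivity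
    linarith
  have hcl : IsClosed P.generatorGraph := by rw [hG]; exact isClosed_closure
  set J := hc.adm2_current.adm.mod.toLoc with hJ
  -- The implication inside the existential makes the chosen solution a total function of `l`; its
  -- value `0` for `l ≤ 0` is a dummy.
  have hres : ∀ l : ℝ, ∃ z : c.H × c.H, 0 < l → z ∈ P.generatorGraph ∧ l • z.1 - z.2 = c.toH J := by
    intro l
    by_cases hl : 0 < l
    · obtain ⟨z, hz, hz'⟩ := P.exists_resolvent hcl hd hl (c.toH J)
      exact ⟨z, fun _ => ⟨hz, hz'⟩⟩
    · exact ⟨0, fun h => absurd h hl⟩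
  choose z hz using hres
  have huv : ∀ l : ℝ, 0 < l → ((z l).1, (z l).2) ∈ P.generatorGraph ∧
      l • (z l).1 - (z l).2 = c.toH J := hz
  obtain ⟨A, hA, M, hM⟩ := exists_tendsto_inner_resolvent P c.revH Chain.inner_revH
    Chain.revH_revH (by positivity : 0 < c.γ / 2) hcoer hsym hc.revH_current huv
  -- `C₁` comes from the quadratic bound with `s = γ`, `t = 1`, matching the relaxation rate `3γ`;
  -- `C₂` from `s = 1`, `t = 0`, after division by `9`.
  have hbounds := bounds_of_tendsto_inner_resolvent P hd huv hA hM hc.toH_current hk hh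
    (C₁ := 6 * c.γ * c.T ^ 2 * a + 2 * c.T ^ 3 * a / c.γ)
    (C₂ := 2 * c.T ^ 2 * a / (3 * c.γ)) (q := c.T ^ 2 * a)
    (fun z hz => by
      refine le_trans (le_of_eq ?_) ((hsq c.γ 1 z hz).trans (le_of_eq ?_))
      · ring
      · field_simp
        ring)
    (fun z hz => by
      have h1 := hsq 1 0 z hz
      have e : 2 * c.T ^ 2 * a / (3 * c.γ) * -inner ℝ z.1 z.2
          = (3 * 1 ^ 2 * c.T ^ 2 * a + 0 ^ 2 * c.T ^ 3 * a)
            * (2 / c.γ * -inner ℝ z.1 z.2) / 9 := by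
        field_simp
        ring
      rw [e, le_div_iff₀ (by norm_num)]
      refine le_trans (le_of_eq ?_) h1
      ring)
    (by positivity) (by positivity)
    (by rw [hJ, Chain.inner_toH]; exact hc.semiInner_symCurrent_current hV)
    (by rw [hJ, Chain.inner_toH]; exact hc.semiInner_bondEnergy_current)
  have hlim : Tendsto (fun l : ℝ => c.γ + (c.T ^ 2)⁻¹ * inner ℝ (c.toH J) (z l).1) (𝓝[>] 0)
      (𝓝 (c.γ + (c.T ^ 2)⁻¹ * A)) := (hA.const_mul _).const_add _
  refine ⟨A, fun κ' => ⟨?_, ?_⟩, hbounds.1, hbounds.2.trans (le_of_eq ?_)⟩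
  · rintro ⟨J', u, v, hJ', huv', hlim'⟩
    have e : J' = J := Subtype.ext (funext hJ')
    subst e
    refine tendsto_nhds_unique (hlim'.congr' ?_) hlim
    filter_upwards [self_mem_nhdsWithin] with l hl
    have hl : 0 < l := hl
    rw [P.resolvent_unique hd hl (huv' l hl).1 (huv l hl).1
      ((huv' l hl).2.trans (huv l hl).2.symm)]
  · rintro rfl
    exact ⟨J, fun l => (z l).1, fun l => (z l).2, fun _ => rfl, huv, hlim⟩
  · field_simp
    ring

/-! ### The Toda potential -/

lemma hasDerivAt_todaPotential (a r : ℝ) :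
    HasDerivAt (todaPotential a) (a - a * Real.exp (-r)) r := by
  have h := (((hasDerivAt_neg r).exp.sub_const 1).const_mul a).add ((hasDerivAt_id' r).const_mul a)
  refine h.congr_deriv ?_
  ring

lemma deriv_todaPotential (a : ℝ) : deriv (todaPotential a) = fun r => a - a * Real.exp (-r) :=
  funext fun r => (hasDerivAt_todaPotential a r).deriv

lemma hasDerivAt_deriv_todaPotential (a r : ℝ) :
    HasDerivAt (deriv (todaPotential a)) (a * Real.exp (-r)) r := by
  rw [deriv_todaPotential]
  refine (((hasDerivAt_neg r).exp.const_mul a).const_sub a).congr_deriv ?_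
  ring

lemma deriv_deriv_todaPotential (a r : ℝ) :
    deriv (deriv (todaPotential a)) r = a - deriv (todaPotential a) r := by
  rw [(hasDerivAt_deriv_todaPotential a r).deriv, deriv_todaPotential]
  ring

lemma todaPotential_nonneg {a : ℝ} (ha : 0 < a) (r : ℝ) : 0 ≤ todaPotential a r := by
  have := Real.add_one_le_exp (-r)
  unfold todaPotential
  nlinarith

/-- Amounts to `-2 r ≤ e^{-r}`. Through it the moments of `V` control those of `V'` and `V''`. -/
lemma exp_neg_le_todaPotential {a : ℝ} (ha : 0 < a) (r : ℝ) :
    a * Real.exp (-r) ≤ 2 * todaPotential a r + 2 * a := by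
  have h1 : -2 * r ≤ Real.exp (-r) := by
    rcases le_total 0 r with h | h
    · linarith [Real.exp_pos (-r)]
    · have := Real.quadratic_le_exp_of_nonneg (x := -r) (by linarith)
      nlinarith [sq_nonneg (r + 1)]
  unfold todaPotential
  nlinarith

/-- Since `V ≥ 0`, the power `V^q` is at most `q! (2T)^q e^{V/(2T)}`. This costs half of the
Boltzmann exponent, and the weight at temperature `2T` is still integrable. -/
lemma toda_regular (a γ T : ℝ) (ha : 0 < a) (hγ : 0 < γ) (hT : 0 < T) :
    (toda a γ T ha hγ hT).Regular := by
  have hd : Differentiable ℝ (todaPotential a) := fun r =>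
    (hasDerivAt_todaPotential a r).differentiableAt
  have hd' : Differentiable ℝ (deriv (todaPotential a)) := fun r =>
    (hasDerivAt_deriv_todaPotential a r).differentiableAt
  have hVq : ∀ q : ℕ, MemLp (todaPotential a) q (toda a γ T ha hγ hT).lawR := by
    intro q
    rcases Nat.eq_zero_or_pos q with rfl | hq
    · simpa using hd.continuous.aestronglyMeasurable
    have hi : Integrable (fun r => ‖todaPotential a r‖ ^ q) (toda a γ T ha hγ hT).lawR := by
      unfold Chain.lawR
      rw [integrable_tilted_iff (toda a γ T ha hγ hT).integrable_boltzmann]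
      have h1 := (integrable_toda ha (T := 2 * T) (by positivity)).const_mul
        ((q.factorial : ℝ) * (2 * T) ^ q)
      refine h1.mono' ?_ (Eventually.of_forall fun r => ?_)
      · have : Continuous fun r : ℝ => Real.exp (-todaPotential a r / T) • ‖todaPotential a r‖ ^ q := by
          have := hd.continuous
          fun_prop
        exact this.aestronglyMeasurable
      · have hV := todaPotential_nonneg ha r
        change ‖Real.exp (-todaPotential a r / T) • ‖todaPotential a r‖ ^ q‖ ≤ _
        rw [smul_eq_mul, Real.norm_of_nonneg hV, Real.norm_of_nonneg (by positivity)]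
        have h2 := Real.pow_div_factorial_le_exp (x := todaPotential a r / (2 * T))
          (by positivity) q
        rw [div_le_iff₀ (by positivity), div_pow, div_le_iff₀ (by positivity)] at h2
        have e : Real.exp (-todaPotential a r / T)
            = Real.exp (-todaPotential a r / (2 * T)) * Real.exp (-todaPotential a r / (2 * T)) := by
          rw [← Real.exp_add]
          congr 1
          field_simp
          ring
        have e' : Real.exp (-todaPotential a r / (2 * T)) * Real.exp (todaPotential a r / (2 * T))
            = 1 := by
          rw [← Real.exp_add, neg_div, neg_add_cancel, Real.exp_zero]
        have h3 := mul_le_mul_of_nonneg_left h2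
          (mul_pos (Real.exp_pos (-todaPotential a r / (2 * T)))
            (Real.exp_pos (-todaPotential a r / (2 * T)))).le
        rw [e]
        refine h3.trans (le_of_eq ?_)
        linear_combination (q.factorial * (2 * T) ^ q
          * Real.exp (-todaPotential a r / (2 * T))) * e'
    have := (integrable_norm_rpow_iff (p := (q : ENNReal)) hd.continuous.aestronglyMeasurable
      (by exact_mod_cast hq.ne') (by simp)).1 (by simpa using hi)
    exact this
  have hc : ∀ (q : ℕ) (b : ℝ), MemLp (fun _ : ℝ => b) q (toda a γ T ha hγ hT).lawR := fun q b =>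
    memLp_const b
  have hexp : ∀ r, 0 ≤ a * Real.exp (-r) := fun r => by positivity
  refine ⟨hd, hd', hVq, fun q => ?_, fun q => ?_⟩
  · have h1 := ((hVq q).const_mul 2).add (hc q (3 * a))
    refine h1.mono hd'.continuous.aestronglyMeasurable (Eventually.of_forall fun r => ?_)
    change ‖deriv (todaPotential a) r‖ ≤ ‖2 * todaPotential a r + 3 * a‖
    have h2 := exp_neg_le_todaPotential ha r
    have h3 := todaPotential_nonneg ha r
    rw [deriv_todaPotential, Real.norm_eq_abs, Real.norm_of_nonneg (by positivity), abs_le]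
    constructor <;> linarith [hexp r]
  · have h1 := ((hVq q).const_mul 2).add (hc q (2 * a))
    refine h1.mono (measurable_deriv _).aestronglyMeasurable (Eventually.of_forall fun r => ?_)
    change ‖deriv (deriv (todaPotential a)) r‖ ≤ ‖2 * todaPotential a r + 2 * a‖
    have h2 := exp_neg_le_todaPotential ha r
    have h3 := todaPotential_nonneg ha r
    rw [(hasDerivAt_deriv_todaPotential a r).deriv, Real.norm_of_nonneg (hexp r),
      Real.norm_of_nonneg (by positivity)]
    exact h2

end

end OscillatorChain

theorem proposition6p3 (a γ T : ℝ) (ha : 0 < a) (hγ : 0 < γ) (hT : 0 < T)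
    (P : OscillatorChain.C0Semigroup (OscillatorChain.toda a γ T ha hγ hT).H)
    (hP : (OscillatorChain.toda a γ T ha hγ hT).IsDynamics P) :
    ∃ κ : ℝ, (∀ κ' : ℝ,
        (OscillatorChain.toda a γ T ha hγ hT).HasConductivity P κ' ↔ κ' = κ) ∧
      γ + (6 * γ / a + 2 * T / (γ * a))⁻¹ ≤ κ ∧ κ ≤ γ + a / (6 * γ) := by
  obtain ⟨A, h1, h2, h3⟩ := (OscillatorChain.toda_regular a γ T ha hγ hT).exists_conductivity ha
    (OscillatorChain.deriv_deriv_todaPotential a) P hP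
  refine ⟨_, h1, ?_, ?_⟩
  · change (T ^ 2 * a) ^ 2 ≤ (6 * γ * T ^ 2 * a + 2 * T ^ 3 * a / γ) * A at h2
    change γ + (6 * γ / a + 2 * T / (γ * a))⁻¹ ≤ γ + (T ^ 2)⁻¹ * A
    have e : (6 * γ / a + 2 * T / (γ * a))⁻¹
        = (T ^ 2)⁻¹ * ((T ^ 2 * a) ^ 2 / (6 * γ * T ^ 2 * a + 2 * T ^ 3 * a / γ)) := by
      field_simp
    rw [e]
    have : (T ^ 2 * a) ^ 2 / (6 * γ * T ^ 2 * a + 2 * T ^ 3 * a / γ) ≤ A := by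
      rw [div_le_iff₀ (by positivity)]
      linarith
    gcongr
  · change A ≤ T ^ 2 * a / (6 * γ) at h3
    change γ + (T ^ 2)⁻¹ * A ≤ γ + a / (6 * γ)
    have e : a / (6 * γ) = (T ^ 2)⁻¹ * (T ^ 2 * a / (6 * γ)) := by field_simp
    rw [e]
    gcongr
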